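/- Let $k$ be an algebraically closed field of arbitrary characteristic, let $M$ be a free abelian group of finite rank $n$, and let $A=\{u_0,\dots,u_N\}\subset M$ be a finite set of distinct elements that spans $M$ as an affine lattice (every element of $M$ has the form $\sum_i a_iu_i$ with $a_i\in\mathbb Z$, $\sum_i a_i=1$). Let $T_M=\operatorname{Spec}k[M]$, let $X_A\subset\mathbb P^N$ be the closure of the image of $T_M\to\mathbb P^N$, $t\mapsto[z^{u_0}(t):\cdots:z^{u_N}(t)]$ (which identifies $T_M$ with an open subset of $X_A$), and let $\gamma\colon X_A\dashrightarrow\mathbb G(n,\mathbb P^N)$ be the Gauss map, which sends a smooth point $x$ to the embedded tangent space of $X_A$ at $x$; the Grassmannian is embedded in a projective space by the Plücker embedding. Put $M_k=M\otimes_{\mathbb Z}k$, $$B=\{u_{i_0}+\cdots+u_{i_n}\;|\;u_{i_0},\dots,u_{i_n}\text{ span the affine space }M_k\},$$ let $\langle B-B\rangle\subset M$ be the subgroup generated by the differences of elements of $B$, and let $\langle B-B\rangle_{\mathbb R}\cap M$ be the subgroup of the elements of $M$ that lie in the real span of $\langle B-B\rangle$ in $M\otimes_{\mathbb Z}\mathbb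 R$. Denote by $\operatorname{Aff}(B)\subset M$ the affine sublattice and by $\operatorname{Aff}_k(B)\subset M_k$ the affine subspace spanned by $B$. The restriction of $\gamma$ to $T_M$ (all of whose points are smooth points of $X_A$) is the composite $$T_M\xrightarrow{\;g_1\;}T_{\langle B-B\rangle_{\mathbb R}\cap M}\xrightarrow{\;g_2\;}T_{\langle B-B\rangle}\hookrightarrow X_B\subset\mathbb P^{\#B-1}\hookrightarrow\mathbb P\bigl(\textstyle\bigwedge^{n+1}k^{N+1}\bigr),$$ where $g_1,g_2$ are induced by the inclusions $\langle B-B\rangle\subset\langle B-B\rangle_{\mathbb R}\cap M\subset M$, $g_2$ is finite, $T_{\langle B-B\rangle}\hookrightarrow X_B$ is the open orbit $s\mapsto[s^{b-b_0}]_{b\in B}$ (for any $b_0\in B$), and the last map is a linear embedding. Moreover: 1. The rank of $\gamma$, i.e. the rank of the differential $d_x\gamma$ at a general point $x\in X_A$, is equal to $\dim\operatorname{Aff}_k(B)$. In particular, $\gamma$ is separable (i.e. $K(X_A)/K(\gamma(X_A))$ is a separable field extension) if and only if $\dim\operatorname{Aff}_k(B)=\operatorname{rank}\operatorname{Aff}(B)$.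 2. Assume that $p=\operatorname{char}k>0$. Then $\deg(g_2)=[\langle B-B\rangle_{\mathbb R}\cap M:\langle B-B\rangle]$. If $s\ge 0$ is the greatest integer with $p^s\mid\deg(g_2)$, then the separable degree of $g_2$ is $\deg(g_2)/p^s$ and its inseparable degree is $p^s$. The number of irreducible components of a general fiber of $\gamma$ is $\deg(g_2)/p^s$, and this number is coprime to $p$. -/

import Mathlib

open scoped LinearAlgebra.Projectivization TensorProduct

noncomputable section

namespace ToricGauss

/-! ### Projective varieties over a field `k`, in homogeneous coordinates indexed by `ι` -/

/-- The Zariski topology on the projective space with homogeneous coordinates indexed by `ι`: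
the sets `F ≠ 0`, with `F` a homogeneous polynomial, form a basis of open sets.  (Whether a
homogeneous polynomial vanishes at a point does not depend on the representative.) -/
instance zariskiTopology (k ι : Type*) [Field k] : TopologicalSpace (ℙ k (ι → k)) :=
  TopologicalSpace.generateFrom
    {O | ∃ (d : ℕ) (F : MvPolynomial ι k), F.IsHomogeneous d ∧
      O = {x | MvPolynomial.eval x.rep F ≠ 0}}

/-- The ideal of `X`: the polynomials vanishing on all vectors that represent points of `X`. -/
def vanishingIdeal {k ι : Type*} [Field k] (X : Set (ℙ k (ι → k))) :
    Ideal (MvPolynomial ι k) where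
  carrier := {F | ∀ (v : ι → k) (hv : v ≠ 0),
    Projectivization.mk k v hv ∈ X → MvPolynomial.eval v F = 0}
  zero_mem' := fun v hv _ => by simp
  add_mem' := fun {F G} hF hG v hv hX => by
    rw [map_add, hF v hv hX, hG v hv hX, add_zero]
  smul_mem' := fun G F hF v hv hX => by
    rw [smul_eq_mul, map_mul, hF v hv hX, mul_zero]

/-- The homogeneous coordinate ring of `X`. -/
abbrev coordinateRing {k ι : Type*} [Field k] (X : Set (ℙ k (ι → k))) : Type _ :=
  MvPolynomial ι k ⧸ vanishingIdeal X

/-- The class of a polynomial in the fraction ring of the homogeneous coordinate ring. -/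
def toFrac {k ι : Type*} [Field k] (X : Set (ℙ k (ι → k))) (F : MvPolynomial ι k) :
    FractionRing (coordinateRing X) :=
  algebraMap (coordinateRing X) (FractionRing (coordinateRing X))
    (Ideal.Quotient.mk (vanishingIdeal X) F)

/-- The function field `K(X)` of a projective variety `X` (a closed set with prime ideal): the
quotients `F / G` of homogeneous polynomials of the same degree, with `G` not vanishing
identically on `X`. -/
def functionField {k ι : Type*} [Field k] (X : Set (ℙ k (ι → k)))
    [(vanishingIdeal X).IsPrime] : IntermediateField k (FractionRing (coordinateRing X)) :=
  IntermediateField.adjoin k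
    {z | ∃ (d : ℕ) (F G : MvPolynomial ι k), F.IsHomogeneous d ∧ G.IsHomogeneous d ∧
      G ∉ vanishingIdeal X ∧ z = toFrac X F / toFrac X G}

/-- The dimension of a projective variety: the transcendence degree of its function field. -/
def dim {k ι : Type*} [Field k] (X : Set (ℙ k (ι → k))) [(vanishingIdeal X).IsPrime] : ℕ :=
  Cardinal.toNat (Algebra.trdeg k (functionField X))

/-! ### Tangent spaces, smooth points, the Gauss map -/

/-- The value `dF(v)(w) = ∑ i, ∂F/∂X_i (v) * w i` of the differential of `F`, linear in `w`. -/
def polyDiff {k ι : Type*} [Field k] [Fintype ι] (F : MvPolynomial ι k) (v : ι → k) :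
    (ι → k) →ₗ[k] k :=
  ∑ i, MvPolynomial.eval v (MvPolynomial.pderiv i F) • LinearMap.proj i

/-- The embedded tangent space of `X` at `x`, as a linear subspace of the vector space
`ι → k` (its projectivization is the linear subvariety of projective space). -/
def embeddedTangentSpace {k ι : Type*} [Field k] [Fintype ι] (X : Set (ℙ k (ι → k)))
    (x : ℙ k (ι → k)) : Submodule k (ι → k) :=
  ⨅ F ∈ vanishingIdeal X, LinearMap.ker (polyDiff F x.rep)

/-- The smooth points of `X`: the embedded tangent space has projective dimension `dim X`. -/
def smoothLocus {k ι : Type*} [Field k] [Fintype ι] (X : Set (ℙ k (ι → k)))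
    [(vanishingIdeal X).IsPrime] : Set (ℙ k (ι → k)) :=
  {x | x ∈ X ∧ Module.finrank k (embeddedTangentSpace X x) = dim X + 1}

/-- The Grassmannian of `m`-dimensional linear subspaces of `ι → k`. -/
abbrev Gr (k ι : Type*) [Field k] (m : ℕ) : Type _ :=
  {E : Submodule k (ι → k) // Module.finrank k E = m}

/-- A subspace with a nonzero finite rank has a nonvanishing maximal minor. -/
theorem exists_minor_ne_zero {k ι : Type*} [Field k] [Fintype ι] [LinearOrder ι] {m : ℕ}
    (b : Fin m → ι → k) (hb : LinearIndependent k b) :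
    (fun c : Fin m ↪o ι => Matrix.det (Matrix.of fun r s => b r (c s))) ≠ 0 := by
  classical
  have hrank : (Matrix.of b).rank = m := by
    simpa using LinearIndependent.rank_matrix (M := Matrix.of b) hb
  have hspan : Submodule.span k (Set.range (Matrix.of b).col) = ⊤ := by
    apply Submodule.eq_top_of_finrank_eq
    rw [← Matrix.rank_eq_finrank_span_cols, hrank]
    simp
  obtain ⟨κ, a, ha, hsp, hli⟩ := exists_linearIndependent' k (Matrix.of b).col
  rw [hspan] at hsp
  let B := Module.Basis.mk hli hsp.ge
  have : Fintype κ := Fintype.ofInjective a ha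
  have hcard : Fintype.card κ = m := by
    have := Module.finrank_eq_card_basis B
    simpa using this.symm
  let S : Finset ι := Finset.univ.image a
  have hS : S.card = m := by
    rw [Finset.card_image_of_injective _ ha, Finset.card_univ, hcard]
  intro h0
  have h1 := congrFun h0 (S.orderEmbOfFin hS)
  have hmem : ∀ s : Fin m, ∃ x : κ, a x = S.orderEmbOfFin hS s := by
    intro s
    have hm := S.orderEmbOfFin_mem hS s
    obtain ⟨x, -, hx⟩ := Finset.mem_image.mp hm
    exact ⟨x, hx⟩
  choose g hg using hmem
  have hginj : Function.Injective g := by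
    intro s t hst
    apply (S.orderEmbOfFin hS).injective
    rw [← hg s, ← hg t, hst]
  have hli' := hli.comp g hginj
  have hcol : LinearIndependent k
      (Matrix.of fun (r : Fin m) s => b r (S.orderEmbOfFin hS s)).col := by
    have he : (Matrix.of fun (r : Fin m) s => b r (S.orderEmbOfFin hS s)).col =
        ((Matrix.of b).col ∘ a) ∘ g := by
      funext s r
      change b r (S.orderEmbOfFin hS s) = b r (a (g s))
      rw [hg]
    rw [he]
    exact hli'
  have hu := (Matrix.linearIndependent_cols_iff_isUnit.mp hcol)
  rw [Matrix.isUnit_iff_isUnit_det] at hu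
  exact hu.ne_zero h1

/-- The Plücker embedding of the Grassmannian: the point whose homogeneous coordinates are the
maximal minors of the matrix whose rows form a basis of `E`. -/
def pluecker {k ι : Type*} [Field k] [Fintype ι] [LinearOrder ι] {m : ℕ} (E : Gr k ι m) :
    ℙ k ((Fin m ↪o ι) → k) :=
  Projectivization.mk k
    (fun c : Fin m ↪o ι => Matrix.det (Matrix.of fun r s =>
      (Module.finBasisOfFinrankEq k E.1 E.2 r : ι → k) (c s)))
    (exists_minor_ne_zero _
      ((Module.finBasisOfFinrankEq k E.1 E.2).linearIndependent.map' E.1.subtype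
        (Submodule.ker_subtype _)))

/-- The Gauss map of `X`, on the smooth points: it sends `x` to the embedded tangent space of `X`
at `x`, a point of the Grassmannian in its Plücker embedding. -/
def gaussMap {k ι : Type*} [Field k] [Fintype ι] [LinearOrder ι] (X : Set (ℙ k (ι → k)))
    [(vanishingIdeal X).IsPrime] (x : smoothLocus X) :
    ℙ k ((Fin (dim X + 1) ↪o ι) → k) :=
  pluecker ⟨embeddedTangentSpace X x.1, x.2.2⟩

/-! ### Rank, separability and general fibers of a rational map

A rational map from a projective variety `X` to a projective space is given by a map
`f : U → ℙ k (κ → k)` on a set `U` of points of `X`. -/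

/-- The Zariski tangent space of `X` at `x`, realized as the quotient of the tangent space of the
affine cone over `X` at a representative of `x` by the line of that representative.  (For `x ∈ X`
this line lies in the tangent space of the cone.) -/
abbrev tangentSpace {k ι : Type*} [Field k] [Fintype ι] (X : Set (ℙ k (ι → k)))
    (x : ℙ k (ι → k)) : Type _ :=
  embeddedTangentSpace X x ⧸ (Submodule.span k {x.rep}).comap (embeddedTangentSpace X x).subtype

/-- The Jacobian of a tuple of polynomials at `v`. -/
def jacobian {k ι κ : Type*} [Field k] [Fintype ι] (F : κ → MvPolynomial ι k) (v : ι → k) :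
    (ι → k) →ₗ[k] (κ → k) :=
  LinearMap.pi fun j => polyDiff (F j) v

/-- Euler's formula: the Jacobian of a tuple of forms at `v` maps `v` into the line of `F(v)`. -/
theorem jacobian_self_mem {k ι κ : Type*} [Field k] [Fintype ι] (F : κ → MvPolynomial ι k)
    {d : ℕ} (hF : ∀ j, (F j).IsHomogeneous d) (v : ι → k) :
    jacobian F v v ∈ Submodule.span k {fun j => MvPolynomial.eval v (F j)} := by
  rw [Submodule.mem_span_singleton]
  refine ⟨(d : k), ?_⟩
  funext j
  have h := congrArg (MvPolynomial.eval v) (hF j).sum_X_mul_pderiv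
  simp only [map_sum, map_mul, MvPolynomial.eval_X, nsmul_eq_mul, map_natCast] at h
  simp only [Pi.smul_apply, smul_eq_mul, jacobian, polyDiff, LinearMap.pi_apply,
    LinearMap.sum_apply, LinearMap.smul_apply, LinearMap.proj_apply]
  rw [← h]
  exact Finset.sum_congr rfl fun i _ => mul_comm _ _

/-- The differential at `x` of the map `y ↦ [F_j(y)]_j` given by forms of the same degree, from
the Zariski tangent space of `X` at `x` to the one of the projective space at `[F_j(x)]_j`. -/
def differential {k ι κ : Type*} [Field k] [Fintype ι] (X : Set (ℙ k (ι → k)))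
    (F : κ → MvPolynomial ι k) {d : ℕ} (hF : ∀ j, (F j).IsHomogeneous d) (x : ℙ k (ι → k)) :
    tangentSpace X x →ₗ[k]
      ((κ → k) ⧸ Submodule.span k {fun j => MvPolynomial.eval x.rep (F j)}) :=
  Submodule.mapQ _ _ ((jacobian F x.rep).comp (embeddedTangentSpace X x).subtype) (by
    rintro ⟨w, hw⟩ hmem
    simp only [Submodule.mem_comap, Submodule.subtype_apply] at hmem
    obtain ⟨c, rfl⟩ := Submodule.mem_span_singleton.mp hmem
    simp only [Submodule.mem_comap, LinearMap.comp_apply, Submodule.subtype_apply, map_smul]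
    exact Submodule.smul_mem _ _ (jacobian_self_mem F hF x.rep))

/-- `f` is given by forms `F_j` of the same degree on a neighbourhood of `x` in `X`, and the
resulting linear map `d_x f` has rank `r`. -/
def HasRankAt {k ι κ : Type*} [Field k] [Fintype ι] (X : Set (ℙ k (ι → k)))
    {U : Set (ℙ k (ι → k))} (f : U → ℙ k (κ → k)) (x : ℙ k (ι → k)) (r : ℕ) : Prop :=
  ∃ (d : ℕ) (F : κ → MvPolynomial ι k) (hF : ∀ j, (F j).IsHomogeneous d) (O : Set (ℙ k (ι → k))),
    IsOpen O ∧ x ∈ X ∩ O ∧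
    (∀ y ∈ X ∩ O, ∃ (hU : y ∈ U) (h0 : (fun j => MvPolynomial.eval y.rep (F j)) ≠ 0),
      f ⟨y, hU⟩ = Projectivization.mk k _ h0) ∧
    Module.finrank k (LinearMap.range (differential X F hF x)) = r

/-- The rank of the rational map `f` is `r`: the rank of `d_x f` is `r` for general `x ∈ X`, that
is, for all `x` in a nonempty open subset of the variety `X`. -/
def HasRank {k ι κ : Type*} [Field k] [Fintype ι] (X : Set (ℙ k (ι → k)))
    {U : Set (ℙ k (ι → k))} (f : U → ℙ k (κ → k)) (r : ℕ) : Prop :=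
  ∃ O : Set (ℙ k (ι → k)), IsOpen O ∧ (X ∩ O).Nonempty ∧ ∀ x ∈ X ∩ O, HasRankAt X f x r

/-- The function field `K(f(X))` of the closure of the image of the rational map `f`, as a subfield
of `K(X)` through pull-back: the rational functions `P / Q` on `X` that agree on a nonempty open
subset of `X` with `(G / H) ∘ f`, for forms `G`, `H` of the same degree on the target. -/
def pullbackField {k ι κ : Type*} [Field k] (X : Set (ℙ k (ι → k)))
    [(vanishingIdeal X).IsPrime] {U : Set (ℙ k (ι → k))} (f : U → ℙ k (κ → k)) :
    IntermediateField k (functionField X) :=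
  IntermediateField.adjoin k
    {z | ∃ (d e : ℕ) (G H : MvPolynomial κ k) (P Q : MvPolynomial ι k) (O : Set (ℙ k (ι → k))),
      G.IsHomogeneous d ∧ H.IsHomogeneous d ∧ P.IsHomogeneous e ∧ Q.IsHomogeneous e ∧
      Q ∉ vanishingIdeal X ∧
      (z : FractionRing (coordinateRing X)) = toFrac X P / toFrac X Q ∧
      IsOpen O ∧ (X ∩ O).Nonempty ∧
      ∀ x ∈ X ∩ O, ∃ hU : x ∈ U,
        MvPolynomial.eval x.rep Q ≠ 0 ∧ MvPolynomial.eval (f ⟨x, hU⟩).rep H ≠ 0 ∧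
        MvPolynomial.eval x.rep P / MvPolynomial.eval x.rep Q =
          MvPolynomial.eval (f ⟨x, hU⟩).rep G / MvPolynomial.eval (f ⟨x, hU⟩).rep H}

/-- Separability of a (finitely generated, not necessarily algebraic) field extension `L / K`:
there is a transcendence basis `s` such that `L / K(s)` is separable algebraic. -/
def IsSeparableExtension (K L : Type*) [Field K] [Field L] [Algebra K L] : Prop :=
  ∃ s : Set L, IsTranscendenceBasis K ((↑) : s → L) ∧
    Algebra.IsSeparable (IntermediateField.adjoin K s) L

/-- The rational map `f` is separable: `K(X) / K(f(X))` is a separable field extension. -/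
def IsSeparableMap {k ι κ : Type*} [Field k] (X : Set (ℙ k (ι → k)))
    [(vanishingIdeal X).IsPrime] {U : Set (ℙ k (ι → k))} (f : U → ℙ k (κ → k)) : Prop :=
  IsSeparableExtension (pullbackField X f) (functionField X)

/-- A general fiber of the rational map `f` on `X` has exactly `c` irreducible components: on a
nonempty open subset `X ∩ O` of `X` on which `f` is defined, the fiber over each general point `y`
of the image has exactly `c` irreducible components (for the induced Zariski topology).  The number
does not depend on the choice of the open set of definition that represents the rational map. -/
def GeneralFiberHasComponents {k ι κ : Type*} [Field k] (X : Set (ℙ k (ι → k)))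
    {U : Set (ℙ k (ι → k))} (f : U → ℙ k (κ → k)) (c : ℕ) : Prop :=
  ∃ O : Set (ℙ k (ι → k)), IsOpen O ∧ (X ∩ O).Nonempty ∧ X ∩ O ⊆ U ∧
    ∃ V : Set (ℙ k (κ → k)), IsOpen V ∧ (V ∩ f '' {x | x.1 ∈ X ∩ O}).Nonempty ∧
      ∀ y ∈ V ∩ f '' {x | x.1 ∈ X ∩ O},
        (irreducibleComponents ↥{x : ℙ k (ι → k) | x ∈ X ∩ O ∧ ∃ h : x ∈ U, f ⟨x, h⟩ = y}).Finite ∧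
        (irreducibleComponents
          ↥{x : ℙ k (ι → k) | x ∈ X ∩ O ∧ ∃ h : x ∈ U, f ⟨x, h⟩ = y}).ncard = c

/-! ### Tori and toric varieties -/

/-- The points of the algebraic torus `T_M = Spec k[M]` over the algebraically closed field `k`. -/
abbrev TorusPoint (k M : Type*) [Field k] [AddCommGroup M] : Type _ :=
  AddMonoidAlgebra k M →ₐ[k] k

/-- The value of the character `z^m` at a torus point. -/
def character {k M : Type*} [Field k] [AddCommGroup M] (m : M) (t : TorusPoint k M) : k :=
  t (AddMonoidAlgebra.single m 1)

theorem character_ne_zero {k M : Type*} [Field k] [AddCommGroup M] (m : M)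
    (t : TorusPoint k M) : character m t ≠ 0 := by
  intro h
  have h1 : character m t * character (-m) t = 1 := by
    unfold character
    rw [← map_mul, AddMonoidAlgebra.single_mul_single, add_neg_cancel, one_mul,
      ← AddMonoidAlgebra.one_def, map_one]
  rw [h, zero_mul] at h1
  exact zero_ne_one h1

/-- The morphism `t ↦ [z^{u_0}(t) : ⋯ : z^{u_N}(t)]` from the torus to projective space. -/
def torusMap {k M : Type*} [Field k] [AddCommGroup M] {N : ℕ} (u : Fin (N + 1) → M)
    (t : TorusPoint k M) : ℙ k (Fin (N + 1) → k) :=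
  Projectivization.mk k (fun i => character (u i) t)
    (fun h => character_ne_zero (u 0) t (congrFun h 0))

/-- The toric variety `X_A`, for `A = {u_0, …, u_N}`: the closure of the image of the torus. -/
def toricVariety (k : Type*) {M : Type*} [Field k] [AddCommGroup M] {N : ℕ}
    (u : Fin (N + 1) → M) : Set (ℙ k (Fin (N + 1) → k)) :=
  closure (Set.range (torusMap (k := k) u))

/-! The ideal of `X_A` is prime. -/

theorem isDomain_addMonoidAlgebra (k G : Type*) [Field k] [AddCommGroup G] [Module.Free ℤ G] :
    IsDomain (AddMonoidAlgebra k G) := by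
  have : TwoUniqueSums G :=
    TwoUniqueSums.of_injective_addHom
      ((Module.Free.chooseBasis ℤ G).repr.toLinearMap.toAddMonoidHom.toAddHom)
      (Module.Free.chooseBasis ℤ G).repr.injective inferInstance
  infer_instance

instance isDomain_subgroupAlgebra (k M : Type*) [Field k] [AddCommGroup M] [Module.Free ℤ M]
    (L : AddSubgroup M) : IsDomain (AddMonoidAlgebra k L) := by
  have := isDomain_addMonoidAlgebra k M
  exact Function.Injective.isDomain
    (AddMonoidAlgebra.mapDomainAlgHom k k L.subtype).toRingHom
    (AddMonoidAlgebra.mapDomain_injective L.subtype_injective)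

theorem eval_smul_of_isHomogeneous {k ι : Type*} [Field k] {F : MvPolynomial ι k} {d : ℕ}
    (hF : F.IsHomogeneous d) (c : k) (v : ι → k) :
    MvPolynomial.eval (c • v) F = c ^ d * MvPolynomial.eval v F := by
  rw [MvPolynomial.eval_eq, MvPolynomial.eval_eq, Finset.mul_sum]
  refine Finset.sum_congr rfl fun s hs => ?_
  have hd := hF.degree_eq_sum_deg_support hs
  simp only [Pi.smul_apply, smul_eq_mul, mul_pow, Finset.prod_mul_distrib,
    Finset.prod_pow_eq_pow_sum, hd]
  ring

theorem mk_smul_eq {k V : Type*} [Field k] [AddCommGroup V] [Module k V] {c : k} (hc : c ≠ 0)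
    {v : V} (hv : v ≠ 0) :
    Projectivization.mk k (c • v) (smul_ne_zero hc hv) = Projectivization.mk k v hv :=
  (Projectivization.mk_eq_mk_iff' k _ _ _ _).mpr ⟨c, rfl⟩

/-- A form vanishes at a representative of a point iff it vanishes at any other one. -/
theorem eval_rep_eq_zero_iff {k ι : Type*} [Field k] {F : MvPolynomial ι k} {d : ℕ}
    (hF : F.IsHomogeneous d) {v : ι → k} (hv : v ≠ 0) :
    MvPolynomial.eval (Projectivization.mk k v hv).rep F = 0 ↔ MvPolynomial.eval v F = 0 := by
  obtain ⟨a, ha⟩ := Projectivization.exists_smul_eq_mk_rep k v hv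
  rw [← ha]
  have : a • v = (a : k) • v := rfl
  rw [this, eval_smul_of_isHomogeneous hF]
  simp

/-- The homogeneous components of an element of the ideal of `Z` are in the ideal of `Z`. -/
theorem homogeneousComponent_mem_vanishingIdeal {k ι : Type*} [Field k] [Infinite k]
    {Z : Set (ℙ k (ι → k))} {F : MvPolynomial ι k} (hF : F ∈ vanishingIdeal Z) (d : ℕ) :
    MvPolynomial.homogeneousComponent d F ∈ vanishingIdeal Z := by
  intro v hv hZ
  let q : Polynomial k := ∑ i ∈ Finset.range (F.totalDegree + 1),
    Polynomial.monomial i (MvPolynomial.eval v (MvPolynomial.homogeneousComponent i F))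
  have hq : ∀ c : k, c ≠ 0 → q.eval c = 0 := by
    intro c hc
    have h := hF (c • v) (smul_ne_zero hc hv) (by rw [mk_smul_eq hc hv]; exact hZ)
    rw [← MvPolynomial.sum_homogeneousComponent F, map_sum] at h
    rw [← h, Polynomial.eval_finsetSum]
    refine Finset.sum_congr rfl fun i _ => ?_
    rw [eval_smul_of_isHomogeneous (MvPolynomial.homogeneousComponent_isHomogeneous i F),
      Polynomial.eval_monomial, mul_comm]
  have hq0 : q = 0 := by
    apply Polynomial.eq_zero_of_infinite_isRoot
    refine Set.Infinite.mono (s := {0}ᶜ) (fun c hc => hq c hc) ?_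
    exact (Set.finite_singleton (0 : k)).infinite_compl
  by_cases hd : F.totalDegree < d
  · rw [MvPolynomial.homogeneousComponent_eq_zero d F hd, map_zero]
  · have h := congrArg (fun p => Polynomial.coeff p d) hq0
    simp only [q, Polynomial.finsetSum_coeff, Polynomial.coeff_monomial,
      Polynomial.coeff_zero] at h
    rw [Finset.sum_ite_eq' (Finset.range (F.totalDegree + 1)) d,
      if_pos (Finset.mem_range.mpr (by omega))] at h
    exact h

/-- A set of points and its Zariski closure have the same ideal. -/
theorem vanishingIdeal_closure {k ι : Type*} [Field k] [Infinite k] (Z : Set (ℙ k (ι → k))) :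
    vanishingIdeal (closure Z) = vanishingIdeal Z := by
  apply le_antisymm
  · exact fun F hF v hv hZ => hF v hv (subset_closure hZ)
  · intro F hF v hv hZ
    rw [← MvPolynomial.sum_homogeneousComponent F, map_sum]
    refine Finset.sum_eq_zero fun d _ => ?_
    have hhom := MvPolynomial.homogeneousComponent_isHomogeneous d F
    have hcl : IsClosed {x : ℙ k (ι → k) |
        MvPolynomial.eval x.rep (MvPolynomial.homogeneousComponent d F) = 0} := by
      rw [← isOpen_compl_iff]
      exact TopologicalSpace.isOpen_generateFrom_of_mem ⟨d, _, hhom, rfl⟩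
    have hsub : Z ⊆ {x : ℙ k (ι → k) |
        MvPolynomial.eval x.rep (MvPolynomial.homogeneousComponent d F) = 0} := by
      intro x hx
      exact homogeneousComponent_mem_vanishingIdeal hF d x.rep x.rep_nonzero
        (by rw [Projectivization.mk_rep]; exact hx)
    have := hcl.closure_subset_iff.mpr hsub hZ
    exact (eval_rep_eq_zero_iff hhom hv).mp this

/-- A Laurent polynomial that vanishes at all points of the torus is zero. -/
theorem eq_zero_of_forall_torusPoint {k M : Type*} [Field k] [IsAlgClosed k] [AddCommGroup M]
    [Module.Free ℤ M] [Module.Finite ℤ M] (a : AddMonoidAlgebra k M)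
    (h : ∀ t : TorusPoint k M, t a = 0) : a = 0 := by
  have := isDomain_addMonoidAlgebra k M
  have : AddMonoid.FG M := by
    rw [← AddGroup.fg_iff_addMonoid_fg]
    exact Module.Finite.iff_addGroup_fg.mp inferInstance
  have hJ : IsJacobsonRing (AddMonoidAlgebra k M) := isJacobsonRing_of_finiteType (A := k)
  have hbot : Ideal.jacobson (⊥ : Ideal (AddMonoidAlgebra k M)) = ⊥ :=
    hJ.out (Ideal.isPrime_bot).isRadical
  have hmem : a ∈ Ideal.jacobson (⊥ : Ideal (AddMonoidAlgebra k M)) := by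
    rw [Ideal.jacobson, Ideal.mem_sInf]
    rintro m ⟨-, hm⟩
    let _ : Field (AddMonoidAlgebra k M ⧸ m) := Ideal.Quotient.field m
    have : Module.Finite k (AddMonoidAlgebra k M ⧸ m) :=
      finite_of_finite_type_of_isJacobsonRing k _
    have hbij : Function.Bijective (algebraMap k (AddMonoidAlgebra k M ⧸ m)) :=
      IsAlgClosed.algebraMap_bijective_of_isIntegral
    let e : k ≃ₐ[k] (AddMonoidAlgebra k M ⧸ m) :=
      AlgEquiv.ofBijective (Algebra.ofId k _) hbij
    have h1 := h (e.symm.toAlgHom.comp (Ideal.Quotient.mkₐ k m))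
    have h2 : e.symm (Ideal.Quotient.mk m a) = 0 := h1
    rw [map_eq_zero_iff e.symm e.symm.injective] at h2
    exact Ideal.Quotient.eq_zero_iff_mem.mp h2
  rw [hbot] at hmem
  exact hmem

/-- The ideal of a toric variety is prime. -/
instance vanishingIdeal_toricVariety_isPrime (k : Type*) {M : Type*} [Field k] [IsAlgClosed k]
    [AddCommGroup M] [Module.Free ℤ M] [Module.Finite ℤ M] {N : ℕ} (u : Fin (N + 1) → M) :
    (vanishingIdeal (toricVariety k u)).IsPrime := by
  have := isDomain_addMonoidAlgebra k M
  have : Infinite k := IsAlgClosed.instInfinite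
  let ψ : MvPolynomial (Fin (N + 1)) k →ₐ[k] Polynomial (AddMonoidAlgebra k M) :=
    MvPolynomial.aeval fun i =>
      Polynomial.C (AddMonoidAlgebra.single (u i) (1 : k)) * Polynomial.X
  have key : ∀ (t : TorusPoint k M) (c : k) (F : MvPolynomial (Fin (N + 1)) k),
      ((ψ F).map t.toRingHom).eval c =
        MvPolynomial.eval (c • fun i => character (u i) t) F := by
    intro t c F
    have h : ((Polynomial.evalRingHom c).comp
        ((Polynomial.mapRingHom t.toRingHom).comp ψ.toRingHom)) =
        MvPolynomial.eval (c • fun i => character (u i) t) := by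
      apply MvPolynomial.ringHom_ext
      · intro r
        simp only [ψ, RingHom.comp_apply, AlgHom.toRingHom_eq_coe, RingHom.coe_coe,
          MvPolynomial.aeval_C, Polynomial.algebraMap_apply, Polynomial.coe_mapRingHom,
          Polynomial.map_C, Polynomial.coe_evalRingHom, Polynomial.eval_C, MvPolynomial.eval_C,
          AlgHom.commutes, Algebra.algebraMap_self, RingHom.id_apply]
      · intro i
        simp only [ψ, RingHom.comp_apply, AlgHom.toRingHom_eq_coe, RingHom.coe_coe,
          MvPolynomial.aeval_X, Polynomial.coe_mapRingHom, Polynomial.map_mul, Polynomial.map_C,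
          Polynomial.map_X, Polynomial.coe_evalRingHom, Polynomial.eval_mul, Polynomial.eval_C,
          Polynomial.eval_X, MvPolynomial.eval_X, Pi.smul_apply, smul_eq_mul, character]
        exact mul_comm _ _
    exact congrArg (fun g => g F) h
  have hker : vanishingIdeal (toricVariety k u) = RingHom.ker ψ := by
    rw [toricVariety, vanishingIdeal_closure]
    ext F
    rw [RingHom.mem_ker]
    constructor
    · intro hF
      ext1 j
      rw [Polynomial.coeff_zero]
      apply eq_zero_of_forall_torusPoint
      intro t
      have h0 : (ψ F).map t.toRingHom = 0 := by
        apply Polynomial.eq_zero_of_infinite_isRoot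
        refine Set.Infinite.mono (s := {0}ᶜ) (fun c hc => ?_)
          (Set.finite_singleton (0 : k)).infinite_compl
        have hv : (fun i => character (u i) t) ≠ 0 := fun h =>
          character_ne_zero (u 0) t (congrFun h 0)
        change Polynomial.eval c _ = 0
        rw [key]
        exact hF _ (smul_ne_zero hc hv) (by rw [mk_smul_eq hc hv]; exact ⟨t, rfl⟩)
      have := congrArg (fun p => Polynomial.coeff p j) h0
      simpa using this
    · rintro hF v hv ⟨t, ht⟩
      obtain ⟨c, hc⟩ := (Projectivization.mk_eq_mk_iff' k _ _ _ _).mp ht.symm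
      rw [← hc, ← key, hF]
      simp
  rw [hker]
  exact RingHom.ker_isPrime _

/-! ### Torus morphisms induced by inclusions of lattices -/

/-- The comorphism `k[L] → k[L']` of the morphism of tori `T_{L'} → T_L` induced by `L ≤ L'`. -/
def torusComorphism (k : Type*) {M : Type*} [Field k] [AddCommGroup M] {L L' : AddSubgroup M}
    (h : L ≤ L') : AddMonoidAlgebra k L →ₐ[k] AddMonoidAlgebra k L' :=
  AddMonoidAlgebra.mapDomainAlgHom k k (AddSubgroup.inclusion h)

theorem torusComorphism_injective (k : Type*) {M : Type*} [Field k] [AddCommGroup M]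
    {L L' : AddSubgroup M} (h : L ≤ L') : Function.Injective (torusComorphism k h) :=
  AddMonoidAlgebra.mapDomain_injective (AddSubgroup.inclusion_injective h)

/-- The comorphism `k[L] → k[M]` of the morphism of tori `T_M → T_L` induced by `L ≤ M`. -/
def torusComorphismTop (k : Type*) {M : Type*} [Field k] [AddCommGroup M] (L : AddSubgroup M) :
    AddMonoidAlgebra k L →ₐ[k] AddMonoidAlgebra k M :=
  AddMonoidAlgebra.mapDomainAlgHom k k L.subtype

/-- The pull-back `K(T_L) → K(T_{L'})` of function fields of the morphism `T_{L'} → T_L`. -/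
def torusFieldMap (k : Type*) {M : Type*} [Field k] [AddCommGroup M] [Module.Free ℤ M]
    {L L' : AddSubgroup M} (h : L ≤ L') :
    FractionRing (AddMonoidAlgebra k L) →+* FractionRing (AddMonoidAlgebra k L') :=
  IsFractionRing.map (j := (torusComorphism k h).toRingHom) (torusComorphism_injective k h)

/-- The degree of `T_{L'} → T_L`: the degree of the extension of function fields. -/
def torusDegree (k : Type*) {M : Type*} [Field k] [AddCommGroup M] [Module.Free ℤ M]
    {L L' : AddSubgroup M} (h : L ≤ L') : ℕ :=
  letI := (torusFieldMap k h).toAlgebra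
  Module.finrank (FractionRing (AddMonoidAlgebra k L)) (FractionRing (AddMonoidAlgebra k L'))

/-- The separable degree of `T_{L'} → T_L`: the one of the extension of function fields. -/
def torusSepDegree (k : Type*) {M : Type*} [Field k] [AddCommGroup M] [Module.Free ℤ M]
    {L L' : AddSubgroup M} (h : L ≤ L') : ℕ :=
  letI := (torusFieldMap k h).toAlgebra
  Field.finSepDegree (FractionRing (AddMonoidAlgebra k L)) (FractionRing (AddMonoidAlgebra k L'))

/-- The inseparable degree of `T_{L'} → T_L`: the one of the extension of function fields. -/
def torusInsepDegree (k : Type*) {M : Type*} [Field k] [AddCommGroup M] [Module.Free ℤ M]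
    {L L' : AddSubgroup M} (h : L ≤ L') : ℕ :=
  letI := (torusFieldMap k h).toAlgebra
  Field.finInsepDegree (FractionRing (AddMonoidAlgebra k L)) (FractionRing (AddMonoidAlgebra k L'))

/-! ### The combinatorial data -/

/-- The image of `m ∈ M` in `M_R = R ⊗ M`. -/
def toModule (R : Type*) {M : Type*} [CommRing R] [AddCommGroup M] (m : M) : R ⊗[ℤ] M :=
  (1 : R) ⊗ₜ[ℤ] m

/-- The set `B` of the sums `u_{i_0} + ⋯ + u_{i_n}`, with `n` the rank of `M`, such that
`u_{i_0}, …, u_{i_n}` span the affine space `M_k`. -/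
def setB (k : Type*) {M : Type*} [Field k] [AddCommGroup M] {N : ℕ} (u : Fin (N + 1) → M) :
    Set M :=
  {b | ∃ i : Fin (Module.finrank ℤ M + 1) → Fin (N + 1),
    affineSpan k (Set.range fun j => toModule k (u (i j))) = ⊤ ∧ b = ∑ j, u (i j)}

/-- The subgroup `⟨B - B⟩` generated by the differences of elements of `B`. -/
def diffLattice {M : Type*} [AddCommGroup M] (B : Set M) : AddSubgroup M :=
  AddSubgroup.closure {m | ∃ b ∈ B, ∃ b' ∈ B, m = b - b'}

/-- The subgroup `L_ℝ ∩ M` of `M`. -/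
def realSaturation {M : Type*} [AddCommGroup M] (L : AddSubgroup M) : AddSubgroup M where
  carrier := {m | toModule ℝ m ∈ Submodule.span ℝ (toModule ℝ '' (L : Set M))}
  zero_mem' := by
    simp only [Set.mem_ofPred_eq, toModule, TensorProduct.tmul_zero]
    exact Submodule.zero_mem _
  add_mem' := fun {a b} ha hb => by
    simp only [Set.mem_ofPred_eq, toModule, TensorProduct.tmul_add] at *
    exact Submodule.add_mem _ ha hb
  neg_mem' := fun {a} ha => by
    simp only [Set.mem_ofPred_eq, toModule, TensorProduct.tmul_neg] at *
    exact Submodule.neg_mem _ ha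

theorem le_realSaturation {M : Type*} [AddCommGroup M] (L : AddSubgroup M) :
    L ≤ realSaturation L :=
  fun m hm => Submodule.subset_span ⟨m, hm, rfl⟩

theorem sub_mem_diffLattice {M : Type*} [AddCommGroup M] {B : Set M} (b b' : B) :
    (b : M) - b' ∈ diffLattice B :=
  AddSubgroup.subset_closure ⟨b, b.2, b', b'.2, rfl⟩

/-- The homogeneous coordinates `(s^{b - b₀})_{b ∈ B}` of the point of `X_B` that corresponds to a
point `s` of the torus `T_{⟨B - B⟩}`, under the embedding of this torus as the open orbit of `X_B`
(it depends on `b₀ ∈ B` only up to a common factor). -/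
def orbitCoords {k M : Type*} [Field k] [AddCommGroup M] (B : Set M) (b₀ : B)
    (s : TorusPoint k (diffLattice B)) : B → k :=
  fun b => character ⟨(b : M) - b₀, sub_mem_diffLattice b b₀⟩ s

end ToricGauss

end

/-! Over the open torus everything becomes lattice arithmetic. Since `A` spans `M` affinely, the
vectors `(u_i, 1)` generate `M × ℤ`. The affine cone over the open orbit is therefore the torus of
`M × ℤ` with coordinates `z^(u_i, 1)`, and the ideal of `X_A` is the kernel of `X_i ↦ z^(u_i, 1)`
(`mem_vanishingIdeal_toricVariety`).

In logarithmic coordinates the tangent space of the cone does not depend on the point: it consists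
of the vectors `(z^(u_i, 1) φ(u_i, 1))_i` with `φ : M × ℤ →+ k` (`mem_embeddedTangentSpace_iff`).
Hence the Plücker coordinate at the columns `c` is a constant minor times `z^(∑ (u_{c s}, 1))`
(`det_tangentRow`). The minor is nonzero in `k` exactly when the chosen `u_i` span the affine space
`M_k` (`minor_ne_zero_iff`, `affineSpan_eq_top_iff_forall`), so the exponents that survive are the
elements of `B`. Division by one of these monomials leaves the characters `z^(b - b₀)`, which is the
decomposition of `γ` through `T_L` with `L = ⟨B - B⟩`.

Rank: differentiating these monomials sends a functional on `M_k` to its values on `B`, up to a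
common constant. The kernel is the annihilator of the direction of `Aff_k(B)`
(`finrank_range_differential`).

Fields: `K(X_A)` is the field of `k[M]`, and `K(γ(X_A))` is the subfield generated by `k[L]`
(`toSubfield_pullbackField`). Characters in different cosets of a sublattice are linearly
independent over its field (`linearIndependent_chi`). Consequently degrees are indices, the
`p`-primary part of a finite quotient is purely inseparable, and the rest is separable
(`finrank_of_chi`, `finSepDegree_of_chi`). In the same way `K(M)/K(L)` is separable iff no
elementary divisor of `L` vanishes in `k`, that is, iff `L` keeps its rank in `M_k`
(`isSeparableExtension_chi_iff`).

Fibers: on the torus, a fiber of `γ` is the set of characters `M → kˣ` with prescribed restriction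
to `L`. Let `L'` be the saturation of `L`. Fixing the restriction to `L'` as well gives a translate
of the torus of `M / L'`, which is irreducible because this quotient is free. The number of possible
restrictions to `L'` is the order of `Hom(L'/L, kˣ)`, the prime-to-`p` part of `[L' : L]`, because
`kˣ` has no `p`-torsion (`generalFiberHasComponents_gaussMap`). -/

noncomputable section

namespace ToricGauss

/-! ### Subfields generated by the characters of a sublattice -/

section LatticeField

variable {k M E : Type*} [Field k] [AddCommGroup M] [Field E] (ι : AddMonoidAlgebra k M →+* E)

/-- The image of the character `m` under a ring homomorphism from the group algebra. -/
def chi (m : M) : E := ι (AddMonoidAlgebra.single m 1)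

/-- The image of `k[H]` in `E`. -/
def latticeHom (H : AddSubgroup M) : AddMonoidAlgebra k H →+* E :=
  ι.comp (AddMonoidAlgebra.mapDomainAlgHom k k H.subtype).toRingHom

/-- The subfield of `E` generated by the image of `k[H]`. -/
def latticeField (H : AddSubgroup M) : Subfield E :=
  Subfield.closure (Set.range (latticeHom ι H))

theorem chi_add (m m' : M) : chi ι (m + m') = chi ι m * chi ι m' := by
  simp [chi, ← map_mul, AddMonoidAlgebra.single_mul_single]

theorem chi_zero : chi ι 0 = 1 := by
  simp [chi, ← AddMonoidAlgebra.one_def]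

theorem chi_nsmul (n : ℕ) (m : M) : chi ι (n • m) = chi ι m ^ n := by
  induction n with
  | zero => simp [chi_zero]
  | succ n ih => rw [succ_nsmul, chi_add, ih, pow_succ]

theorem chi_ne_zero (m : M) : chi ι m ≠ 0 := by
  intro h
  have h1 : chi ι m * chi ι (-m) = 1 := by rw [← chi_add, add_neg_cancel, chi_zero]
  rw [h, zero_mul] at h1
  exact zero_ne_one h1

theorem chi_neg (m : M) : chi ι (-m) = (chi ι m)⁻¹ := by
  apply eq_inv_of_mul_eq_one_left
  rw [← chi_add, neg_add_cancel, chi_zero]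

theorem chi_sub (m m' : M) : chi ι (m - m') = chi ι m / chi ι m' := by
  rw [sub_eq_add_neg, chi_add, chi_neg, div_eq_mul_inv]

theorem latticeHom_single (H : AddSubgroup M) (h : H) (c : k) :
    latticeHom ι H (AddMonoidAlgebra.single h c) = ι (AddMonoidAlgebra.single (h : M) c) := by
  simp [latticeHom]

theorem mem_latticeField {H : AddSubgroup M} {x : E} :
    x ∈ latticeField ι H ↔ ∃ a b, x = latticeHom ι H a / latticeHom ι H b := by
  rw [latticeField, Subfield.mem_closure_iff, ← RingHom.coe_range, Subring.closure_eq]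
  constructor
  · rintro ⟨_, ⟨a, rfl⟩, _, ⟨b, rfl⟩, rfl⟩
    exact ⟨a, b, rfl⟩
  · rintro ⟨a, b, rfl⟩
    exact ⟨_, ⟨a, rfl⟩, _, ⟨b, rfl⟩, rfl⟩

theorem latticeHom_mem (H : AddSubgroup M) (a : AddMonoidAlgebra k H) :
    latticeHom ι H a ∈ latticeField ι H :=
  Subfield.subset_closure ⟨a, rfl⟩

theorem single_mem_latticeField {H : AddSubgroup M} {m : M} (hm : m ∈ H) (c : k) :
    ι (AddMonoidAlgebra.single m c) ∈ latticeField ι H := by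
  have := latticeHom_mem ι H (AddMonoidAlgebra.single ⟨m, hm⟩ c)
  rwa [latticeHom_single] at this

theorem chi_mem_latticeField {H : AddSubgroup M} {m : M} (hm : m ∈ H) :
    chi ι m ∈ latticeField ι H :=
  single_mem_latticeField ι hm 1

theorem single_eq_mul_chi (m : M) (c : k) :
    ι (AddMonoidAlgebra.single m c) = ι (AddMonoidAlgebra.single 0 c) * chi ι m := by
  simp [chi, ← map_mul, AddMonoidAlgebra.single_mul_single]

theorem latticeHom_mem_of_generators {H : AddSubgroup M} {K : Subfield E}
    (hc : ∀ c : k, ι (AddMonoidAlgebra.single 0 c) ∈ K) (hH : ∀ m ∈ H, chi ι m ∈ K)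
    (a : AddMonoidAlgebra k H) : latticeHom ι H a ∈ K := by
  induction a using AddMonoidAlgebra.induction_linear with
  | zero => simp
  | add f g hf hg => rw [map_add]; exact K.add_mem hf hg
  | single m c =>
    rw [latticeHom_single, single_eq_mul_chi]
    exact K.mul_mem (hc c) (hH _ m.2)

theorem latticeField_le {H : AddSubgroup M} {K : Subfield E}
    (hc : ∀ c : k, ι (AddMonoidAlgebra.single 0 c) ∈ K) (hH : ∀ m ∈ H, chi ι m ∈ K) :
    latticeField ι H ≤ K := by
  rw [latticeField, Subfield.closure_le]
  rintro _ ⟨a, rfl⟩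
  exact latticeHom_mem_of_generators ι hc hH a

theorem latticeField_mono {H H' : AddSubgroup M} (h : H ≤ H') :
    latticeField ι H ≤ latticeField ι H' :=
  latticeField_le ι (fun c => single_mem_latticeField ι (zero_mem _) c)
    fun _ hm => chi_mem_latticeField ι (h hm)

/-- Finitely many elements of `latticeField ι H` have a common denominator. -/
theorem exists_common_denominator {H : AddSubgroup M} {J : Type*}
    (s : Finset J) (f : J → E) (hf : ∀ j ∈ s, f j ∈ latticeField ι H) :
    ∃ b, latticeHom ι H b ≠ 0 ∧ ∀ j ∈ s, ∃ a, f j * latticeHom ι H b = latticeHom ι H a := by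
  classical
  induction s using Finset.induction_on with
  | empty => exact ⟨1, by simp, by simp⟩
  | insert i s his ih =>
    obtain ⟨b, hb, hs⟩ := ih fun j hj => hf j (Finset.mem_insert_of_mem hj)
    obtain ⟨a, b', h⟩ := (mem_latticeField ι).mp (hf i (Finset.mem_insert_self _ _))
    -- `ι` need not be injective here. If the denominator maps to zero, the quotient is zero by the
    -- convention `x / 0 = 0`, and the old denominator still works.
    by_cases hb' : latticeHom ι H b' = 0
    · refine ⟨b, hb, fun j hj => ?_⟩
      rcases Finset.mem_insert.mp hj with rfl | hj
      · exact ⟨0, by rw [h, hb', div_zero, zero_mul, map_zero]⟩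
      · exact hs j hj
    · refine ⟨b' * b, by rw [map_mul]; exact mul_ne_zero hb' hb, fun j hj => ?_⟩
      rcases Finset.mem_insert.mp hj with rfl | hj
      · refine ⟨a * b, ?_⟩
        rw [h, map_mul, map_mul, ← mul_assoc, div_mul_cancel₀ _ hb']
      · obtain ⟨c, hc⟩ := hs j hj
        refine ⟨b' * c, ?_⟩
        rw [map_mul, map_mul, ← hc]; ring

/-- Characters in different cosets of `H` are linearly independent over the field of `k[H]`. -/
theorem linearIndependent_chi (hι : Function.Injective ι) {H : AddSubgroup M}
    {F : Type*} [Field F] [Algebra F E] (hF : ∀ x : F, algebraMap F E x ∈ latticeField ι H)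
    {J : Type*} (m : J → M) (hm : Function.Injective fun j => (m j : M ⧸ H)) :
    LinearIndependent F fun j => chi ι (m j) := by
  classical
  rw [linearIndependent_iff']
  intro s g hg i hi
  obtain ⟨b, hb, hs⟩ := exists_common_denominator ι s (fun j => algebraMap F E (g j))
    fun j _ => hF _
  choose! a ha using hs
  -- Clearing denominators turns the relation into an identity `∑ a_j z^(m_j) = 0` in `k[M]` with
  -- `a_j ∈ k[H]`.
  have h0 : ∑ j ∈ s, (AddMonoidAlgebra.mapDomainAlgHom k k H.subtype (a j)) *
      AddMonoidAlgebra.single (m j) 1 = 0 := by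
    apply hι
    rw [map_sum, map_zero]
    have : ∀ j ∈ s, ι ((AddMonoidAlgebra.mapDomainAlgHom k k H.subtype (a j)) *
      AddMonoidAlgebra.single (m j) 1) = latticeHom ι H b * (g j • chi ι (m j)) := by
      intro j hj
      rw [map_mul, Algebra.smul_def, ← mul_assoc, mul_comm _ (algebraMap F E _), ha j hj]
      rfl
    rw [Finset.sum_congr rfl this, ← Finset.mul_sum, hg, mul_zero]
  -- The support of `a_j z^(m_j)` lies in the coset `H + m_j`. These cosets are disjoint, so the
  -- coefficient at `h + m_i` only sees `a_i`.
  have hai : a i = 0 := by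
    ext h
    have hcoef := congrArg (fun z => z.coeff ((h : M) + m i)) h0
    simp only [AddMonoidAlgebra.coeff_sum, Finset.sum_apply', AddMonoidAlgebra.coeff_zero,
      Finsupp.coe_zero, Pi.zero_apply] at hcoef
    rw [Finset.sum_eq_single i] at hcoef
    · rw [AddMonoidAlgebra.coeff_mul_single_eq_coeff_mul (h : M)] at hcoef
      · have h2 : (Finsupp.mapDomain (H.subtype) (a i).coeff) (H.subtype h) = 0 := by
          simpa using hcoef
        rwa [Finsupp.mapDomain_apply H.subtype_injective] at h2
      · intro m' _
        exact add_left_inj _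
    · intro j hj hji
      by_contra hne
      have hsup : (h : M) + m i - m j ∈ H := by
        by_contra hnot
        apply hne
        rw [AddMonoidAlgebra.coeff_mul_single_eq_coeff_mul ((h : M) + m i - m j)]
        · have : (Finsupp.mapDomain (H.subtype) (a j).coeff) ((h : M) + m i - m j) = 0 := by
            apply Finsupp.mapDomain_of_notMem_range
            rintro ⟨y, hy⟩
            exact hnot (hy ▸ y.2)
          simpa using this
        · intro m' _
          exact eq_sub_iff_add_eq.symm
      apply hji
      apply hm
      change (m j : M ⧸ H) = (m i : M ⧸ H)
      rw [QuotientAddGroup.eq]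
      have h3 : -m j + m i = ((h : M) + m i - m j) - h := by abel
      rw [h3]
      exact H.sub_mem hsup h.2
    · exact fun h => absurd hi h
  have := ha i hi
  rw [hai, map_zero, mul_eq_zero, or_iff_left hb] at this
  exact (map_eq_zero _).mp this

/-- If `m ∉ H`, then `0` and `m` lie in different cosets, so `1` and `χ^m` are independent over the
field of `k[H]`. If `χ^m` lay in that field, then `χ^m · 1 - 1 · χ^m = 0` would be a nontrivial
relation. -/
theorem mem_of_chi_mem_latticeField (hι : Function.Injective ι) {H : AddSubgroup M} {m : M}
    (hm : chi ι m ∈ latticeField ι H) : m ∈ H := by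
  by_contra hmH
  have hli := linearIndependent_chi ι hι (H := H) (F := latticeField ι H) (fun x => x.2)
    (J := Bool) (fun b => if b then m else 0) (by
      have h1 : ¬ ((m : M ⧸ H) = 0) := by rwa [QuotientAddGroup.eq_zero_iff]
      intro a b hab
      cases a <;> cases b <;> simp_all [eq_comm])
  rw [Fintype.linearIndependent_iff] at hli
  have := hli (fun b => if b then -1 else ⟨chi ι m, hm⟩) (by
    simp only [Fintype.sum_bool, if_true, neg_smul, one_smul]
    simp [chi_zero, Subfield.smul_def]) true
  simp at this

end LatticeField

/-! ### Extensions generated by characters: degree, separability, transcendence -/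

section CharExtension

variable {k M E : Type*} [Field k] [AddCommGroup M] [Field E] (ι : AddMonoidAlgebra k M →+* E)
  {F : Type*} [Field F] [Algebra F E] {H : AddSubgroup M}

theorem chi_pow_mem_range (hF : (algebraMap F E).fieldRange = latticeField ι H) {m : M} {d : ℕ}
    (hd : d • m ∈ H) : ∃ a : F, algebraMap F E a = chi ι m ^ d := by
  have := chi_mem_latticeField ι hd
  rwa [chi_nsmul, ← hF] at this

/-- Adjoining characters amounts to enlarging the lattice, so every result about `F` and `H` applies
again over the intermediate field. The reverse inclusion uses that the `m` with `χ^m` in a given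
field form a subgroup. -/
theorem fieldRange_adjoin_chi (hF : (algebraMap F E).fieldRange = latticeField ι H) (S : Set M) :
    (algebraMap (IntermediateField.adjoin F (chi ι '' S)) E).fieldRange =
      latticeField ι (H ⊔ AddSubgroup.closure S) := by
  have hle := latticeField_mono ι (le_sup_left : H ≤ H ⊔ AddSubgroup.closure S)
  apply le_antisymm
  · rintro _ ⟨⟨x, hx⟩, rfl⟩
    change x ∈ _
    induction hx using IntermediateField.adjoin_induction with
    | mem x hx =>
      obtain ⟨m, hm, rfl⟩ := hx
      exact chi_mem_latticeField ι
        ((le_sup_right : _ ≤ H ⊔ AddSubgroup.closure S) (AddSubgroup.subset_closure hm))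
    | algebraMap x => exact hle (hF ▸ ⟨x, rfl⟩)
    | add x y _ _ hx hy => exact add_mem hx hy
    | inv x _ hx => exact inv_mem hx
    | mul x y _ _ hx hy => exact mul_mem hx hy
  · have hb : latticeField ι H ≤ (IntermediateField.adjoin F (chi ι '' S)).toSubfield := by
      rw [← hF]
      rintro _ ⟨x, rfl⟩
      exact IntermediateField.algebraMap_mem _ x
    have : latticeField ι (H ⊔ AddSubgroup.closure S) ≤
        (IntermediateField.adjoin F (chi ι '' S)).toSubfield := by
      apply latticeField_le
      · exact fun c => hb (single_mem_latticeField ι (zero_mem _) c)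
      · intro m hm
        let P : AddSubgroup M :=
          { carrier := {m | chi ι m ∈ IntermediateField.adjoin F (chi ι '' S)}
            zero_mem' := by
              change chi ι 0 ∈ IntermediateField.adjoin F (chi ι '' S)
              rw [chi_zero]; exact one_mem _
            add_mem' := fun {a b} ha hb => by
              change chi ι (a + b) ∈ IntermediateField.adjoin F (chi ι '' S)
              rw [chi_add]; exact mul_mem ha hb
            neg_mem' := fun {a} ha => by
              change chi ι (-a) ∈ IntermediateField.adjoin F (chi ι '' S)
              rw [chi_neg]; exact inv_mem ha }
        have hP : H ⊔ AddSubgroup.closure S ≤ P := by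
          refine sup_le (fun h hh => hb (chi_mem_latticeField ι hh)) ?_
          rw [AddSubgroup.closure_le]
          exact fun m hm => IntermediateField.subset_adjoin _ _ ⟨m, hm, rfl⟩
        exact hP hm
    intro x hx
    exact ⟨⟨x, this hx⟩, rfl⟩

theorem adjoin_chi_eq_top (hF : (algebraMap F E).fieldRange = latticeField ι H)
    (hE : latticeField ι ⊤ = ⊤) : IntermediateField.adjoin F (Set.range (chi ι)) = ⊤ := by
  have h := fieldRange_adjoin_chi ι hF Set.univ
  rw [AddSubgroup.closure_univ, sup_top_eq, hE, Set.image_univ] at h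
  rw [eq_top_iff]
  intro x _
  have : x ∈ (⊤ : Subfield E) := trivial
  rw [← h] at this
  obtain ⟨y, rfl⟩ := this
  exact y.2

theorem isIntegral_chi (hF : (algebraMap F E).fieldRange = latticeField ι H) {m : M} {d : ℕ}
    (hd0 : d ≠ 0) (hd : d • m ∈ H) : IsIntegral F (chi ι m) := by
  obtain ⟨a, ha⟩ := chi_pow_mem_range ι hF hd
  refine IsIntegral.of_pow (Nat.pos_of_ne_zero hd0) ?_
  rw [← ha]
  exact isIntegral_algebraMap

/-- `χ^m` is a root of `X^d - a` with `a ≠ 0`, which is separable when `d` is invertible. -/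
theorem isSeparable_chi (hF : (algebraMap F E).fieldRange = latticeField ι H) {m : M} {d : ℕ}
    (hd0 : (d : F) ≠ 0) (hd : d • m ∈ H) : IsSeparable F (chi ι m) := by
  obtain ⟨a, ha⟩ := chi_pow_mem_range ι hF hd
  have ha0 : a ≠ 0 := by
    rintro rfl
    rw [map_zero] at ha
    exact pow_ne_zero _ (chi_ne_zero ι m) ha.symm
  exact (Polynomial.separable_X_pow_sub_C a hd0 ha0).of_dvd
    (minpoly.dvd F _ (by simp [ha]))

theorem isAlgebraic_of_chi (hF : (algebraMap F E).fieldRange = latticeField ι H)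
    (hE : latticeField ι ⊤ = ⊤) (hd : ∀ m : M, ∃ d : ℕ, d ≠ 0 ∧ d • m ∈ H) :
    Algebra.IsAlgebraic F E := by
  have h := adjoin_chi_eq_top ι hF hE
  have h1 : Algebra.IsAlgebraic F (IntermediateField.adjoin F (Set.range (chi ι))) := by
    apply IntermediateField.isAlgebraic_adjoin
    rintro _ ⟨m, rfl⟩
    obtain ⟨d, hd0, hd⟩ := hd m
    exact isIntegral_chi ι hF hd0 hd
  rw [h] at h1
  exact IntermediateField.topEquiv.isAlgebraic

theorem isSeparable_of_chi (hF : (algebraMap F E).fieldRange = latticeField ι H)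
    (hE : latticeField ι ⊤ = ⊤) (hd : ∀ m : M, ∃ d : ℕ, (d : F) ≠ 0 ∧ d • m ∈ H) :
    Algebra.IsSeparable F E := by
  have h := adjoin_chi_eq_top ι hF hE
  have h1 : Algebra.IsSeparable F (IntermediateField.adjoin F (Set.range (chi ι))) := by
    rw [IntermediateField.isSeparable_adjoin_iff_isSeparable]
    rintro _ ⟨m, rfl⟩
    obtain ⟨d, hd0, hd⟩ := hd m
    exact isSeparable_chi ι hF hd0 hd
  rw [h] at h1
  exact AlgEquiv.Algebra.isSeparable IntermediateField.topEquiv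

/-- The characters of coset representatives form a basis. They span because `E`, being generated by
algebraic elements, is generated by characters already as an algebra. Products of characters are
characters, and each character is an `F`-multiple of the one representing its coset. -/
theorem finrank_of_chi (hι : Function.Injective ι)
    (hF : (algebraMap F E).fieldRange = latticeField ι H)
    (hE : latticeField ι ⊤ = ⊤) [Finite (M ⧸ H)] :
    Module.finrank F E = Nat.card (M ⧸ H) ∧ FiniteDimensional F E := by
  have : Fintype (M ⧸ H) := Fintype.ofFinite _
  let r : M ⧸ H → M := Quotient.out
  have hr : ∀ q : M ⧸ H, (r q : M ⧸ H) = q := fun q => Quotient.out_eq' q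
  have hli : LinearIndependent F fun q => chi ι (r q) :=
    linearIndependent_chi ι hι (H := H) (fun x => hF ▸ ⟨x, rfl⟩) r (by
      intro a b hab
      simpa only [hr] using hab)
  have hint : ∀ x ∈ Set.range (chi ι), IsAlgebraic F x := by
    rintro _ ⟨m, rfl⟩
    refine (isIntegral_chi ι hF (d := Nat.card (M ⧸ H)) Nat.card_pos.ne' ?_).isAlgebraic
    rw [← QuotientAddGroup.eq_zero_iff]
    change ((Nat.card (M ⧸ H)) • (m : M ⧸ H)) = 0
    exact card_nsmul_eq_zero'
  have htop := IntermediateField.adjoin_toSubalgebra_of_isAlgebraic hint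
  rw [adjoin_chi_eq_top ι hF hE] at htop
  have hsp : (⊤ : Submodule F E) ≤ Submodule.span F (Set.range fun q => chi ι (r q)) := by
    have h1 : Subalgebra.toSubmodule (Algebra.adjoin F (Set.range (chi ι))) = ⊤ := by
      rw [← htop]; rfl
    rw [← h1, Algebra.adjoin_eq_span, Submodule.span_le]
    intro x hx
    have : ∃ m, chi ι m = x := by
      induction hx using Submonoid.closure_induction with
      | mem x hx => exact hx
      | one => exact ⟨0, chi_zero ι⟩
      | mul x y _ _ hx hy =>
        obtain ⟨m, rfl⟩ := hx
        obtain ⟨m', rfl⟩ := hy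
        exact ⟨m + m', chi_add ι m m'⟩
    obtain ⟨m, rfl⟩ := this
    have hmem : m - r m ∈ H := by
      have h2 : -r m + m ∈ H := QuotientAddGroup.eq.mp (hr m)
      rwa [neg_add_eq_sub] at h2
    have h3 := chi_mem_latticeField ι hmem
    rw [← hF] at h3
    obtain ⟨a, ha⟩ := h3
    have h4 : chi ι m = a • chi ι (r m) := by
      rw [Algebra.smul_def, ha, ← chi_add, sub_add_cancel]
    rw [h4]
    exact Submodule.smul_mem _ _ (Submodule.subset_span ⟨m, rfl⟩)
  let b := Module.Basis.mk hli hsp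
  exact ⟨by rw [Module.finrank_eq_card_basis b, Nat.card_eq_fintype_card],
    Module.Finite.of_basis b⟩

/-- The separable degree in characteristic `p`, when there is a lattice `H'` between `H` and `M`
such that `H'/H` is a `p`-group and `M/H'` has no `p`-torsion. -/
theorem finSepDegree_of_chi (hι : Function.Injective ι)
    (hF : (algebraMap F E).fieldRange = latticeField ι H)
    (hE : latticeField ι ⊤ = ⊤) [Finite (M ⧸ H)] {p : ℕ} [CharP F p] (hp : p.Prime)
    {H' : AddSubgroup M} (hH : H ≤ H') (hpow : ∀ m ∈ H', ∃ n : ℕ, p ^ n • m ∈ H)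
    (hcop : (Nat.card (M ⧸ H')).Coprime p) :
    Field.finSepDegree F E = Nat.card (M ⧸ H') := by
  have : ExpChar F p := ExpChar.prime hp
  have hfin' : Finite (M ⧸ H') :=
    Finite.of_surjective (QuotientAddGroup.map H H' (AddMonoidHom.id M) hH) (by
      intro q
      obtain ⟨m, rfl⟩ := QuotientAddGroup.mk_surjective q
      exact ⟨m, rfl⟩)
  -- The field of `H'` splits the extension. Below it, `p`-power multiples of lattice elements fall
  -- into `H`, which gives pure inseparability; above it, the index is prime to `p`, which gives
  -- separability.
  let K := IntermediateField.adjoin F (chi ι '' (H' : Set M))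
  have hK : (algebraMap K E).fieldRange = latticeField ι H' := by
    rw [fieldRange_adjoin_chi ι hF, AddSubgroup.closure_eq, sup_eq_right.mpr hH]
  have hKins : IsPurelyInseparable F K := by
    rw [IntermediateField.isPurelyInseparable_adjoin_iff_pow_mem F E p]
    rintro _ ⟨m, hm, rfl⟩
    obtain ⟨n, hn⟩ := hpow m hm
    exact ⟨n, chi_pow_mem_range ι hF hn⟩
  have : CharP K p := charP_of_injective_algebraMap (algebraMap F K).injective p
  have hsep : Algebra.IsSeparable K E := by
    apply isSeparable_of_chi ι hK hE
    intro m
    refine ⟨Nat.card (M ⧸ H'), ?_, ?_⟩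
    · rw [Ne, CharP.cast_eq_zero_iff K p]
      intro hdvd
      have := Nat.eq_one_of_dvd_coprimes hcop hdvd dvd_rfl
      exact hp.one_lt.ne' this
    · rw [← QuotientAddGroup.eq_zero_iff]
      change ((Nat.card (M ⧸ H')) • (m : M ⧸ H')) = 0
      exact card_nsmul_eq_zero'
  have := (finrank_of_chi ι hι hF hE).2
  rw [← Field.finSepDegree_mul_finSepDegree_of_isAlgebraic F K E,
    IsPurelyInseparable.finSepDegree_eq_one F K, one_mul,
    Field.finSepDegree_eq_finrank_of_isSeparable K E, (finrank_of_chi ι hι hK hE).1]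

/-- If `M/H` has `p`-torsion, then `E` is not separable over the field of `k[H]`. -/
theorem not_isSeparableExtension_of_chi (hι : Function.Injective ι)
    (hF : (algebraMap F E).fieldRange = latticeField ι H) {p : ℕ} [CharP F p] (hp : p.Prime)
    {m : M} (hm : m ∉ H) (hpm : p • m ∈ H) : ¬ IsSeparableExtension F E := by
  rintro ⟨s, hs, hsep⟩
  have : ExpChar F p := ExpChar.prime hp
  obtain ⟨a, ha⟩ := chi_pow_mem_range ι hF hpm
  have hx : chi ι m ∉ (algebraMap F E).range := by
    intro h
    have h1 : chi ι m ∈ (algebraMap F E).fieldRange := h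
    rw [hF] at h1
    exact hm (mem_of_chi_mem_latticeField ι hι h1)
  have halg : IsAlgebraic F (chi ι m) := (isIntegral_chi ι hF hp.ne_zero hpm).isAlgebraic
  let K := IntermediateField.adjoin F s
  have : ExpChar K p := expChar_of_injective_algebraMap (algebraMap F K).injective p
  -- Over `K = F(s)` the element `χ^m` is purely inseparable, since its `p`-th power lies in `F`,
  -- and separable by assumption. Hence it lies in `K`.
  have hmem : chi ι m ∈ (algebraMap K E).range := by
    have hps : IsPurelyInseparable K (IntermediateField.adjoin K {chi ι m}) := by
      rw [IntermediateField.isPurelyInseparable_adjoin_iff_pow_mem K E p]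
      rintro _ rfl
      refine ⟨1, algebraMap F K a, ?_⟩
      rw [← IsScalarTower.algebraMap_apply, ha, pow_one]
    have hss : Algebra.IsSeparable K (IntermediateField.adjoin K {chi ι m}) := inferInstance
    obtain ⟨y, hy⟩ := IsPurelyInseparable.surjective_algebraMap_of_isSeparable K
      (IntermediateField.adjoin K {chi ι m})
      ⟨chi ι m, IntermediateField.mem_adjoin_simple_self K _⟩
    exact ⟨y, congrArg Subtype.val hy⟩
  obtain ⟨⟨y, hy⟩, hyx⟩ := hmem
  change y = chi ι m at hyx
  subst hyx
  rw [IntermediateField.mem_adjoin_iff_div] at hy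
  obtain ⟨P, hP, Q, hQ, hPQ⟩ := hy
  have hs1 : AlgebraicIndependent F ((↑) : s → E) := hs.1
  have hr : Algebra.adjoin F s = (MvPolynomial.aeval ((↑) : s → E)).range := by
    rw [← Algebra.adjoin_range_eq_range_aeval, Subtype.range_coe]
  rw [hr] at hP hQ
  obtain ⟨P, rfl⟩ := hP
  obtain ⟨Q, rfl⟩ := hQ
  -- The set `s` stays algebraically independent over the algebraic closure of `F` in `E`, which
  -- contains `χ^m`. Comparing coefficients in `χ^m * Q = P` then exhibits `χ^m` as a quotient of
  -- elements of `F`.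
  have hind := hs1.algebraicClosure
  let A := algebraicClosure F E
  let z : A := ⟨chi ι m, mem_algebraicClosure_iff.mpr halg⟩
  have hQ0 : Q ≠ 0 := by
    rintro rfl
    apply chi_ne_zero ι m
    rw [hPQ]
    simp
  have hQ1 : MvPolynomial.aeval ((↑) : s → E) Q ≠ 0 := by
    intro h
    exact hQ0 ((injective_iff_map_eq_zero _).mp hs1 Q h)
  have heq : MvPolynomial.C z * MvPolynomial.map (algebraMap F A) Q =
      MvPolynomial.map (algebraMap F A) P := by
    apply hind
    rw [map_mul, MvPolynomial.aeval_C, MvPolynomial.aeval_map_algebraMap,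
      MvPolynomial.aeval_map_algebraMap]
    change chi ι m * _ = _
    rw [hPQ]
    exact div_mul_cancel₀ _ hQ1
  obtain ⟨d, hd⟩ := MvPolynomial.ne_zero_iff.mp hQ0
  have hc := congrArg (MvPolynomial.coeff d) heq
  rw [MvPolynomial.coeff_C_mul, MvPolynomial.coeff_map, MvPolynomial.coeff_map] at hc
  apply hx
  refine ⟨MvPolynomial.coeff d P / MvPolynomial.coeff d Q, ?_⟩
  have hc' := congrArg (algebraMap A E) hc
  rw [map_mul, ← IsScalarTower.algebraMap_apply, ← IsScalarTower.algebraMap_apply] at hc'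
  rw [map_div₀, ← hc']
  exact mul_div_cancel_right₀ _ ((map_ne_zero _).mpr hd)

/-- Monomials in characters that are independent modulo `H` are linearly independent over the
field of `k[H]`, so that the characters are algebraically independent. -/
theorem algebraicIndependent_chi (hι : Function.Injective ι)
    (hF : ∀ x : F, algebraMap F E x ∈ latticeField ι H) {J : Type*} (e : J → M)
    (he : Function.Injective fun c : J →₀ ℕ => ((c.sum fun j n => n • e j : M) : M ⧸ H)) :
    AlgebraicIndependent F fun j => chi ι (e j) := by
  have hli := linearIndependent_chi ι hι hF (fun c : J →₀ ℕ => c.sum fun j n => n • e j) he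
  have hmon : ∀ c : J →₀ ℕ, MvPolynomial.aeval (R := F) (fun j => chi ι (e j))
      (MvPolynomial.monomial c 1) = chi ι (c.sum fun j n => n • e j) := by
    intro c
    rw [MvPolynomial.aeval_monomial, map_one, one_mul]
    induction c using Finsupp.induction_linear with
    | zero => simp [chi_zero]
    | add f g hf hg =>
      rw [Finsupp.prod_add_index' (by simp) (by intros; rw [pow_add]), hf, hg,
        Finsupp.sum_add_index' (by simp) (by intros; rw [add_smul]), chi_add]
    | single j n => simp [chi_nsmul]
  have hcomp : (fun c : J →₀ ℕ => chi ι (c.sum fun j n => n • e j)) =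
      (MvPolynomial.aeval (R := F) (fun j => chi ι (e j))).toLinearMap ∘
        (MvPolynomial.basisMonomials J F) := by
    funext c
    simp [MvPolynomial.coe_basisMonomials, hmon]
  rw [hcomp] at hli
  exact LinearMap.injective_of_linearIndependent (MvPolynomial.basisMonomials J F).span_eq hli

end CharExtension

/-! ### Base change of lattices, elementary divisors, saturation -/

section Lattice

variable {M : Type*} [AddCommGroup M]

/-- The linear functional on `R ⊗ M` that extends an additive map `M → R`. -/
def functional {R : Type*} [CommRing R] (φ : M →+ R) : R ⊗[ℤ] M →ₗ[R] R :=
  φ.toIntLinearMap.liftBaseChange R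

@[simp]
theorem functional_toModule {R : Type*} [CommRing R] (φ : M →+ R) (m : M) :
    functional φ (toModule R m) = φ m := by
  simp [functional, toModule]

theorem toModule_add (R : Type*) [CommRing R] (m m' : M) :
    toModule R (m + m') = toModule R m + toModule R m' :=
  TensorProduct.tmul_add _ _ _

theorem toModule_sub (R : Type*) [CommRing R] (m m' : M) :
    toModule R (m - m') = toModule R m - toModule R m' :=
  TensorProduct.tmul_sub _ _ _

theorem toModule_zsmul (R : Type*) [CommRing R] (n : ℤ) (m : M) :
    toModule R (n • m) = (n : R) • toModule R m := by
  rw [toModule, TensorProduct.tmul_smul, toModule, Int.cast_smul_eq_zsmul]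

theorem toModule_sum (R : Type*) [CommRing R] {J : Type*} (s : Finset J) (m : J → M) :
    toModule R (∑ j ∈ s, m j) = ∑ j ∈ s, toModule R (m j) :=
  TensorProduct.tmul_sum _ _ _

theorem span_range_toModule (R : Type*) [CommRing R] :
    Submodule.span R (Set.range (toModule R : M → R ⊗[ℤ] M)) = ⊤ := by
  rw [eq_top_iff]
  intro x _
  induction x using TensorProduct.induction_on with
  | zero => exact zero_mem _
  | add x y hx hy => exact add_mem (hx trivial) (hy trivial)
  | tmul r m =>
    have : r ⊗ₜ[ℤ] m = r • toModule R m := by simp [toModule, TensorProduct.smul_tmul']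
    rw [this]
    exact Submodule.smul_mem _ _ (Submodule.subset_span ⟨m, rfl⟩)

/-- The additive map `M → R` given by a linear functional on `R ⊗ M`. -/
def restrictFunctional {R : Type*} [CommRing R] (Φ : R ⊗[ℤ] M →ₗ[R] R) : M →+ R where
  toFun m := Φ (toModule R m)
  map_zero' := by simp [toModule]
  map_add' a b := by rw [toModule_add, map_add]

theorem functional_restrictFunctional {R : Type*} [CommRing R] (Φ : R ⊗[ℤ] M →ₗ[R] R) :
    functional (restrictFunctional Φ) = Φ := by
  apply LinearMap.ext_on_range (span_range_toModule R)
  intro m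
  rw [functional_toModule]
  rfl

theorem natAbs_nsmul_mem {L : AddSubgroup M} {d : ℤ} {m : M} (h : d • m ∈ L) :
    d.natAbs • m ∈ L := by
  rw [← natCast_zsmul]
  rcases Int.natAbs_eq d with h' | h'
  · rwa [← h']
  · rw [h', neg_smul] at h
    exact neg_mem_iff.mp h

/-- In `k ⊗ M` the lattice spans the same subspace as the vectors `a_i e_{f i}`. Each of them is a
multiple of a distinct basis vector, so the dimension drops exactly when some `a_i` vanishes in `k`.
-/
theorem finrank_span_toModule_eq_iff (k : Type*) [Field k] {L : AddSubgroup M} {n r : ℕ}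
    (e : Module.Basis (Fin n) ℤ M) (f : Fin r ↪ Fin n) (a : Fin r → ℤ)
    (h1 : ∀ m ∈ L, ∃ c : Fin r → ℤ, m = ∑ i, c i • a i • e (f i))
    (h2 : ∀ i, a i • e (f i) ∈ L) :
    Module.finrank k (Submodule.span k (toModule k '' (L : Set M))) = r ↔
      ∀ i, (a i : k) ≠ 0 := by
  let v : Fin r → k ⊗[ℤ] M := fun i => (a i : k) • (e.baseChange k) (f i)
  have hv : ∀ i, toModule k (a i • e (f i)) = v i := by
    intro i
    rw [toModule_zsmul]
    simp [v, toModule]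
  have hspan : Submodule.span k (toModule k '' (L : Set M)) =
      Submodule.span k (Set.range v) := by
    apply le_antisymm
    · rw [Submodule.span_le]
      rintro _ ⟨m, hm, rfl⟩
      obtain ⟨c, rfl⟩ := h1 m hm
      rw [toModule_sum]
      refine Submodule.sum_mem _ fun i _ => ?_
      rw [toModule_zsmul, hv]
      exact Submodule.smul_mem _ _ (Submodule.subset_span ⟨i, rfl⟩)
    · rw [Submodule.span_le]
      rintro _ ⟨i, rfl⟩
      exact Submodule.subset_span ⟨_, h2 i, hv i⟩
  have hli := linearIndependent_iff_card_eq_finrank_span (R := k) (b := v)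
  rw [Fintype.card_fin, eq_comm] at hli
  rw [hspan]
  refine hli.symm.trans ⟨fun h i hi => h.ne_zero i (by simp [v, hi]), fun h => ?_⟩
  have hb : LinearIndependent k fun i => (e.baseChange k) (f i) :=
    (e.baseChange k).linearIndependent.comp f f.injective
  exact hb.units_smul fun i => Units.mk0 _ (h i)

/-- The characters of the basis vectors outside the range of `f` form the transcendence basis. Over
the field they generate, the lattice becomes `L` plus these vectors, and the product of the
elementary divisors, invertible in `F`, multiplies `M` into it. -/
theorem isSeparableExtension_of_chi {k E : Type*} [Field k] [Field E]
    (ι : AddMonoidAlgebra k M →+* E) (hι : Function.Injective ι)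
    {F : Type*} [Field F] [Algebra F E] {L : AddSubgroup M}
    (hF : (algebraMap F E).fieldRange = latticeField ι L) (hE : latticeField ι ⊤ = ⊤) {n r : ℕ}
    (e : Module.Basis (Fin n) ℤ M) (f : Fin r ↪ Fin n) (a : Fin r → ℤ)
    (h1 : ∀ m ∈ L, ∃ c : Fin r → ℤ, m = ∑ i, c i • a i • e (f i))
    (h2 : ∀ i, a i • e (f i) ∈ L) (ha : ∀ i, (a i : F) ≠ 0) : IsSeparableExtension F E := by
  classical
  let J := {j : Fin n // j ∉ Set.range f}
  let e' : J → M := fun j => e j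
  have hcoord : ∀ m ∈ L, ∀ j : J, e.repr m j = 0 := by
    rintro m hm ⟨j, hj⟩
    obtain ⟨c, rfl⟩ := h1 m hm
    have : ∀ i, f i ≠ j := fun i hi => hj ⟨i, hi⟩
    simp [this]
  have hrepr : ∀ (c : J →₀ ℕ) (j : J), e.repr (c.sum fun j n => n • e' j) j = c j := by
    intro c j
    rw [Finsupp.sum, map_sum, Finset.sum_apply', Finset.sum_eq_single j]
    · simp [e']
    · intro i _ hij
      have : (i : Fin n) ≠ j := fun h => hij (Subtype.ext h)
      simp [e', this]
    · intro h
      simp [Finsupp.notMem_support_iff.mp h]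
  have hind : AlgebraicIndependent F fun j => chi ι (e' j) := by
    apply algebraicIndependent_chi ι hι (H := L) (fun x => hF ▸ ⟨x, rfl⟩)
    intro c c' hcc
    have hmem := QuotientAddGroup.eq.mp hcc
    ext j
    have := hcoord _ hmem j
    rw [map_add, map_neg, Finsupp.add_apply, Finsupp.neg_apply, hrepr, hrepr] at this
    omega
  let s : Set E := chi ι '' Set.range e'
  have hs : s = Set.range fun j => chi ι (e' j) := by
    simp only [s, ← Set.range_comp]; rfl
  let K := IntermediateField.adjoin F s
  have hK : (algebraMap K E).fieldRange = latticeField ι (L ⊔ AddSubgroup.closure (Set.range e')) :=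
    fieldRange_adjoin_chi ι hF _
  have hsep : Algebra.IsSeparable K E := by
    apply isSeparable_of_chi ι hK hE
    intro m
    let d := ∏ i, a i
    have hz : d • m ∈ L ⊔ AddSubgroup.closure (Set.range e') := by
      rw [← e.sum_repr m, Finset.smul_sum]
      refine AddSubgroup.sum_mem _ fun j _ => ?_
      by_cases hj : j ∈ Set.range f
      · obtain ⟨i, rfl⟩ := hj
        have : d • e.repr m (f i) • e (f i) =
            ((∏ x ∈ Finset.univ.erase i, a x) * e.repr m (f i)) • a i • e (f i) := by
          change (∏ i, a i) • _ = _
          rw [← Finset.mul_prod_erase Finset.univ a (Finset.mem_univ i)]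
          simp only [smul_smul]; congr 1; ring
        rw [this]
        exact (le_sup_left : L ≤ _) (L.zsmul_mem (h2 i) _)
      · rw [smul_smul]
        exact AddSubgroup.zsmul_mem _ ((le_sup_right : _ ≤ L ⊔ AddSubgroup.closure (Set.range e'))
          (AddSubgroup.subset_closure ⟨⟨j, hj⟩, rfl⟩)) _
    refine ⟨d.natAbs, ?_, ?_⟩
    · have hdF : (d : F) ≠ 0 := by
        simp only [d, Int.cast_prod]
        exact Finset.prod_ne_zero_iff.mpr fun i _ => ha i
      have hdF' : ((d.natAbs : ℕ) : F) ≠ 0 := by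
        intro h
        apply hdF
        rcases Int.natAbs_eq d with h' | h'
        · rw [h', Int.cast_natCast, h]
        · rw [h', Int.cast_neg, Int.cast_natCast, h, neg_zero]
      have := (map_ne_zero (algebraMap F K)).mpr hdF'
      rwa [map_natCast] at this
    · exact natAbs_nsmul_mem hz
  refine ⟨s, ?_, hsep⟩
  rw [isTranscendenceBasis_iff_algebraicIndependent_isAlgebraic]
  constructor
  · rw [hs]
    exact hind.coe_range
  · rw [Subtype.range_coe, ← IntermediateField.isAlgebraic_adjoin_iff_top]
    infer_instance

variable [Module.Free ℤ M] [Module.Finite ℤ M]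

/-- The elementary divisors of a sublattice. -/
theorem exists_elementary_divisors (L : AddSubgroup M) :
    ∃ (n r : ℕ) (e : Module.Basis (Fin n) ℤ M) (f : Fin r ↪ Fin n) (a : Fin r → ℤ),
      (∀ i, a i ≠ 0) ∧
      (∀ m ∈ L, ∃ c : Fin r → ℤ, m = ∑ i, c i • a i • e (f i)) ∧
      (∀ i, a i • e (f i) ∈ L) ∧
      Module.finrank ℤ (AddSubgroup.toIntSubmodule L) = r := by
  let b := Module.finBasis ℤ M
  obtain ⟨r, S⟩ := Submodule.smithNormalForm b (AddSubgroup.toIntSubmodule L)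
  refine ⟨_, r, S.bM, S.f, S.a, ?_, ?_, ?_, ?_⟩
  · intro i hi
    have := S.snf i
    rw [hi, zero_smul] at this
    exact S.bN.ne_zero i (Subtype.ext this)
  · intro m hm
    refine ⟨fun i => S.bN.repr ⟨m, hm⟩ i, ?_⟩
    have := congrArg Subtype.val (S.bN.sum_repr ⟨m, hm⟩)
    simp only [AddSubmonoidClass.coe_finsetSum, Submodule.coe_smul, S.snf] at this
    exact this.symm
  · intro i
    rw [← S.snf i]
    exact (S.bN i).2
  · rw [Module.finrank_eq_card_basis S.bN, Fintype.card_fin]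

/-- Replaces the real span by torsion modulo `L`. In a basis adapted to `L`, an element of the span
has zero coordinates outside the range of `f`, and the product of the elementary divisors then
multiplies it into `L`. -/
theorem mem_realSaturation {L : AddSubgroup M} {m : M} :
    m ∈ realSaturation L ↔ ∃ d : ℕ, d ≠ 0 ∧ d • m ∈ L := by
  constructor
  · intro hm
    obtain ⟨n, r, e, f, a, ha, hL, hL', -⟩ := exists_elementary_divisors L
    have h0 : ∀ j ∉ Set.range f, e.repr m j = 0 := by
      intro j hj
      let φ : M →+ ℝ := (Int.castAddHom ℝ).comp (e.coord j).toAddMonoidHom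
      have hle : Submodule.span ℝ (toModule ℝ '' (L : Set M)) ≤
          LinearMap.ker (functional φ) := by
        rw [Submodule.span_le]
        rintro _ ⟨l, hl, rfl⟩
        obtain ⟨c, rfl⟩ := hL l hl
        have : ∀ i, f i ≠ j := fun i hi => hj ⟨i, hi⟩
        simp [φ, this]
      have := hle hm
      rw [LinearMap.mem_ker, functional_toModule] at this
      simpa [φ] using this
    have hd : ∏ i, a i ≠ 0 := Finset.prod_ne_zero_iff.mpr fun i _ => ha i
    refine ⟨(∏ i, a i).natAbs, Int.natAbs_ne_zero.mpr hd, ?_⟩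
    have hz : (∏ i, a i) • m ∈ L := by
      have hs : m = ∑ i, e.repr m (f i) • e (f i) := by
        conv_lhs => rw [← e.sum_repr m]
        rw [← Finset.sum_subset (Finset.subset_univ (Finset.univ.map f))]
        · rw [Finset.sum_map]
        · intro j _ hj
          rw [h0 j (by simpa using hj), zero_smul]
      rw [hs, Finset.smul_sum]
      refine L.sum_mem fun i _ => ?_
      rw [← Finset.mul_prod_erase Finset.univ a (Finset.mem_univ i)]
      have : (a i * ∏ x ∈ Finset.univ.erase i, a x) • e.repr m (f i) • e (f i) =
          ((∏ x ∈ Finset.univ.erase i, a x) * e.repr m (f i)) • a i • e (f i) := by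
        simp only [smul_smul]; congr 1; ring
      rw [this]
      exact L.zsmul_mem (hL' i) _
    exact natAbs_nsmul_mem hz
  · rintro ⟨d, hd, hm⟩
    change toModule ℝ m ∈ Submodule.span ℝ (toModule ℝ '' (L : Set M))
    have : toModule ℝ m = (d : ℝ)⁻¹ • toModule ℝ (d • m) := by
      have h := toModule_zsmul ℝ (d : ℤ) m
      rw [natCast_zsmul] at h
      rw [h, smul_smul]
      simp [hd]
    rw [this]
    exact Submodule.smul_mem _ _ (Submodule.subset_span ⟨_, hm, rfl⟩)

instance finite_realSaturation_quotient (L : AddSubgroup M) :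
    Finite (realSaturation L ⧸ L.addSubgroupOf (realSaturation L)) := by
  have : Module.Finite ℤ (realSaturation L) :=
    inferInstanceAs (Module.Finite ℤ (AddSubgroup.toIntSubmodule (realSaturation L)))
  have : Module.Finite ℤ (realSaturation L ⧸ L.addSubgroupOf (realSaturation L)) :=
    Module.Finite.of_surjective
      (QuotientAddGroup.mk' (L.addSubgroupOf (realSaturation L))).toIntLinearMap
      (QuotientAddGroup.mk'_surjective _)
  apply Module.finite_of_fg_torsion
  intro q
  obtain ⟨m, rfl⟩ := QuotientAddGroup.mk_surjective q
  obtain ⟨d, hd, hm⟩ := mem_realSaturation.mp m.2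
  refine ⟨⟨(d : ℤ), mem_nonZeroDivisors_of_ne_zero (by exact_mod_cast hd)⟩, ?_⟩
  change (d : ℤ) • (m : realSaturation L ⧸ L.addSubgroupOf (realSaturation L)) = 0
  rw [natCast_zsmul, ← QuotientAddGroup.mk_nsmul, QuotientAddGroup.eq_zero_iff]
  exact hm

/-- The separability criterion for the extension `K(T_M) / K(T_L)`. -/
theorem isSeparableExtension_chi_iff {k E : Type*} [Field k] [Field E]
    (ι : AddMonoidAlgebra k M →+* E) (hι : Function.Injective ι)
    {F : Type*} [Field F] [Algebra F E] {L : AddSubgroup M}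
    (hF : (algebraMap F E).fieldRange = latticeField ι L) (hE : latticeField ι ⊤ = ⊤) :
    IsSeparableExtension F E ↔
      Module.finrank k (Submodule.span k (toModule k '' (L : Set M))) =
        Module.finrank ℤ (AddSubgroup.toIntSubmodule L) := by
  obtain ⟨n, r, e, f, a, ha, h1, h2, hr⟩ := exists_elementary_divisors L
  rw [hr, finrank_span_toModule_eq_iff k e f a h1 h2]
  -- `F` and `k` both embed in `E`, so an integer vanishes in one iff it vanishes in the other.
  let κ : k →+* E := ι.comp AddMonoidAlgebra.singleZeroRingHom
  have hcast : ∀ z : ℤ, (z : F) = 0 ↔ (z : k) = 0 := by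
    intro z
    rw [← map_eq_zero (algebraMap F E), ← map_eq_zero κ, map_intCast, map_intCast]
  constructor
  · intro hsep i hi
    obtain ⟨p, hp⟩ := CharP.exists F
    have hdvd : (p : ℤ) ∣ a i := by
      rw [← CharP.intCast_eq_zero_iff F p, hcast, hi]
    have hp0 : p ≠ 0 := by
      rintro rfl
      exact ha i (by simpa using hdvd)
    have hpp : p.Prime := (CharP.char_is_prime_or_zero F p).resolve_right hp0
    obtain ⟨b, hb⟩ := hdvd
    -- If `a_i = p b`, then `b e_{f i}` represents an element of order `p` in `M / L`.
    refine not_isSeparableExtension_of_chi ι hι hF hpp (m := b • e (f i)) ?_ ?_ hsep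
    · intro hmem
      obtain ⟨c, hc⟩ := h1 _ hmem
      have := congrArg (fun m => e.repr m (f i)) hc
      have hfi : ∀ j, f j = f i ↔ j = i := fun j => f.injective.eq_iff
      simp [Finsupp.single_apply, hfi] at this
      have hb0 : b ≠ 0 := by
        rintro rfl
        exact ha i (by simp [hb])
      rw [hb] at this
      have h3 : (c i * p - 1) * b = 0 := by linear_combination -this
      rcases mul_eq_zero.mp h3 with h4 | h4
      · have : (p : ℤ) ∣ 1 := ⟨c i, by linear_combination -h4⟩
        exact hpp.one_lt.ne' (by exact_mod_cast Int.natAbs_dvd_natAbs.mpr this |> Nat.dvd_one.mp)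
      · exact hb0 h4
    · rw [← natCast_zsmul, smul_smul, ← hb]
      exact h2 i
  · intro h
    exact isSeparableExtension_of_chi ι hι hF hE e f a h1 h2 fun i => by
      rw [Ne, hcast]; exact h i

/-- The characters of a `ℤ`-basis form a transcendence basis: this is the case `H = ⊥`, whose field
is `k`. Algebraicity over the field they generate is trivial (`d = 1`), since all characters already
lie in it. -/
theorem trdeg_of_chi {k E : Type*} [Field k] [Field E] [Algebra k E]
    (ι : AddMonoidAlgebra k M →ₐ[k] E) (hι : Function.Injective ι)
    (hE : latticeField (ι : AddMonoidAlgebra k M →+* E) ⊤ = ⊤) :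
    Cardinal.toNat (Algebra.trdeg k E) = Module.finrank ℤ M := by
  let e := Module.finBasis ℤ M
  have hF : (algebraMap k E).fieldRange =
      latticeField (ι : AddMonoidAlgebra k M →+* E) ⊥ := by
    have hc : ∀ c : k, (ι : AddMonoidAlgebra k M →+* E) (AddMonoidAlgebra.single 0 c) =
        algebraMap k E c := fun c => ι.commutes c
    apply le_antisymm
    · rintro _ ⟨c, rfl⟩
      rw [← hc]
      exact single_mem_latticeField _ (zero_mem _) c
    · apply latticeField_le
      · exact fun c => ⟨c, (hc c).symm⟩
      · intro m hm
        rw [AddSubgroup.mem_bot] at hm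
        rw [hm, chi_zero]
        exact one_mem _
  have hind : AlgebraicIndependent k fun j => chi (ι : AddMonoidAlgebra k M →+* E) (e j) := by
    apply algebraicIndependent_chi _ hι (H := ⊥) (fun x => hF ▸ ⟨x, rfl⟩)
    intro c c' hcc
    have hmem := QuotientAddGroup.eq.mp hcc
    rw [AddSubgroup.mem_bot, neg_add_eq_zero] at hmem
    have hs : ∀ c : Fin (Module.finrank ℤ M) →₀ ℕ, ∀ j,
        e.repr (c.sum fun j n => n • e j) j = c j := by
      intro c j
      rw [Finsupp.sum, map_sum, Finset.sum_apply', Finset.sum_eq_single j]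
      · simp
      · intro i _ hij
        simp [hij]
      · intro h
        simp [Finsupp.notMem_support_iff.mp h]
    ext j
    have := congrArg (fun m => e.repr m j) hmem
    simp only [hs] at this
    exact_mod_cast this
  have hb : IsTranscendenceBasis k fun j => chi (ι : AddMonoidAlgebra k M →+* E) (e j) := by
    rw [isTranscendenceBasis_iff_algebraicIndependent_isAlgebraic]
    refine ⟨hind, ?_⟩
    rw [← IntermediateField.isAlgebraic_adjoin_iff_top]
    have hK := fieldRange_adjoin_chi (ι : AddMonoidAlgebra k M →+* E) hF (Set.range e)
    rw [← Set.range_comp] at hK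
    refine isAlgebraic_of_chi _ hK hE fun m => ⟨1, one_ne_zero, ?_⟩
    have hcl : AddSubgroup.closure (Set.range e) = ⊤ := by
      rw [← Submodule.span_int_eq_addSubgroupClosure, e.span_eq]; rfl
    rw [hcl, sup_top_eq]
    trivial
  rw [← Cardinal.toNat_lift, ← hb.lift_cardinalMk_eq_trdeg]
  simp

end Lattice

/-! ### The `p`-primary part of a finite quotient -/

section PrimaryPart

variable {G : Type*} [AddCommGroup G]

/-- The preimage of the `n`-torsion of `G/H`. -/
def torsionPreimage (H : AddSubgroup G) (n : ℕ) : AddSubgroup G :=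
  H.comap (nsmulAddMonoidHom n)

theorem mem_torsionPreimage {H : AddSubgroup G} {n : ℕ} {g : G} :
    g ∈ torsionPreimage H n ↔ n • g ∈ H := Iff.rfl

theorem le_torsionPreimage (H : AddSubgroup G) (n : ℕ) : H ≤ torsionPreimage H n :=
  fun _ hg => H.nsmul_mem hg n

/-- Let `p^s` be the exact power of `p` in the order of `Q = G / H`. Multiplication by `p^s` on `Q`
has the `p`-primary part as kernel and a group of order prime to `p` as image, and this image is the
quotient by the torsion preimage. -/
theorem card_quotient_torsionPreimage (H : AddSubgroup G) [Finite (G ⧸ H)] {p : ℕ}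
    (hp : p.Prime) :
    (Nat.card (G ⧸ torsionPreimage H (p ^ (Nat.card (G ⧸ H)).factorization p))).Coprime p ∧
    Nat.card (G ⧸ H) = p ^ (Nat.card (G ⧸ H)).factorization p *
      Nat.card (G ⧸ torsionPreimage H (p ^ (Nat.card (G ⧸ H)).factorization p)) := by
  set Q := G ⧸ H
  set s := (Nat.card Q).factorization p
  have : Fact p.Prime := ⟨hp⟩
  let φ : Q →+ Q := nsmulAddMonoidHom (p ^ s)
  let ψ : G →+ Q := φ.comp (QuotientAddGroup.mk' H)
  have hker : ψ.ker = torsionPreimage H (p ^ s) := by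
    ext g
    rw [AddMonoidHom.mem_ker, mem_torsionPreimage, ← QuotientAddGroup.eq_zero_iff]
    rfl
  have hrange : ψ.range = φ.range := by
    ext x
    constructor
    · rintro ⟨g, rfl⟩
      exact ⟨_, rfl⟩
    · rintro ⟨q, rfl⟩
      obtain ⟨g, rfl⟩ := QuotientAddGroup.mk_surjective q
      exact ⟨g, rfl⟩
  have hc1 : Nat.card (G ⧸ torsionPreimage H (p ^ s)) = Nat.card φ.range := by
    rw [← hker, ← hrange]
    exact Nat.card_congr (QuotientAddGroup.quotientKerEquivRange ψ).toEquiv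
  have hc2 : Nat.card Q = Nat.card φ.range * Nat.card φ.ker := by
    rw [AddSubgroup.card_eq_card_quotient_mul_card_addSubgroup φ.ker]
    congr 1
    exact Nat.card_congr (QuotientAddGroup.quotientKerEquivRange φ).toEquiv
  have hK : ∀ {ℓ : ℕ}, ℓ.Prime → ℓ ∣ Nat.card φ.ker → ℓ = p := by
    intro ℓ hℓ hdvd
    have : Fact ℓ.Prime := ⟨hℓ⟩
    obtain ⟨x, hx⟩ := exists_prime_addOrderOf_dvd_card' ℓ hdvd
    have h1 : p ^ s • x = 0 := Subtype.ext x.2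
    have h2 := addOrderOf_dvd_of_nsmul_eq_zero h1
    rw [hx] at h2
    exact (Nat.prime_dvd_prime_iff_eq hℓ hp).mp (hℓ.dvd_of_dvd_pow h2)
  -- By Cauchy's theorem there would be an element `p^s y` of order `p`. Then `y` has `p`-power
  -- order dividing the order of `Q`, so `p^s` already kills it.
  have hR : ¬ p ∣ Nat.card φ.range := by
    intro hdvd
    obtain ⟨⟨x, y, rfl⟩, hx⟩ := exists_prime_addOrderOf_dvd_card' p hdvd
    have h0 : p • (p ^ s • y) = 0 := by
      have := addOrderOf_nsmul_eq_zero (⟨φ y, y, rfl⟩ : φ.range)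
      rw [hx] at this
      exact congrArg Subtype.val this
    rw [← mul_nsmul', ← pow_succ'] at h0
    obtain ⟨j, -, hj⟩ := (Nat.dvd_prime_pow hp).mp (addOrderOf_dvd_of_nsmul_eq_zero h0)
    have hjs : j ≤ s := by
      rw [← hp.pow_dvd_iff_le_factorization Nat.card_pos.ne', ← hj]
      exact addOrderOf_dvd_natCard y
    have : φ y = 0 := addOrderOf_dvd_iff_nsmul_eq_zero.mp (hj ▸ pow_dvd_pow p hjs)
    have h1 : (⟨φ y, y, rfl⟩ : φ.range) = 0 := Subtype.ext this
    rw [h1, addOrderOf_zero] at hx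
    exact hp.one_lt.ne hx
  have hcop : (Nat.card φ.range).Coprime p := ((Nat.Prime.coprime_iff_not_dvd hp).mpr hR).symm
  refine ⟨hc1 ▸ hcop, ?_⟩
  obtain ⟨a, ha⟩ : ∃ a, Nat.card φ.ker = p ^ a := ⟨_, Nat.eq_prime_pow_of_unique_prime_dvd
    Nat.card_pos.ne' hK⟩
  have hs : s = a := by
    change (Nat.card Q).factorization p = a
    rw [hc2, ha, Nat.factorization_mul Nat.card_pos.ne' (pow_ne_zero _ hp.ne_zero),
      Finsupp.add_apply, Nat.factorization_eq_zero_of_not_dvd hR, zero_add,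
      hp.factorization_pow, Finsupp.single_eq_same]
  rw [hc1, hs, ← ha, mul_comm]
  exact hc2

end PrimaryPart

/-! ### Degrees of the morphisms of tori given by lattice inclusions -/

section TorusDegrees

variable (k : Type*) {M : Type*} [Field k] [AddCommGroup M] {L L' : AddSubgroup M}

theorem torusComorphism_single (h : L ≤ L') (m : L) (c : k) :
    torusComorphism k h (AddMonoidAlgebra.single m c) =
      AddMonoidAlgebra.single (AddSubgroup.inclusion h m) c := by
  simp [torusComorphism]

/-- A power of each monomial comes from `k[L]`, so the extension is integral; being also of finite
type, it is finite. -/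
theorem torusComorphism_finite (h : L ≤ L') [AddGroup.FG L']
    (hd : ∀ m ∈ L', ∃ d : ℕ, d ≠ 0 ∧ d • m ∈ L) :
    (torusComorphism k h).toRingHom.Finite := by
  apply RingHom.IsIntegral.to_finite
  · intro x
    induction x using AddMonoidAlgebra.induction_linear with
    | zero => exact RingHom.isIntegralElem_zero _
    | add f g hf hg => exact hf.add _ hg
    | single m c =>
      obtain ⟨d, hd0, hd⟩ := hd m m.2
      have hs : (AddMonoidAlgebra.single m c : AddMonoidAlgebra k L') ^ d =
          (torusComorphism k h).toRingHom (AddMonoidAlgebra.single ⟨d • (m : M), hd⟩ (c ^ d)) := by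
        rw [AddMonoidAlgebra.single_pow]
        exact (torusComorphism_single k h ⟨d • (m : M), hd⟩ (c ^ d)).symm
      let _ := (torusComorphism k h).toRingHom.toAlgebra
      refine IsIntegral.of_pow (R := AddMonoidAlgebra k L) (Nat.pos_of_ne_zero hd0) ?_
      rw [hs]
      exact isIntegral_algebraMap
  · have : AddMonoid.FG L' := AddGroup.fg_iff_addMonoid_fg.mp inferInstance
    have hft : (algebraMap k (AddMonoidAlgebra k L')).FiniteType :=
      RingHom.finiteType_algebraMap.mpr inferInstance
    rw [← (torusComorphism k h).comp_algebraMap] at hft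
    exact RingHom.FiniteType.of_comp_finiteType hft

variable [Module.Free ℤ M]

theorem latticeField_top_eq_top (G : Type*) [AddCommGroup G] [IsDomain (AddMonoidAlgebra k G)] :
    latticeField (algebraMap (AddMonoidAlgebra k G) (FractionRing (AddMonoidAlgebra k G))) ⊤ =
      ⊤ := by
  set ι := algebraMap (AddMonoidAlgebra k G) (FractionRing (AddMonoidAlgebra k G))
  rw [eq_top_iff]
  intro x _
  have hmem : ∀ a, ι a ∈ latticeField ι ⊤ := by
    intro a
    induction a using AddMonoidAlgebra.induction_linear with
    | zero => rw [map_zero]; exact zero_mem _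
    | add f g hf hg => rw [map_add]; exact add_mem hf hg
    | single m c => exact single_mem_latticeField ι (AddSubgroup.mem_top m) c
  obtain ⟨a, b, -, rfl⟩ := IsFractionRing.div_surjective (A := AddMonoidAlgebra k G) x
  exact div_mem (hmem a) (hmem b)

/-- Identifies the pulled-back function field with the field of the sublattice, so that the results
on extensions generated by characters apply. -/
theorem fieldRange_torusFieldMap (h : L ≤ L') :
    (torusFieldMap k h).fieldRange =
      latticeField (algebraMap (AddMonoidAlgebra k L') (FractionRing (AddMonoidAlgebra k L')))
        (L.addSubgroupOf L') := by
  set ι := algebraMap (AddMonoidAlgebra k L') (FractionRing (AddMonoidAlgebra k L'))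
  have hmap : ∀ a, torusFieldMap k h (algebraMap _ _ a) = ι (torusComorphism k h a) := fun a =>
    IsLocalization.map_eq (g := (torusComorphism k h).toRingHom)
      (nonZeroDivisors_le_comap_nonZeroDivisors_of_injective _ (torusComorphism_injective k h)) a
  apply le_antisymm
  · rintro _ ⟨x, rfl⟩
    obtain ⟨a, b, -, rfl⟩ := IsFractionRing.div_surjective (A := AddMonoidAlgebra k L) x
    have hmem : ∀ a, ι (torusComorphism k h a) ∈ latticeField ι (L.addSubgroupOf L') := by
      intro a
      induction a using AddMonoidAlgebra.induction_linear with
      | zero => rw [map_zero, map_zero]; exact zero_mem _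
      | add f g hf hg => rw [map_add, map_add]; exact add_mem hf hg
      | single m c =>
        rw [torusComorphism_single]
        exact single_mem_latticeField ι m.2 c
    rw [map_div₀, hmap, hmap]
    exact div_mem (hmem a) (hmem b)
  · apply latticeField_le
    · intro c
      refine ⟨algebraMap (AddMonoidAlgebra k L) _ (AddMonoidAlgebra.single 0 c), ?_⟩
      rw [hmap, torusComorphism_single]
      rfl
    · intro m hm
      refine ⟨algebraMap (AddMonoidAlgebra k L) _ (AddMonoidAlgebra.single ⟨m, hm⟩ 1), ?_⟩
      rw [hmap, torusComorphism_single]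
      rfl

theorem torusDegree_eq (h : L ≤ L') [Finite (L' ⧸ L.addSubgroupOf L')] :
    torusDegree k h = L.relIndex L' := by
  let _ := (torusFieldMap k h).toAlgebra
  exact (finrank_of_chi _ (IsFractionRing.injective _ _) (fieldRange_torusFieldMap k h)
    (latticeField_top_eq_top k L')).1

/-- The intermediate lattice needed in `finSepDegree_of_chi` is the preimage of the `p`-primary part
of `L'/L`. -/
theorem torusSepDegree_eq (h : L ≤ L') [Finite (L' ⧸ L.addSubgroupOf L')] {p : ℕ} (hp : p.Prime)
    [CharP k p] :
    torusSepDegree k h = Nat.card (L' ⧸ torsionPreimage (L.addSubgroupOf L')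
      (p ^ (L.relIndex L').factorization p)) := by
  let _ := (torusFieldMap k h).toAlgebra
  have : CharP (FractionRing (AddMonoidAlgebra k L)) p :=
    charP_of_injective_algebraMap (algebraMap k (FractionRing (AddMonoidAlgebra k L))).injective p
  exact finSepDegree_of_chi _ (IsFractionRing.injective _ _) (fieldRange_torusFieldMap k h)
    (latticeField_top_eq_top k L') hp (le_torsionPreimage _ _) (fun m hm => ⟨_, hm⟩)
    (card_quotient_torsionPreimage (L.addSubgroupOf L') hp).1

theorem torusSepDegree_mul_torusInsepDegree (h : L ≤ L') :
    torusSepDegree k h * torusInsepDegree k h = torusDegree k h := by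
  let _ := (torusFieldMap k h).toAlgebra
  exact Field.finSepDegree_mul_finInsepDegree _ _

end TorusDegrees

/-! ### Torus points as homomorphisms to `kˣ` -/

section TorusPoints

variable {k G : Type*} [Field k] [AddCommGroup G]

theorem character_zero (t : TorusPoint k G) : character 0 t = 1 := by
  rw [character, ← AddMonoidAlgebra.one_def, map_one]

theorem character_add (g h : G) (t : TorusPoint k G) :
    character (g + h) t = character g t * character h t := by
  simp only [character, ← map_mul, AddMonoidAlgebra.single_mul_single, mul_one]

/-- The homomorphism `G → kˣ` given by a torus point. -/
def charHom (t : TorusPoint k G) : G →+ Additive kˣ where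
  toFun g := Additive.ofMul (Units.mk0 (character g t) (character_ne_zero g t))
  map_zero' := by
    rw [ofMul_eq_zero]
    exact Units.ext (character_zero t)
  map_add' g h := by
    rw [← ofMul_mul]
    exact congrArg _ (Units.ext (character_add g h t))

theorem coe_charHom (t : TorusPoint k G) (g : G) :
    ((charHom t g).toMul : k) = character g t := rfl

/-- The torus point given by a homomorphism `G → kˣ`. -/
def pointOfHom (φ : G →+ Additive kˣ) : TorusPoint k G :=
  AddMonoidAlgebra.lift k k G ((Units.coeHom k).comp (AddMonoidHom.toMultiplicativeLeft φ))

@[simp]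
theorem character_pointOfHom (φ : G →+ Additive kˣ) (g : G) :
    character g (pointOfHom φ) = ((φ g).toMul : k) := by
  rw [character, pointOfHom, AddMonoidAlgebra.lift_single, one_smul]
  rfl

theorem torusPoint_ext {t t' : TorusPoint k G} (h : ∀ g, character g t = character g t') :
    t = t' :=
  (AddMonoidAlgebra.lift k k G).symm.injective (MonoidHom.ext h)

theorem charHom_eq_iff {t t' : TorusPoint k G} {g : G} :
    charHom t g = charHom t' g ↔ character g t = character g t' := by
  constructor
  · intro h
    rw [← coe_charHom, ← coe_charHom, h]
  · exact fun h => congrArg Additive.ofMul (Units.ext h)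

theorem character_sum {J : Type*} (s : Finset J) (g : J → G) (t : TorusPoint k G) :
    character (∑ j ∈ s, g j) t = ∏ j ∈ s, character (g j) t := by
  classical
  induction s using Finset.induction_on with
  | empty => simp [character_zero]
  | insert a s ha ih => rw [Finset.sum_insert ha, Finset.prod_insert ha, character_add, ih]

theorem apply_single (g : G) (c : k) (t : TorusPoint k G) :
    t (AddMonoidAlgebra.single g c) = c * character g t := by
  rw [character, ← smul_eq_mul, ← map_smul, AddMonoidAlgebra.smul_single, smul_eq_mul, mul_one]

end TorusPoints

/-! ### The affine cone over `X_A` and the torus of `M × ℤ` -/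

section Cone

variable {k M : Type*} [Field k] [AddCommGroup M] {N : ℕ} (u : Fin (N + 1) → M)

/-- The generators `(u_i, 1)` of the lattice `M × ℤ`. -/
def coneGen (i : Fin (N + 1)) : M × ℤ := (u i, 1)

/-- This is where the assumption that `A` spans `M` as an affine lattice enters: in linear terms,
the `(u_i, 1)` generate `M × ℤ`. -/
theorem exists_sum_coneGen (hA : affineSpan ℤ (Set.range u) = ⊤) (x : M × ℤ) :
    ∃ a : Fin (N + 1) → ℤ, ∑ i, a i • coneGen u i = x := by
  have key : ∀ m : M, ∃ w : Fin (N + 1) → ℤ, ∑ i, w i = 1 ∧ ∑ i, w i • u i = m := by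
    intro m
    obtain ⟨w, hw, h⟩ := eq_affineCombination_of_mem_affineSpan_of_fintype
      (k := ℤ) (p := u) (p1 := m) (hA ▸ trivial)
    rw [Finset.affineCombination_eq_linear_combination _ _ _ hw] at h
    exact ⟨w, hw, h.symm⟩
  obtain ⟨w, hw1, hw⟩ := key x.1
  obtain ⟨z, hz1, hz⟩ := key 0
  -- `w` represents `x.1` and `z` represents `0`, both with total weight `1`. Adding `x.2 - 1`
  -- copies of `z` corrects the last coordinate and leaves the first one alone.
  refine ⟨fun i => w i + (x.2 - 1) * z i, ?_⟩
  apply Prod.ext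
  · have h : ∀ i, ((w i + (x.2 - 1) * z i) • coneGen u i).1 =
        w i • u i + (x.2 - 1) • z i • u i := fun i => by simp [coneGen, add_smul, mul_smul]
    rw [Prod.fst_sum, Finset.sum_congr rfl fun i _ => h i, Finset.sum_add_distrib,
      ← Finset.smul_sum, hw, hz, smul_zero, add_zero]
  · rw [Prod.snd_sum]
    simp only [coneGen, Prod.smul_snd, smul_eq_mul, mul_one, Finset.sum_add_distrib,
      ← Finset.mul_sum, hw1, hz1]
    ring

theorem ext_on_coneGen {N : ℕ} {u : Fin (N + 1) → M}
    (hA : affineSpan ℤ (Set.range u) = ⊤) {G : Type*} [AddCommGroup G]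
    {φ ψ : M × ℤ →+ G} (h : ∀ i, φ (coneGen u i) = ψ (coneGen u i)) : φ = ψ := by
  ext1 x
  obtain ⟨a, rfl⟩ := exists_sum_coneGen u hA x
  simp [h]

/-- A map on the generators that respects the relations extends to `M × ℤ`. -/
theorem exists_hom_of_relations {N : ℕ} {u : Fin (N + 1) → M}
    (hA : affineSpan ℤ (Set.range u) = ⊤) {G : Type*} [AddCommGroup G]
    (g : Fin (N + 1) → G)
    (hg : ∀ a : Fin (N + 1) → ℤ, ∑ i, a i • coneGen u i = 0 → ∑ i, a i • g i = 0) :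
    ∃ φ : M × ℤ →+ G, ∀ i, φ (coneGen u i) = g i := by
  let π : (Fin (N + 1) → ℤ) →+ M × ℤ := (Fintype.linearCombination ℤ (coneGen u)).toAddMonoidHom
  let γ : (Fin (N + 1) → ℤ) →+ G := (Fintype.linearCombination ℤ g).toAddMonoidHom
  have hπ : Function.Surjective π := exists_sum_coneGen u hA
  have hker : π.ker ≤ γ.ker := fun a ha => hg a ha
  refine ⟨AddMonoidHom.liftOfRightInverse π _ (Function.rightInverse_surjInv hπ) ⟨γ, hker⟩,
    fun i => ?_⟩
  have h1 : π (Pi.single i 1) = coneGen u i := by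
    simp [π]
  rw [← h1, AddMonoidHom.liftOfRightInverse_comp_apply]
  simp [γ]

/-- The homomorphism `X_i ↦ z^(u_i, 1)`, whose kernel is the ideal of `X_A`. -/
def coneHom (k : Type*) [Field k] :
    MvPolynomial (Fin (N + 1)) k →ₐ[k] AddMonoidAlgebra k (M × ℤ) :=
  MvPolynomial.aeval fun i => AddMonoidAlgebra.single (coneGen u i) 1

theorem coneHom_monomial (s : Fin (N + 1) →₀ ℕ) (r : k) :
    coneHom u k (MvPolynomial.monomial s r) =
      AddMonoidAlgebra.single (∑ i, s i • coneGen u i) r := by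
  have h : ∀ t : Finset (Fin (N + 1)),
      ∏ i ∈ t, (AddMonoidAlgebra.single (coneGen u i) (1 : k)) ^ s i =
        AddMonoidAlgebra.single (∑ i ∈ t, s i • coneGen u i) 1 := by
    intro t
    induction t using Finset.induction_on with
    | empty => simp [AddMonoidAlgebra.one_def]
    | insert a t ha ih =>
      rw [Finset.prod_insert ha, Finset.sum_insert ha, ih, AddMonoidAlgebra.single_pow,
        AddMonoidAlgebra.single_mul_single, one_pow, one_mul]
  rw [coneHom, MvPolynomial.aeval_monomial, Finsupp.prod_fintype _ _ (by simp), h,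
    AddMonoidAlgebra.coe_algebraMap, Function.comp_apply, AddMonoidAlgebra.single_mul_single]
  simp

/-- The point of the affine cone over `X_A` given by a point of the torus of `M × ℤ`. -/
def conePoint (T : TorusPoint k (M × ℤ)) : Fin (N + 1) → k := fun i => character (coneGen u i) T

theorem conePoint_apply_ne_zero (T : TorusPoint k (M × ℤ)) (i : Fin (N + 1)) :
    conePoint u T i ≠ 0 := character_ne_zero _ T

theorem conePoint_ne_zero (T : TorusPoint k (M × ℤ)) : conePoint u T ≠ 0 :=
  fun h => conePoint_apply_ne_zero u T 0 (congrFun h 0)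

theorem eval_conePoint (T : TorusPoint k (M × ℤ)) (F : MvPolynomial (Fin (N + 1)) k) :
    MvPolynomial.eval (conePoint u T) F = T (coneHom u k F) := by
  have : (T.comp (coneHom u k)) = MvPolynomial.aeval (conePoint u T) := by
    apply MvPolynomial.algHom_ext
    intro i
    simp [coneHom, conePoint, character]
  rw [← AlgHom.comp_apply, this, MvPolynomial.aeval_eq_eval]

/-- The restriction of a point of the torus of `M × ℤ` to `M`. -/
def basePoint (T : TorusPoint k (M × ℤ)) : TorusPoint k M :=
  pointOfHom ((charHom T).comp (AddMonoidHom.inl M ℤ))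

@[simp]
theorem character_basePoint (T : TorusPoint k (M × ℤ)) (m : M) :
    character m (basePoint T) = character (m, 0) T := by
  rw [basePoint, character_pointOfHom]
  rfl

theorem conePoint_eq_smul (T : TorusPoint k (M × ℤ)) :
    conePoint u T = character ((0, 1) : M × ℤ) T • fun i => character (u i) (basePoint T) := by
  funext i
  rw [Pi.smul_apply, smul_eq_mul, character_basePoint, ← character_add]
  simp [conePoint, coneGen]

theorem mk_conePoint (T : TorusPoint k (M × ℤ)) :
    Projectivization.mk k (conePoint u T) (conePoint_ne_zero u T) =
      torusMap u (basePoint T) := by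
  rw [torusMap, Projectivization.mk_eq_mk_iff']
  exact ⟨_, (conePoint_eq_smul u T).symm⟩

/-- The factor `ℤ` absorbs the scale of a homogeneous coordinate vector. In particular the
arbitrarily chosen `rep` of a torus point is itself a cone point. -/
theorem exists_basePoint_eq (t : TorusPoint k M) {c : k} (hc : c ≠ 0) :
    ∃ T : TorusPoint k (M × ℤ), basePoint T = t ∧
      conePoint u T = c • fun i => character (u i) t := by
  let T : TorusPoint k (M × ℤ) := pointOfHom (AddMonoidHom.coprod (charHom t)
    (zmultiplesHom _ (Additive.ofMul (Units.mk0 c hc))))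
  have hT : basePoint T = t := by
    apply torusPoint_ext
    intro m
    rw [character_basePoint, character_pointOfHom]
    simp [coe_charHom]
  refine ⟨T, hT, ?_⟩
  rw [conePoint_eq_smul, hT, character_pointOfHom]
  simp

theorem rep_torusMap (t : TorusPoint k M) : ∃ T : TorusPoint k (M × ℤ), basePoint T = t ∧
    (torusMap u t).rep = conePoint u T := by
  obtain ⟨a, ha⟩ := Projectivization.exists_smul_eq_mk_rep k (fun i => character (u i) t)
    (fun h => character_ne_zero (u 0) t (congrFun h 0))
  obtain ⟨T, hT, h⟩ := exists_basePoint_eq u t a.ne_zero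
  exact ⟨T, hT, by rw [torusMap, ← ha, h]; rfl⟩

theorem torusMap_injective {N : ℕ} {u : Fin (N + 1) → M} (hA : affineSpan ℤ (Set.range u) = ⊤) :
    Function.Injective (torusMap (k := k) u) := by
  intro t t' h
  obtain ⟨T, hT, h1⟩ := rep_torusMap u t
  obtain ⟨T', hT', h1'⟩ := rep_torusMap u t'
  have hc : ∀ i, charHom T (coneGen u i) = charHom T' (coneGen u i) := by
    intro i
    rw [charHom_eq_iff]
    have : conePoint u T = conePoint u T' := by rw [← h1, ← h1', h]
    exact congrFun this i
  have := ext_on_coneGen hA hc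
  apply torusPoint_ext
  intro m
  rw [← hT, ← hT', character_basePoint, character_basePoint, ← charHom_eq_iff, this]

theorem torusMap_mem (t : TorusPoint k M) : torusMap u t ∈ toricVariety k u :=
  subset_closure ⟨t, rfl⟩

section Ideal

variable [IsAlgClosed k] [Module.Free ℤ M] [Module.Finite ℤ M]

/-- The vectors that represent points of the open orbit are the cone points, and a Laurent
polynomial vanishing on a whole torus is zero. The extra factor `ℤ` accounts for scaling, so `F`
need not be homogeneous. -/
theorem mem_vanishingIdeal_toricVariety {F : MvPolynomial (Fin (N + 1)) k} :
    F ∈ vanishingIdeal (toricVariety k u) ↔ coneHom u k F = 0 := by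
  have : Infinite k := IsAlgClosed.instInfinite
  rw [toricVariety, vanishingIdeal_closure]
  constructor
  · intro h
    apply eq_zero_of_forall_torusPoint
    intro T
    rw [← eval_conePoint]
    exact h _ (conePoint_ne_zero u T) ⟨_, (mk_conePoint u T).symm⟩
  · rintro h v hv ⟨t, ht⟩
    obtain ⟨c, hc⟩ := (Projectivization.mk_eq_mk_iff' k _ _ _ _).mp ht.symm
    have hc0 : c ≠ 0 := by
      rintro rfl
      exact hv (by rw [← hc, zero_smul])
    obtain ⟨T, -, hT⟩ := exists_basePoint_eq u t hc0
    rw [← hc, ← hT, eval_conePoint, h, map_zero]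

/-- The binomial of a relation between the generators. -/
def binomial (k : Type*) [Field k] {N : ℕ} (a : Fin (N + 1) → ℤ) : MvPolynomial (Fin (N + 1)) k :=
  MvPolynomial.monomial (Finsupp.equivFunOnFinite.symm fun i => (a i).toNat) 1 -
    MvPolynomial.monomial (Finsupp.equivFunOnFinite.symm fun i => (-a i).toNat) 1

theorem binomial_mem {a : Fin (N + 1) → ℤ} (ha : ∑ i, a i • coneGen u i = 0) :
    binomial k a ∈ vanishingIdeal (toricVariety k u) := by
  rw [mem_vanishingIdeal_toricVariety, binomial, map_sub, coneHom_monomial, coneHom_monomial,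
    sub_eq_zero]
  congr 1
  rw [← sub_eq_zero, ← Finset.sum_sub_distrib, ← ha]
  refine Finset.sum_congr rfl fun i _ => ?_
  simp only [Finsupp.equivFunOnFinite_symm_apply_apply]
  rw [← natCast_zsmul, ← natCast_zsmul, ← sub_smul, Int.toNat_sub_toNat_neg]

/-- The points of the affine cone over `X_A` with nonzero coordinates are the points of the torus
of `M × ℤ`. -/
theorem exists_conePoint_eq {N : ℕ} {u : Fin (N + 1) → M}
    (hA : affineSpan ℤ (Set.range u) = ⊤) {v : Fin (N + 1) → k}
    (hv : v ≠ 0) (hX : Projectivization.mk k v hv ∈ toricVariety k u) (h0 : ∀ i, v i ≠ 0) :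
    ∃ T, v = conePoint u T := by
  -- The binomial of a relation between the `(u_i, 1)` vanishes at `v`. As all `v_i` are units, this
  -- says that they satisfy the same relation multiplicatively, so they extend to a character of `M
  -- × ℤ`.
  obtain ⟨φ, hφ⟩ := exists_hom_of_relations hA
    (fun i => Additive.ofMul (Units.mk0 (v i) (h0 i))) (by
      intro a ha
      have h1 := binomial_mem (k := k) u ha v hv hX
      rw [binomial, map_sub, sub_eq_zero, MvPolynomial.eval_monomial, MvPolynomial.eval_monomial,
        one_mul, one_mul, Finsupp.prod_fintype _ _ (by simp), Finsupp.prod_fintype _ _ (by simp)]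
        at h1
      simp only [Finsupp.equivFunOnFinite_symm_apply_apply] at h1
      apply Additive.toMul.injective
      rw [toMul_sum, toMul_zero]
      have h2 : ∏ i, (Units.mk0 (v i) (h0 i)) ^ (a i).toNat =
          ∏ i, (Units.mk0 (v i) (h0 i)) ^ (-a i).toNat := by
        apply Units.ext
        simpa [Units.coe_prod] using h1
      rw [← div_eq_one, ← Finset.prod_div_distrib] at h2
      rw [← h2]
      refine Finset.prod_congr rfl fun i _ => ?_
      rw [toMul_zsmul, toMul_ofMul, ← zpow_natCast, ← zpow_natCast,
        div_eq_mul_inv, ← zpow_sub,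
        Int.toNat_sub_toNat_neg])
  refine ⟨pointOfHom φ, ?_⟩
  funext i
  rw [conePoint, character_pointOfHom, hφ]
  rfl

end Ideal

end Cone

/-! ### Tangent spaces in logarithmic coordinates -/

section Tangent

variable {k : Type*} [Field k]

theorem polyDiff_add {ι : Type*} [Fintype ι] (F G : MvPolynomial ι k) (v : ι → k) :
    polyDiff (F + G) v = polyDiff F v + polyDiff G v := by
  simp [polyDiff, add_smul, Finset.sum_add_distrib]

theorem polyDiff_sub {ι : Type*} [Fintype ι] (F G : MvPolynomial ι k) (v : ι → k) :
    polyDiff (F - G) v = polyDiff F v - polyDiff G v := by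
  rw [eq_sub_iff_add_eq, ← polyDiff_add, sub_add_cancel]

/-- In the logarithmic direction `(v_i y_i)` differentiation multiplies a monomial by the linear
form of its exponents. No coordinate has to be inverted. -/
theorem polyDiff_monomial {ι : Type*} [Fintype ι] (s : ι →₀ ℕ) (r : k) (v y : ι → k) :
    polyDiff (MvPolynomial.monomial s r) v (fun i => v i * y i) =
      MvPolynomial.eval v (MvPolynomial.monomial s r) * ∑ i, (s i : k) * y i := by
  classical
  simp only [polyDiff, LinearMap.sum_apply, LinearMap.smul_apply, LinearMap.proj_apply,
    smul_eq_mul, Finset.mul_sum]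
  refine Finset.sum_congr rfl fun i _ => ?_
  rw [MvPolynomial.pderiv_monomial]
  -- Exponents are subtracted in `ℕ`, so lowering an exponent `0` is treated apart; there the
  -- coefficient vanishes.
  by_cases hs : s i = 0
  · simp [hs]
  · have h1 : MvPolynomial.monomial s r =
        MvPolynomial.monomial (s - Finsupp.single i 1) r * MvPolynomial.X i := by
      rw [MvPolynomial.X, MvPolynomial.monomial_mul, mul_one, tsub_add_cancel_of_le]
      rw [Finsupp.single_le_iff]
      omega
    have h2 := congrArg (MvPolynomial.eval v) h1
    rw [map_mul, MvPolynomial.eval_X] at h2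
    rw [h2, MvPolynomial.eval_monomial, MvPolynomial.eval_monomial]
    ring

variable {M : Type*} [AddCommGroup M] {N : ℕ} {u : Fin (N + 1) → M}
  [IsAlgClosed k] [Module.Free ℤ M] [Module.Finite ℤ M]

/-- The tangent space of the affine cone at a torus point consists of the vectors
`(z^(u_i, 1) φ(u_i, 1))_i`, for the additive maps `φ : M × ℤ → k`. -/
theorem mem_embeddedTangentSpace_iff (hA : affineSpan ℤ (Set.range u) = ⊤)
    {x : ℙ k (Fin (N + 1) → k)} {T : TorusPoint k (M × ℤ)} (hx : x.rep = conePoint u T)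
    {w : Fin (N + 1) → k} :
    w ∈ embeddedTangentSpace (toricVariety k u) x ↔
      ∃ φ : M × ℤ →+ k, w = fun i => conePoint u T i * φ (coneGen u i) := by
  simp only [embeddedTangentSpace, Submodule.mem_iInf, LinearMap.mem_ker, hx]
  constructor
  · intro hw
    -- Differentiating the binomial of a relation `a` shows that the logarithmic coordinates `w_i /
    -- z^(u_i, 1)` satisfy the same relation additively.
    obtain ⟨φ, hφ⟩ := exists_hom_of_relations hA (fun i => w i / conePoint u T i) (by
      intro a ha
      have h1 := hw _ (binomial_mem u ha)
      have hw' : w = fun i => conePoint u T i * (w i / conePoint u T i) := by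
        funext i
        rw [mul_div_cancel₀ _ (conePoint_apply_ne_zero u T i)]
      have h2 := binomial_mem (k := k) u ha _ (conePoint_ne_zero u T)
        (by rw [mk_conePoint]; exact torusMap_mem u _)
      rw [binomial, map_sub, sub_eq_zero] at h2
      have h3 : MvPolynomial.eval (conePoint u T) (MvPolynomial.monomial
          (Finsupp.equivFunOnFinite.symm fun i => (a i).toNat) 1) ≠ 0 := by
        rw [eval_conePoint, coneHom_monomial]
        exact character_ne_zero _ T
      rw [hw', binomial, polyDiff_sub, LinearMap.sub_apply, polyDiff_monomial, polyDiff_monomial,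
        ← h2, ← mul_sub, mul_eq_zero, or_iff_right h3, ← Finset.sum_sub_distrib] at h1
      rw [← h1]
      refine Finset.sum_congr rfl fun i _ => ?_
      simp only [Finsupp.equivFunOnFinite_symm_apply_apply]
      rw [← sub_mul, zsmul_eq_mul]
      congr 1
      conv_lhs => rw [← Int.toNat_sub_toNat_neg (a i)]
      push_cast
      rfl)
    refine ⟨φ, ?_⟩
    funext i
    rw [hφ, mul_div_cancel₀ _ (conePoint_apply_ne_zero u T i)]
  · rintro ⟨φ, rfl⟩ F hF
    rw [mem_vanishingIdeal_toricVariety] at hF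
    -- `D` is the derivation `z^g ↦ φ(g) z^g` followed by evaluation at `T`. The differential of `F`
    -- in this direction depends only on `coneHom F`, hence kills the ideal.
    let D : (M × ℤ →₀ k) →ₗ[k] k :=
      Finsupp.lsum k fun g => (φ g * character g T) • (LinearMap.id : k →ₗ[k] k)
    have key : ∀ F : MvPolynomial (Fin (N + 1)) k,
        polyDiff F (conePoint u T) (fun i => conePoint u T i * φ (coneGen u i)) =
          D (coneHom u k F).coeff := by
      intro F
      induction F using MvPolynomial.induction_on' with
      | monomial s r =>
        rw [polyDiff_monomial, eval_conePoint, coneHom_monomial, apply_single]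
        simp only [D, AddMonoidAlgebra.coeff_single, Finsupp.lsum_single, LinearMap.smul_apply,
          LinearMap.id_apply, smul_eq_mul, map_sum, map_nsmul, nsmul_eq_mul]
        ring
      | add p q hp hq =>
        rw [polyDiff_add, LinearMap.add_apply, hp, hq, map_add, AddMonoidAlgebra.coeff_add,
          map_add]
    rw [key, hF]
    simp

end Tangent

/-! ### The function field of `X_A` as the field of `k[M]` -/

section FunctionField

variable {k M : Type*} [Field k] [IsAlgClosed k] [AddCommGroup M] [Module.Free ℤ M]
  [Module.Finite ℤ M] {N : ℕ} (u : Fin (N + 1) → M)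

instance isDomain_prodAlgebra (k M : Type*) [Field k] [AddCommGroup M] [Module.Free ℤ M] :
    IsDomain (AddMonoidAlgebra k (M × ℤ)) :=
  isDomain_addMonoidAlgebra k (M × ℤ)

/-- The field of rational functions of the torus of `M × ℤ`. -/
abbrev ConeField (k M : Type*) [Field k] [AddCommGroup M] [Module.Free ℤ M] : Type _ :=
  FractionRing (AddMonoidAlgebra k (M × ℤ))

/-- The embedding of the group algebra in the field of rational functions. -/
abbrev coneEmb (k M : Type*) [Field k] [AddCommGroup M] [Module.Free ℤ M] :
    AddMonoidAlgebra k (M × ℤ) →+* ConeField k M :=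
  algebraMap _ _

/-- The homogeneous coordinate ring of `X_A` as a subring of the group algebra of `M × ℤ`. -/
def coordHom (k : Type*) [Field k] [IsAlgClosed k] :
    coordinateRing (toricVariety k u) →ₐ[k] AddMonoidAlgebra k (M × ℤ) :=
  Ideal.Quotient.liftₐ _ (coneHom u k) fun _ hF => (mem_vanishingIdeal_toricVariety u).mp hF

theorem coordHom_injective : Function.Injective (coordHom u k) := by
  rw [injective_iff_map_eq_zero]
  intro x hx
  obtain ⟨F, rfl⟩ := Ideal.Quotient.mk_surjective x
  exact Ideal.Quotient.eq_zero_iff_mem.mpr ((mem_vanishingIdeal_toricVariety u).mpr hx)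

/-- The homogeneous coordinate ring of `X_A` as a subring of the field of `M × ℤ`. -/
def coordEmb (k : Type*) [Field k] [IsAlgClosed k] :
    coordinateRing (toricVariety k u) →ₐ[k] ConeField k M :=
  (IsScalarTower.toAlgHom k (AddMonoidAlgebra k (M × ℤ)) (ConeField k M)).comp (coordHom u k)

theorem coordEmb_injective : Function.Injective (coordEmb u k) :=
  (IsFractionRing.injective (AddMonoidAlgebra k (M × ℤ)) (ConeField k M)).comp
    (coordHom_injective u)

/-- The induced embedding of fraction fields. -/
def fracHom (k : Type*) [Field k] [IsAlgClosed k] :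
    FractionRing (coordinateRing (toricVariety k u)) →ₐ[k] ConeField k M :=
  IsFractionRing.liftAlgHom (K := FractionRing (coordinateRing (toricVariety k u)))
    (coordEmb_injective u)

theorem fracHom_toFrac (F : MvPolynomial (Fin (N + 1)) k) :
    fracHom u k (toFrac (toricVariety k u) F) = coneEmb k M (coneHom u k F) := by
  rw [fracHom, toFrac, IsFractionRing.liftAlgHom_apply]
  exact IsFractionRing.lift_algebraMap (coordEmb_injective u) _

/-- The sublattice `M × 0`. -/
abbrev baseLattice (H : AddSubgroup M) : AddSubgroup (M × ℤ) := H.map (AddMonoidHom.inl M ℤ)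

/-- All exponents of a form of degree `d` have last coordinate `d`, so division by `z^(0, d)` moves
them into `M × 0`. -/
theorem coneEmb_coneHom_div_mem {F : MvPolynomial (Fin (N + 1)) k} {d : ℕ}
    (hF : F.IsHomogeneous d) :
    coneEmb k M (coneHom u k F) / chi (coneEmb k M) (0, (d : ℤ)) ∈
      latticeField (coneEmb k M) (baseLattice ⊤) := by
  rw [F.as_sum, map_sum, map_sum, Finset.sum_div]
  refine sum_mem fun s hs => ?_
  have hd : ∑ i, s i = d := by
    rw [hF.degree_eq_sum_deg_support hs]
    exact (Finset.sum_subset (Finset.subset_univ _)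
      fun i _ hi => Finsupp.notMem_support_iff.mp hi).symm
  have hg : ∑ i, s i • coneGen u i = (∑ i, s i • u i, 0) + (0, (d : ℤ)) := by
    apply Prod.ext
    · rw [Prod.fst_sum]
      simp [coneGen]
    · rw [Prod.snd_sum, ← hd]
      simp [coneGen]
  rw [coneHom_monomial, hg, single_eq_mul_chi, chi_add, ← mul_assoc,
    mul_div_cancel_right₀ _ (chi_ne_zero _ _), ← single_eq_mul_chi]
  exact single_mem_latticeField _ (AddSubgroup.mem_map_of_mem _ (AddSubgroup.mem_top _)) _

variable {u}

/-- Every character of `M` is a quotient of two monomials of the same degree. -/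
theorem exists_monomials (hA : affineSpan ℤ (Set.range u) = ⊤) (m : M) :
    ∃ (d : ℕ) (s s' : Fin (N + 1) →₀ ℕ), s.degree = d ∧ s'.degree = d ∧
      ∑ i, s i • coneGen u i = (m, 0) + ∑ i, s' i • coneGen u i := by
  obtain ⟨a, ha⟩ := exists_sum_coneGen u hA (m, 0)
  let s : Fin (N + 1) →₀ ℕ := Finsupp.equivFunOnFinite.symm fun i => (a i).toNat
  let s' : Fin (N + 1) →₀ ℕ := Finsupp.equivFunOnFinite.symm fun i => (-a i).toNat
  have h : ∑ i, s i • coneGen u i = (m, 0) + ∑ i, s' i • coneGen u i := by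
    rw [← ha, ← Finset.sum_add_distrib]
    refine Finset.sum_congr rfl fun i _ => ?_
    rw [← natCast_zsmul, ← natCast_zsmul, ← add_smul]
    congr 1
    simp only [s, s', Finsupp.equivFunOnFinite_symm_apply_apply]
    omega
  refine ⟨s.degree, s, s', rfl, ?_, h⟩
  -- The last coordinate of `(m, 0)` is zero, which forces the positive and negative parts to have
  -- the same degree.
  have h2 := congrArg Prod.snd h
  rw [Prod.snd_add, Prod.snd_sum, Prod.snd_sum] at h2
  simp only [coneGen, Prod.smul_snd, nsmul_eq_mul, mul_one, zero_add] at h2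
  rw [Finsupp.degree_eq_sum, Finsupp.degree_eq_sum]
  exact_mod_cast h2.symm

theorem chi_eq_fracHom {m : M} {s s' : Fin (N + 1) →₀ ℕ}
    (h : ∑ i, s i • coneGen u i = (m, 0) + ∑ i, s' i • coneGen u i) :
    chi (coneEmb k M) (m, 0) = fracHom u k (toFrac (toricVariety k u) (MvPolynomial.monomial s 1) /
      toFrac (toricVariety k u) (MvPolynomial.monomial s' 1)) := by
  rw [map_div₀, fracHom_toFrac, fracHom_toFrac, coneHom_monomial, coneHom_monomial, h]
  change _ = chi (coneEmb k M) _ / chi (coneEmb k M) _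
  rw [chi_add, mul_div_cancel_right₀ _ (chi_ne_zero _ _)]

theorem monomial_notMem (s : Fin (N + 1) →₀ ℕ) {r : k} (hr : r ≠ 0) :
    MvPolynomial.monomial s r ∉ vanishingIdeal (toricVariety k u) := by
  rw [mem_vanishingIdeal_toricVariety, coneHom_monomial]
  simpa using hr

theorem fracHom_mem {z : FractionRing (coordinateRing (toricVariety k u))}
    (hz : z ∈ functionField (toricVariety k u)) :
    fracHom u k z ∈ latticeField (coneEmb k M) (baseLattice ⊤) := by
  induction hz using IntermediateField.adjoin_induction with
  | mem z hz =>
    obtain ⟨d, F, G, hF, hG, -, rfl⟩ := hz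
    rw [map_div₀, fracHom_toFrac, fracHom_toFrac,
      ← div_div_div_cancel_right₀ (chi_ne_zero (coneEmb k M) (0, (d : ℤ)))]
    exact div_mem (coneEmb_coneHom_div_mem u hF) (coneEmb_coneHom_div_mem u hG)
  | algebraMap c =>
    rw [AlgHom.commutes]
    exact single_mem_latticeField (coneEmb k M) (zero_mem _) c
  | add x y _ _ hx hy => rw [map_add]; exact add_mem hx hy
  | inv x _ hx => rw [map_inv₀]; exact inv_mem hx
  | mul x y _ _ hx hy => rw [map_mul]; exact mul_mem hx hy

/-- The embedding of the function field of `X_A` in the function field of the torus of `M × ℤ`. -/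
def ffHom (u : Fin (N + 1) → M) (k : Type*) [Field k] [IsAlgClosed k] :
    functionField (toricVariety k u) →ₐ[k] ConeField k M :=
  (fracHom u k).comp (functionField (toricVariety k u)).val

theorem chi_mem_range_ffHom (hA : affineSpan ℤ (Set.range u) = ⊤) (m : M) :
    ∃ z, ffHom u k z = chi (coneEmb k M) (m, 0) := by
  obtain ⟨d, s, s', hs, hs', h⟩ := exists_monomials hA m
  refine ⟨⟨_, IntermediateField.subset_adjoin _ _ ⟨d, MvPolynomial.monomial s 1,
    MvPolynomial.monomial s' 1, MvPolynomial.isHomogeneous_monomial _ hs,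
    MvPolynomial.isHomogeneous_monomial _ hs', monomial_notMem s' one_ne_zero, rfl⟩⟩, ?_⟩
  exact (chi_eq_fracHom h).symm

/-- The embedding of `k[M]` in the function field of the torus of `M × ℤ`. -/
def baseHom (k M : Type*) [Field k] [AddCommGroup M] [Module.Free ℤ M] :
    AddMonoidAlgebra k M →ₐ[k] ConeField k M :=
  (IsScalarTower.toAlgHom k (AddMonoidAlgebra k (M × ℤ)) (ConeField k M)).comp
    (AddMonoidAlgebra.mapDomainAlgHom k k (AddMonoidHom.inl M ℤ))

theorem baseHom_single (m : M) (c : k) :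
    baseHom k M (AddMonoidAlgebra.single m c) =
      coneEmb k M (AddMonoidAlgebra.single (m, 0) c) := by
  simp [baseHom]

theorem baseHom_mem (hA : affineSpan ℤ (Set.range u) = ⊤) (a : AddMonoidAlgebra k M) :
    baseHom k M a ∈ (ffHom u k).range := by
  induction a using AddMonoidAlgebra.induction_linear with
  | zero => rw [map_zero]; exact zero_mem _
  | add f g hf hg => rw [map_add]; exact add_mem hf hg
  | single m c =>
    obtain ⟨z, hz⟩ := chi_mem_range_ffHom (k := k) hA m
    refine ⟨c • z, ?_⟩
    change ffHom u k (c • z) = _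
    rw [map_smul, hz, baseHom_single, chi, Algebra.smul_def,
      IsScalarTower.algebraMap_apply k (AddMonoidAlgebra k (M × ℤ)), ← map_mul]
    congr 1
    simp [AddMonoidAlgebra.single_mul_single]

/-- The embedding of `k[M]` in the function field of `X_A`. -/
def toFunctionField (hA : affineSpan ℤ (Set.range u) = ⊤) (k : Type*) [Field k] [IsAlgClosed k] :
    AddMonoidAlgebra k M →ₐ[k] functionField (toricVariety k u) :=
  (AlgEquiv.ofInjectiveField (ffHom u k)).symm.toAlgHom.comp
    ((baseHom k M).codRestrict _ (baseHom_mem hA))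

theorem ffHom_toFunctionField (hA : affineSpan ℤ (Set.range u) = ⊤) (a : AddMonoidAlgebra k M) :
    ffHom u k (toFunctionField hA k a) = baseHom k M a :=
  congrArg Subtype.val ((AlgEquiv.ofInjectiveField (ffHom u k)).apply_symm_apply
    ((baseHom k M).codRestrict _ (baseHom_mem hA) a))

theorem toFunctionField_injective (hA : affineSpan ℤ (Set.range u) = ⊤) :
    Function.Injective (toFunctionField hA k) := by
  intro a b h
  have h1 : baseHom k M a = baseHom k M b := by
    rw [← ffHom_toFunctionField hA, ← ffHom_toFunctionField hA, h]
  exact AddMonoidAlgebra.mapDomain_injective (fun m m' hm => congrArg Prod.fst hm)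
    (IsFractionRing.injective (AddMonoidAlgebra k (M × ℤ)) (ConeField k M) h1)

/-- Moves questions about `K(X_A)`, whose elements come from fractions of forms, to the field of `M
× ℤ`, where forms become explicit Laurent polynomials. -/
theorem mem_latticeField_toFunctionField (hA : affineSpan ℤ (Set.range u) = ⊤)
    {H : AddSubgroup M} {z : functionField (toricVariety k u)} :
    z ∈ latticeField (toFunctionField hA k).toRingHom H ↔
      ffHom u k z ∈ latticeField (coneEmb k M) (baseLattice H) := by
  have hs : ∀ m c, ffHom u k ((toFunctionField hA k).toRingHom (AddMonoidAlgebra.single m c)) =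
      coneEmb k M (AddMonoidAlgebra.single (m, 0) c) := by
    intro m c
    rw [← baseHom_single, ← ffHom_toFunctionField hA]
    rfl
  constructor
  · have : latticeField (toFunctionField hA k).toRingHom H ≤
        (latticeField (coneEmb k M) (baseLattice H)).comap (ffHom u k).toRingHom := by
      apply latticeField_le
      · intro c
        change ffHom u k _ ∈ latticeField (coneEmb k M) (baseLattice H)
        rw [hs]
        exact single_mem_latticeField _ (zero_mem _) c
      · intro m hm
        change ffHom u k _ ∈ latticeField (coneEmb k M) (baseLattice H)
        rw [chi, hs]
        exact chi_mem_latticeField _ ⟨m, hm, rfl⟩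
    exact fun h => this h
  · have : latticeField (coneEmb k M) (baseLattice H) ≤
        (latticeField (toFunctionField hA k).toRingHom H).map (ffHom u k).toRingHom := by
      apply latticeField_le
      · exact fun c => ⟨_, single_mem_latticeField _ (zero_mem H) c, hs 0 c⟩
      · rintro _ ⟨m, hm, rfl⟩
        exact ⟨_, chi_mem_latticeField _ hm, hs m 1⟩
    intro h
    obtain ⟨z', hz', h'⟩ := this h
    rwa [← (ffHom u k).injective h']

theorem latticeField_toFunctionField_top (hA : affineSpan ℤ (Set.range u) = ⊤) :
    latticeField (toFunctionField hA k).toRingHom ⊤ = ⊤ := by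
  rw [eq_top_iff]
  intro z _
  rw [mem_latticeField_toFunctionField]
  exact fracHom_mem z.2

theorem dim_toricVariety (hA : affineSpan ℤ (Set.range u) = ⊤) :
    dim (toricVariety k u) = Module.finrank ℤ M :=
  trdeg_of_chi (toFunctionField hA k) (toFunctionField_injective hA)
    (latticeField_toFunctionField_top hA)

end FunctionField

/-! ### Independence of the Plücker point from the basis -/

section Pluecker

/-- The Plücker coordinates can be computed from any basis of the subspace. -/
theorem pluecker_eq_mk {k ι : Type*} [Field k] [Fintype ι] [LinearOrder ι] {m : ℕ} (E : Gr k ι m)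
    (b : Fin m → ι → k) (hb : LinearIndependent k b)
    (hE : Submodule.span k (Set.range b) = E.1) :
    pluecker E = Projectivization.mk k
      (fun c : Fin m ↪o ι => Matrix.det (Matrix.of fun r s => b r (c s)))
      (exists_minor_ne_zero b hb) := by
  rw [pluecker, Projectivization.mk_eq_mk_iff']
  set e := Module.finBasisOfFinrankEq k E.1 E.2
  let b' := Module.Basis.span hb
  have hmem : ∀ r, (e r : ι → k) ∈ Submodule.span k (Set.range b) := fun r => by
    rw [hE]; exact (e r).2
  -- `P` is the change of basis; its determinant multiplies all maximal minors simultaneously.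
  let P : Matrix (Fin m) (Fin m) k := Matrix.of fun r s => b'.repr ⟨e r, hmem r⟩ s
  refine ⟨P.det, ?_⟩
  funext c
  rw [Pi.smul_apply, smul_eq_mul, ← Matrix.det_mul]
  congr 1
  ext r s
  have h := congrArg (fun x : Submodule.span k (Set.range b) => (x : ι → k) (c s))
    (b'.sum_repr ⟨e r, hmem r⟩)
  simp only [AddSubmonoidClass.coe_finsetSum, Finset.sum_apply, Submodule.coe_smul,
    Pi.smul_apply, smul_eq_mul] at h
  rw [Matrix.mul_apply, Matrix.of_apply, ← h]
  refine Finset.sum_congr rfl fun i _ => ?_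
  simp only [P, Matrix.of_apply, b', Module.Basis.span_apply]

end Pluecker

/-! ### Minors of the matrix of the `(u_i, 1)` and the set `B` -/

section Minors

variable {k M : Type*} [Field k] [AddCommGroup M] {N : ℕ} (u : Fin (N + 1) → M)
  {m : ℕ} (β : Module.Basis (Fin m) ℤ (M × ℤ))

/-- The minor of the matrix of the vectors `(u_i, 1)` over `k`, for the columns `c`. -/
def minor (k : Type*) [Field k] (c : Fin m → Fin (N + 1)) : k :=
  Matrix.det (Matrix.of fun r s => ((β.repr (coneGen u (c s)) r : ℤ) : k))

/-- The additive map `M × ℤ → k` with given values at a basis. -/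
def homOfCoords (y : Fin m → k) : M × ℤ →+ k :=
  (β.constr ℤ y).toAddMonoidHom

theorem homOfCoords_apply (y : Fin m → k) (x : M × ℤ) :
    homOfCoords β y x = ∑ r, y r * ((β.repr x r : ℤ) : k) := by
  change β.constr ℤ y x = _
  rw [Module.Basis.constr_apply_fintype]
  refine Finset.sum_congr rfl fun r _ => ?_
  rw [Module.Basis.equivFun_apply, zsmul_eq_mul, mul_comm]

theorem homOfCoords_basis (φ : M × ℤ →+ k) : homOfCoords β (fun r => φ (β r)) = φ := by
  have : β.constr ℤ (fun r => φ (β r)) = φ.toIntLinearMap :=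
    β.ext fun r => by simp
  ext1 x
  exact congrArg (fun f => f x) this

theorem homOfCoords_apply_basis (y : Fin m → k) (r : Fin m) : homOfCoords β y (β r) = y r := by
  change β.constr ℤ y (β r) = _
  simp

/-- A vector in the left kernel of the matrix is the coordinate vector of an additive map `M × ℤ →
k` that vanishes at the chosen generators. -/
theorem minor_ne_zero_iff {c : Fin m → Fin (N + 1)} :
    minor u β k c ≠ 0 ↔ ∀ φ : M × ℤ →+ k, (∀ s, φ (coneGen u (c s)) = 0) → φ = 0 := by
  rw [minor, Ne, ← Matrix.exists_vecMul_eq_zero_iff]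
  have hv : ∀ y : Fin m → k, Matrix.vecMul y
      (Matrix.of fun r s => ((β.repr (coneGen u (c s)) r : ℤ) : k)) =
        fun s => homOfCoords β y (coneGen u (c s)) := by
    intro y
    funext s
    rw [homOfCoords_apply]
    rfl
  constructor
  · intro h φ hφ
    by_contra hne
    refine h ⟨fun r => φ (β r), ?_, ?_⟩
    · intro h0
      apply hne
      rw [← homOfCoords_basis β φ, h0]
      ext1 x
      rw [homOfCoords_apply]
      simp
    · rw [hv, homOfCoords_basis]
      exact funext hφ
  · rintro h ⟨y, hy, h0⟩
    rw [hv] at h0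
    have := h _ (congrFun h0)
    apply hy
    funext r
    rw [← homOfCoords_apply_basis β y, this]
    rfl

/-- Additive maps `φ : M × ℤ → k` are the affine functions on `M_k`, with value `φ(m, 1)` at `m`.
Points span the affine space iff no nonzero affine function vanishes at all of them. -/
theorem affineSpan_eq_top_iff_forall {J : Type*} [Nonempty J] (i : J → Fin (N + 1)) :
    affineSpan k (Set.range fun j => toModule k (u (i j))) = ⊤ ↔
      ∀ φ : M × ℤ →+ k, (∀ j, φ (coneGen u (i j)) = 0) → φ = 0 := by
  have hne : (Set.range fun j => toModule k (u (i j))).Nonempty := Set.range_nonempty _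
  constructor
  · intro h φ hφ
    have hsplit : ∀ x : M × ℤ, φ x = φ (x.1, 0) + (x.2 : k) * φ (0, 1) := by
      intro x
      have h1 : x = (x.1, 0) + x.2 • (0, 1) := by
        apply Prod.ext <;> simp
      conv_lhs => rw [h1]
      rw [map_add, map_zsmul, zsmul_eq_mul]
    let ψ : M →+ k := φ.comp (AddMonoidHom.inl M ℤ)
    have hψ : ∀ j, ψ (u (i j)) = - φ (0, 1) := by
      intro j
      have := hφ j
      rw [hsplit] at this
      simp only [coneGen, Int.cast_one, one_mul] at this
      exact eq_neg_of_add_eq_zero_left this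
    have hle : vectorSpan k (Set.range fun j => toModule k (u (i j))) ≤
        LinearMap.ker (functional ψ) := by
      rw [vectorSpan_def, Submodule.span_le]
      rintro _ ⟨_, ⟨j, rfl⟩, _, ⟨j', rfl⟩, rfl⟩
      change functional ψ (toModule k (u (i j)) - toModule k (u (i j'))) = 0
      rw [map_sub, functional_toModule, functional_toModule, hψ, hψ, sub_self]
    rw [AffineSubspace.vectorSpan_eq_top_of_affineSpan_eq_top k _ _ h] at hle
    have hψ0 : ∀ x, ψ x = 0 := by
      intro x
      rw [← functional_toModule ψ]
      exact hle trivial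
    have h1 : φ (0, 1) = 0 := by
      obtain ⟨j⟩ := ‹Nonempty J›
      have := hψ j
      rw [hψ0] at this
      exact neg_eq_zero.mp this.symm
    ext1 x
    rw [hsplit, h1, mul_zero, add_zero]
    exact hψ0 x.1
  · intro h
    rw [AffineSubspace.affineSpan_eq_top_iff_vectorSpan_eq_top_of_nonempty k _ _ hne]
    by_contra hV
    obtain ⟨Φ, hΦ, hle⟩ := Submodule.exists_le_ker_of_lt_top _ (lt_top_iff_ne_top.mpr hV)
    obtain ⟨j₀⟩ := ‹Nonempty J›
    -- The affine function is `Φ` minus its value at one of the points; it vanishes at all of them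
    -- because `Φ` kills their differences.
    let a : k := Φ (toModule k (u (i j₀)))
    let φ : M × ℤ →+ k := AddMonoidHom.coprod (restrictFunctional Φ) (zmultiplesHom _ (-a))
    have hφ : φ = 0 := by
      apply h
      intro j
      have h1 : Φ (toModule k (u (i j)) - toModule k (u (i j₀))) = 0 :=
        hle (vsub_mem_vectorSpan k ⟨j, rfl⟩ ⟨j₀, rfl⟩)
      rw [map_sub] at h1
      simp only [φ, coneGen, AddMonoidHom.coprod_apply, zmultiplesHom_apply, one_smul]
      change Φ (toModule k (u (i j))) + -a = 0
      rw [← sub_eq_add_neg]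
      exact h1
    apply hΦ
    rw [← functional_restrictFunctional Φ]
    have : restrictFunctional Φ = 0 := by
      ext1 x
      have := congrArg (fun f => f (x, 0)) hφ
      simpa [φ] using this
    rw [this]
    apply LinearMap.ext_on_range (span_range_toModule k)
    intro m
    rw [functional_toModule]
    rfl

theorem minor_eq_zero_of_not_injective {c : Fin m → Fin (N + 1)} (hc : ¬ Function.Injective c) :
    minor u β k c = 0 := by
  simp only [Function.Injective, not_forall] at hc
  obtain ⟨s, s', h, hne⟩ := hc
  exact Matrix.det_zero_of_column_eq hne fun r => by simp [h]

/-- `B` is defined by arbitrary tuples, Plücker coordinates by increasing ones. A tuple with nonzero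
minor is injective and can be sorted, because the criterion for a nonzero minor depends only on the
set of columns. -/
theorem mem_setB_iff (hm : m = Module.finrank ℤ M + 1) {b : M} :
    b ∈ setB k u ↔ ∃ c : Fin m ↪o Fin (N + 1), minor u β k c ≠ 0 ∧ b = ∑ s, u (c s) := by
  classical
  subst hm
  constructor
  · rintro ⟨i, hi, rfl⟩
    rw [affineSpan_eq_top_iff_forall, ← minor_ne_zero_iff u β] at hi
    have hinj : Function.Injective i := by
      by_contra h
      exact hi (minor_eq_zero_of_not_injective u β h)
    let S := Finset.univ.image i
    have hS : S.card = Module.finrank ℤ M + 1 := by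
      rw [Finset.card_image_of_injective _ hinj, Finset.card_univ, Fintype.card_fin]
    refine ⟨S.orderEmbOfFin hS, ?_, ?_⟩
    · rw [minor_ne_zero_iff] at hi ⊢
      intro φ hφ
      apply hi
      intro s
      have hmem : i s ∈ Set.range (S.orderEmbOfFin hS) := by
        rw [Finset.range_orderEmbOfFin]
        exact Finset.mem_coe.mpr (Finset.mem_image_of_mem i (Finset.mem_univ s))
      obtain ⟨s', hs'⟩ := hmem
      rw [← hs']
      exact hφ s'
    · rw [← Finset.sum_image (s := Finset.univ) (f := u) (fun a _ b _ h => hinj h),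
        ← Finset.sum_image (s := Finset.univ) (g := S.orderEmbOfFin hS) (f := u)
          (fun a _ b _ h => (S.orderEmbOfFin hS).injective h)]
      congr 1
      rw [Finset.image_orderEmbOfFin_univ]
  · rintro ⟨c, hc, rfl⟩
    refine ⟨c, ?_, rfl⟩
    rwa [affineSpan_eq_top_iff_forall, ← minor_ne_zero_iff u β]

/-- The linear embedding of the space of `X_B` in the space of Plücker coordinates. -/
def plueckerEmbedding (hm : m = Module.finrank ℤ M + 1) :
    (setB k u → k) →ₗ[k] ((Fin m ↪o Fin (N + 1)) → k) :=
  open Classical in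
  -- Several `c` may have the same sum `b`; the coordinate of `b` is copied to each of them, scaled
  -- by its minor.
  LinearMap.pi fun c => if h : minor u β k c ≠ 0 then
    minor u β k c • LinearMap.proj ⟨_, (mem_setB_iff u β hm).mpr ⟨c, h, rfl⟩⟩ else 0

theorem plueckerEmbedding_injective (hm : m = Module.finrank ℤ M + 1) :
    Function.Injective (plueckerEmbedding (k := k) u β hm) := by
  rw [injective_iff_map_eq_zero]
  intro w hw
  funext ⟨b, hb⟩
  obtain ⟨c, hc, rfl⟩ := (mem_setB_iff u β hm).mp hb
  have := congrFun hw c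
  simp only [plueckerEmbedding, LinearMap.pi_apply, dif_pos hc, LinearMap.smul_apply,
    LinearMap.proj_apply, smul_eq_mul, Pi.zero_apply, mul_eq_zero, or_iff_right hc] at this
  exact this

theorem plueckerEmbedding_apply (hm : m = Module.finrank ℤ M + 1) {f : M → k}
    {w : setB k u → k} (hw : ∀ b, w b = f b) (c : Fin m ↪o Fin (N + 1)) :
    plueckerEmbedding u β hm w c = minor u β k c * f (∑ s, u (c s)) := by
  by_cases h : minor u β k c ≠ 0
  · simp only [plueckerEmbedding, LinearMap.pi_apply, dif_pos h, LinearMap.smul_apply,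
      LinearMap.proj_apply, smul_eq_mul, hw]
  · rw [not_not] at h
    simp [plueckerEmbedding, h]

end Minors

/-! ### The Gauss map on the torus in Plücker coordinates -/

section Gauss

variable {k M : Type*} [Field k] [IsAlgClosed k] [AddCommGroup M] [Module.Free ℤ M]
  [Module.Finite ℤ M] {N : ℕ} {u : Fin (N + 1) → M} {m : ℕ} (β : Module.Basis (Fin m) ℤ (M × ℤ))

variable (u) in
/-- The rows of the matrix that spans the tangent space. -/
def tangentRow (T : TorusPoint k (M × ℤ)) (r : Fin m) (i : Fin (N + 1)) : k :=
  conePoint u T i * ((β.repr (coneGen u i) r : ℤ) : k)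

theorem sum_smul_tangentRow (T : TorusPoint k (M × ℤ)) (y : Fin m → k) :
    ∑ r, y r • tangentRow u β T r = fun i => conePoint u T i * homOfCoords β y (coneGen u i) := by
  funext i
  rw [homOfCoords_apply, Finset.sum_apply, Finset.mul_sum]
  refine Finset.sum_congr rfl fun r _ => ?_
  simp only [tangentRow, Pi.smul_apply, smul_eq_mul]
  ring

theorem linearIndependent_tangentRow (hA : affineSpan ℤ (Set.range u) = ⊤)
    (T : TorusPoint k (M × ℤ)) : LinearIndependent k (tangentRow u β T) := by
  rw [Fintype.linearIndependent_iff]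
  intro y hy r
  rw [sum_smul_tangentRow] at hy
  have : homOfCoords β y = 0 := by
    apply ext_on_coneGen hA
    intro i
    have := congrFun hy i
    rw [Pi.zero_apply, mul_eq_zero, or_iff_right (conePoint_apply_ne_zero u T i)] at this
    exact this
  rw [← homOfCoords_apply_basis β y, this]
  rfl

theorem span_tangentRow (hA : affineSpan ℤ (Set.range u) = ⊤) {x : ℙ k (Fin (N + 1) → k)}
    {T : TorusPoint k (M × ℤ)} (hx : x.rep = conePoint u T) :
    Submodule.span k (Set.range (tangentRow u β T)) =
      embeddedTangentSpace (toricVariety k u) x := by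
  ext w
  rw [mem_embeddedTangentSpace_iff hA hx, Submodule.mem_span_range_iff_exists_fun]
  constructor
  · rintro ⟨y, rfl⟩
    exact ⟨_, sum_smul_tangentRow β T y⟩
  · rintro ⟨φ, rfl⟩
    refine ⟨fun r => φ (β r), ?_⟩
    rw [sum_smul_tangentRow, homOfCoords_basis]

theorem finrank_prod_int : Module.finrank ℤ (M × ℤ) = Module.finrank ℤ M + 1 := by
  rw [Module.finrank_prod, Module.finrank_self]

theorem mem_smoothLocus (hA : affineSpan ℤ (Set.range u) = ⊤) (t : TorusPoint k M) :
    torusMap u t ∈ smoothLocus (toricVariety k u) := by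
  refine ⟨torusMap_mem u t, ?_⟩
  obtain ⟨T, -, hT⟩ := rep_torusMap u t
  rw [dim_toricVariety hA, ← finrank_prod_int,
    ← span_tangentRow (Module.finBasis ℤ (M × ℤ)) hA hT,
    finrank_span_eq_card (linearIndependent_tangentRow _ hA T), Fintype.card_fin]

variable (u) in
/-- The Plücker coordinates of the tangent space at a torus point. -/
def gaussVector (T : TorusPoint k (M × ℤ)) (c : Fin m ↪o Fin (N + 1)) : k :=
  minor u β k c * character (∑ s, coneGen u (c s)) T

/-- The column `i` of the integral matrix is scaled by `z^(u_i, 1)`, and the determinant is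
multiplicative in the columns. -/
theorem det_tangentRow (T : TorusPoint k (M × ℤ)) :
    (fun c : Fin m ↪o Fin (N + 1) =>
      Matrix.det (Matrix.of fun r s => tangentRow u β T r (c s))) = gaussVector u β T := by
  funext c
  rw [gaussVector, character_sum, mul_comm, minor]
  exact Matrix.det_mul_row (fun s => character (coneGen u (c s)) T)
    (Matrix.of fun r s => ((β.repr (coneGen u (c s)) r : ℤ) : k))

theorem gaussVector_ne_zero (hA : affineSpan ℤ (Set.range u) = ⊤) (T : TorusPoint k (M × ℤ)) :
    gaussVector u β T ≠ 0 := by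
  rw [← det_tangentRow]
  exact exists_minor_ne_zero _ (linearIndependent_tangentRow β hA T)

theorem gaussMap_eq (hA : affineSpan ℤ (Set.range u) = ⊤)
    (β : Module.Basis (Fin (dim (toricVariety k u) + 1)) ℤ (M × ℤ))
    {x : ℙ k (Fin (N + 1) → k)} (hx : x ∈ smoothLocus (toricVariety k u))
    {T : TorusPoint k (M × ℤ)} (hT : x.rep = conePoint u T) :
    gaussMap (toricVariety k u) ⟨x, hx⟩ =
      Projectivization.mk k (gaussVector u β T) (gaussVector_ne_zero β hA T) := by
  rw [gaussMap, pluecker_eq_mk _ (tangentRow u β T) (linearIndependent_tangentRow β hA T)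
    (span_tangentRow β hA hT)]
  congr 1
  exact det_tangentRow β T

theorem sum_coneGen_eq (c : Fin m → Fin (N + 1)) :
    ∑ s, coneGen u (c s) = (∑ s, u (c s), 0) + (0, (m : ℤ)) := by
  apply Prod.ext
  · rw [Prod.fst_sum]; simp [coneGen]
  · rw [Prod.snd_sum]; simp [coneGen]

/-- All monomials of the vector have last exponent `m`, so a common factor `z^(b, m)` removes the
`ℤ` part and leaves characters of `M`. -/
theorem gaussVector_eq_smul (T : TorusPoint k (M × ℤ)) (b : M) :
    gaussVector u β T = character (b, (m : ℤ)) T •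
      fun c : Fin m ↪o Fin (N + 1) =>
        minor u β k c * character (∑ s, u (c s) - b) (basePoint T) := by
  funext c
  rw [Pi.smul_apply, smul_eq_mul, gaussVector, mul_left_comm, character_basePoint,
    ← character_add, sum_coneGen_eq]
  congr 1
  apply congrArg fun g => character g T
  apply Prod.ext <;> simp

variable (u) in
/-- A basis of `M × ℤ` indexed by the rows of the Plücker coordinates. -/
def coneBasis (hA : affineSpan ℤ (Set.range u) = ⊤) :
    Module.Basis (Fin (dim (toricVariety k u) + 1)) ℤ (M × ℤ) :=
  Module.finBasisOfFinrankEq ℤ (M × ℤ) (by rw [finrank_prod_int, dim_toricVariety hA])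

/-- The decomposition of the Gauss map of a toric variety. -/
theorem exists_linear_embedding (hA : affineSpan ℤ (Set.range u) = ⊤)
    {L' : AddSubgroup M} (hL : diffLattice (setB k u) ≤ L') :
    ∃ J : (setB k u → k) →ₗ[k] ((Fin (dim (toricVariety k u) + 1) ↪o Fin (N + 1)) → k),
      Function.Injective J ∧ ∀ (b₀ : setB k u) (t : TorusPoint k M),
        ∃ (hx : torusMap u t ∈ smoothLocus (toricVariety k u))
          (h0 : J (orbitCoords (setB k u) b₀ ((t.comp (torusComorphismTop k L')).comp
            (torusComorphism k hL))) ≠ 0),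
          gaussMap (toricVariety k u) ⟨torusMap u t, hx⟩ = Projectivization.mk k _ h0 := by
  have hm : dim (toricVariety k u) + 1 = Module.finrank ℤ M + 1 := by rw [dim_toricVariety hA]
  let β := coneBasis (k := k) u hA
  refine ⟨plueckerEmbedding u β hm, plueckerEmbedding_injective u β hm, fun b₀ t => ?_⟩
  obtain ⟨T, rfl, hT⟩ := rep_torusMap u t
  have hw : ∀ b, orbitCoords (setB k u) b₀ (((basePoint T).comp (torusComorphismTop k L')).comp
      (torusComorphism k hL)) b = character ((b : M) - b₀) (basePoint T) := by
    intro b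
    simp [orbitCoords, character, torusComorphism, torusComorphismTop]
  have hJ : gaussVector u β T = character ((b₀ : M), ((dim (toricVariety k u) + 1 : ℕ) : ℤ)) T •
      plueckerEmbedding u β hm (orbitCoords (setB k u) b₀
        (((basePoint T).comp (torusComorphismTop k L')).comp (torusComorphism k hL))) := by
    rw [gaussVector_eq_smul β T b₀]
    congr 1
    funext c
    exact (plueckerEmbedding_apply u β hm
      (f := fun m => character (m - b₀) (basePoint T)) hw c).symm
  have hne := gaussVector_ne_zero β hA T
  refine ⟨mem_smoothLocus hA _, ?_, ?_⟩
  · intro h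
    rw [hJ, h, smul_zero] at hne
    exact hne rfl
  · rw [gaussMap_eq hA β _ hT, Projectivization.mk_eq_mk_iff']
    exact ⟨_, hJ.symm⟩

/-- The Plücker vector at the unit of the torus is nonzero, so some minor is. -/
theorem setB_nonempty (k : Type*) [Field k] [IsAlgClosed k]
    (hA : affineSpan ℤ (Set.range u) = ⊤) : (setB k u).Nonempty := by
  have hm : dim (toricVariety k u) + 1 = Module.finrank ℤ M + 1 := by rw [dim_toricVariety hA]
  let β := coneBasis (k := k) u hA
  obtain ⟨c, hc⟩ := Function.ne_iff.mp (gaussVector_ne_zero β hA (pointOfHom (k := k) 0))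
  exact ⟨_, (mem_setB_iff u β hm).mpr ⟨c, left_ne_zero_of_mul hc, rfl⟩⟩

end Gauss

/-! ### Directions of the affine spans of `B` in terms of `⟨B - B⟩` -/

section Directions

variable {M : Type*} [AddCommGroup M]

theorem vectorSpan_toModule_image (R : Type*) [CommRing R] (B : Set M) :
    vectorSpan R (toModule R '' B) =
      Submodule.span R (toModule R '' (diffLattice B : Set M)) := by
  apply le_antisymm
  · rw [vectorSpan_def, Submodule.span_le]
    rintro _ ⟨_, ⟨b, hb, rfl⟩, _, ⟨b', hb', rfl⟩, rfl⟩
    refine Submodule.subset_span ⟨b - b', sub_mem_diffLattice ⟨b, hb⟩ ⟨b', hb'⟩, ?_⟩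
    exact toModule_sub R b b'
  · rw [Submodule.span_le]
    rintro _ ⟨l, hl, rfl⟩
    induction hl using AddSubgroup.closure_induction with
    | mem x hx =>
      obtain ⟨b, hb, b', hb', rfl⟩ := hx
      rw [toModule_sub]
      exact vsub_mem_vectorSpan R ⟨b, hb, rfl⟩ ⟨b', hb', rfl⟩
    | zero => simp [toModule]
    | add x y _ _ hx hy => rw [toModule_add]; exact add_mem hx hy
    | neg x _ hx =>
      have : toModule R (-x) = - toModule R x := TensorProduct.tmul_neg _ _
      rw [this]
      exact neg_mem hx

theorem vectorSpan_int_eq (B : Set M) :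
    vectorSpan ℤ B = AddSubgroup.toIntSubmodule (diffLattice B) := by
  apply le_antisymm
  · rw [vectorSpan_def, Submodule.span_le]
    rintro _ ⟨b, hb, b', hb', rfl⟩
    exact sub_mem_diffLattice ⟨b, hb⟩ ⟨b', hb'⟩
  · intro l hl
    change l ∈ diffLattice B at hl
    induction hl using AddSubgroup.closure_induction with
    | mem x hx =>
      obtain ⟨b, hb, b', hb', rfl⟩ := hx
      exact vsub_mem_vectorSpan ℤ hb hb'
    | zero => exact zero_mem _
    | add x y _ _ hx hy => exact add_mem hx hy
    | neg x _ hx => exact neg_mem hx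

end Directions

/-! ### The open orbit as the locus of nonzero coordinates -/

section CoordinateTorus

/-- The open set of the points all of whose coordinates are nonzero. -/
def coordTorus (k : Type*) [Field k] (N : ℕ) : Set (ℙ k (Fin (N + 1) → k)) :=
  {x | ∀ i, x.rep i ≠ 0}

theorem isOpen_basic {k ι : Type*} [Field k] {F : MvPolynomial ι k} {d : ℕ}
    (hF : F.IsHomogeneous d) : IsOpen {x : ℙ k (ι → k) | MvPolynomial.eval x.rep F ≠ 0} :=
  TopologicalSpace.isOpen_generateFrom_of_mem ⟨d, F, hF, rfl⟩

theorem isOpen_coordTorus (k : Type*) [Field k] (N : ℕ) : IsOpen (coordTorus k N) := by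
  have h := isOpen_basic (MvPolynomial.IsHomogeneous.prod Finset.univ
    (fun i : Fin (N + 1) => (MvPolynomial.X i : MvPolynomial (Fin (N + 1)) k)) (fun _ => 1)
    fun i _ => MvPolynomial.isHomogeneous_X k i)
  convert h using 1
  ext x
  simp [coordTorus, Finset.prod_ne_zero_iff]

variable {k M : Type*} [Field k] [IsAlgClosed k] [AddCommGroup M] [Module.Free ℤ M]
  [Module.Finite ℤ M] {N : ℕ} {u : Fin (N + 1) → M}

theorem torusMap_mem_coordTorus (t : TorusPoint k M) : torusMap u t ∈ coordTorus k N := by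
  obtain ⟨T, -, hT⟩ := rep_torusMap u t
  intro i
  rw [hT]
  exact conePoint_apply_ne_zero u T i

theorem exists_rep_eq_conePoint (hA : affineSpan ℤ (Set.range u) = ⊤)
    {x : ℙ k (Fin (N + 1) → k)} (hx : x ∈ toricVariety k u ∩ coordTorus k N) :
    ∃ T, x.rep = conePoint u T ∧ x = torusMap u (basePoint T) := by
  obtain ⟨T, hT⟩ := exists_conePoint_eq hA x.rep_nonzero
    (by rw [Projectivization.mk_rep]; exact hx.1) hx.2
  refine ⟨T, hT, ?_⟩
  rw [← mk_conePoint]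
  conv_lhs => rw [← x.mk_rep]
  congr 1

end CoordinateTorus

/-! ### The rank of the Gauss map -/

section Rank

variable {k M : Type*} [Field k] [AddCommGroup M] {N : ℕ} (u : Fin (N + 1) → M) {m : ℕ}
  (β : Module.Basis (Fin m) ℤ (M × ℤ))

/-- The monomials that define the Gauss map on the torus. -/
def gaussForm (c : Fin m ↪o Fin (N + 1)) : MvPolynomial (Fin (N + 1)) k :=
  MvPolynomial.monomial (∑ s, Finsupp.single (c s) 1) (minor u β k c)

theorem isHomogeneous_gaussForm (c : Fin m ↪o Fin (N + 1)) :
    (gaussForm (k := k) u β c).IsHomogeneous m := by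
  apply MvPolynomial.isHomogeneous_monomial
  rw [map_sum]
  simp

theorem sum_exponent_smul {G : Type*} [AddCommMonoid G] (c : Fin m → Fin (N + 1))
    (g : Fin (N + 1) → G) :
    ∑ i, (∑ s, Finsupp.single (c s) 1 : Fin (N + 1) →₀ ℕ) i • g i = ∑ s, g (c s) := by
  classical
  simp only [Finset.sum_apply', Finset.sum_smul]
  rw [Finset.sum_comm]
  refine Finset.sum_congr rfl fun s _ => ?_
  rw [Finset.sum_eq_single (c s)]
  · simp
  · intro i _ hi
    simp [hi.symm]
  · simp

theorem eval_gaussForm (T : TorusPoint k (M × ℤ)) (c : Fin m ↪o Fin (N + 1)) :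
    MvPolynomial.eval (conePoint u T) (gaussForm u β c) = gaussVector u β T c := by
  rw [eval_conePoint, gaussForm, coneHom_monomial, apply_single, sum_exponent_smul, gaussVector]

theorem polyDiff_gaussForm (T : TorusPoint k (M × ℤ)) (φ : M × ℤ →+ k)
    (c : Fin m ↪o Fin (N + 1)) :
    polyDiff (gaussForm u β c) (conePoint u T)
      (fun i => conePoint u T i * φ (coneGen u i)) =
        gaussVector u β T c * φ (∑ s, coneGen u (c s)) := by
  rw [← eval_gaussForm, gaussForm, polyDiff_monomial, map_sum]
  simp only [← nsmul_eq_mul]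
  rw [sum_exponent_smul]

variable {u} [IsAlgClosed k] [Module.Free ℤ M] [Module.Finite ℤ M]

/-- In the direction `φ` the Plücker coordinate at `c` is multiplied by `φ(∑ (u_{c s}, 1))`. The `ℤ`
component of `φ` contributes a multiple of the Plücker vector and disappears in the quotient. What
remains is a map on functionals of `M_k` whose kernel, the functionals constant on `B`, is the
annihilator of the direction `W`; so its rank is `dim W`. -/
theorem finrank_range_differential (hA : affineSpan ℤ (Set.range u) = ⊤)
    (hm : m = Module.finrank ℤ M + 1) {x : ℙ k (Fin (N + 1) → k)} {T : TorusPoint k (M × ℤ)}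
    (hx : x.rep = conePoint u T) :
    Module.finrank k (LinearMap.range (differential (toricVariety k u) (gaussForm u β)
      (isHomogeneous_gaussForm u β) x)) =
        Module.finrank k (affineSpan k (toModule k '' setB k u)).direction := by
  set W := (affineSpan k (toModule k '' setB k u)).direction
  have hg : (fun c => MvPolynomial.eval x.rep (gaussForm u β c)) = gaussVector u β T := by
    rw [hx]
    exact funext (eval_gaussForm u β T)
  let ℓ : Submodule k ((Fin m ↪o Fin (N + 1)) → k) :=
    Submodule.span k {fun c => MvPolynomial.eval x.rep (gaussForm u β c)}
  let Λ₀ : Module.Dual k (k ⊗[ℤ] M) →ₗ[k] ((Fin m ↪o Fin (N + 1)) → k) :=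
    LinearMap.pi fun c => gaussVector u β T c •
      LinearMap.applyₗ (toModule k (∑ s, u (c s)))
  let Λ := ℓ.mkQ.comp Λ₀
  have hmem : gaussVector u β T ∈ ℓ := by
    rw [← hg]
    exact Submodule.mem_span_singleton_self _
  have hjac : ∀ φ : M × ℤ →+ k, ℓ.mkQ (jacobian (gaussForm u β) x.rep
      fun i => conePoint u T i * φ (coneGen u i)) =
        Λ (functional (φ.comp (AddMonoidHom.inl M ℤ))) := by
    intro φ
    have h1 : (jacobian (gaussForm u β) x.rep fun i => conePoint u T i * φ (coneGen u i)) =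
        Λ₀ (functional (φ.comp (AddMonoidHom.inl M ℤ))) +
          φ (0, (m : ℤ)) • gaussVector u β T := by
      funext c
      simp only [jacobian, LinearMap.pi_apply, hx, polyDiff_gaussForm, Pi.add_apply,
        Pi.smul_apply, smul_eq_mul, Λ₀, LinearMap.smul_apply, LinearMap.applyₗ_apply_apply,
        functional_toModule, AddMonoidHom.comp_apply, AddMonoidHom.inl_apply]
      rw [sum_coneGen_eq, map_add]
      ring
    have h0 : ℓ.mkQ (gaussVector u β T) = 0 := (Submodule.Quotient.mk_eq_zero ℓ).mpr hmem
    rw [h1, map_add, map_smul, h0, smul_zero, add_zero]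
    rfl
  have hrange : LinearMap.range (differential (toricVariety k u) (gaussForm u β)
      (isHomogeneous_gaussForm u β) x) = LinearMap.range Λ := by
    apply le_antisymm
    · rintro _ ⟨w, rfl⟩
      obtain ⟨⟨w, hw⟩, rfl⟩ := Submodule.Quotient.mk_surjective _ w
      obtain ⟨φ, rfl⟩ := (mem_embeddedTangentSpace_iff hA hx).mp hw
      exact ⟨_, (hjac φ).symm⟩
    · rintro _ ⟨Φ, rfl⟩
      let φ : M × ℤ →+ k := (restrictFunctional Φ).comp (AddMonoidHom.fst M ℤ)
      have hφ : functional (φ.comp (AddMonoidHom.inl M ℤ)) = Φ := by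
        conv_rhs => rw [← functional_restrictFunctional Φ]
        rfl
      refine ⟨Submodule.Quotient.mk ⟨_, (mem_embeddedTangentSpace_iff hA hx).mpr ⟨φ, rfl⟩⟩, ?_⟩
      rw [← hφ]
      exact hjac φ
  have hker : LinearMap.ker Λ = W.dualAnnihilator := by
    ext Φ
    have h1 : Φ ∈ LinearMap.ker Λ ↔ ∃ a : k, ∀ b ∈ setB k u, Φ (toModule k b) = a := by
      change ℓ.mkQ (Λ₀ Φ) = 0 ↔ _
      rw [Submodule.mkQ_apply, Submodule.Quotient.mk_eq_zero, Submodule.mem_span_singleton, hg]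
      -- The factor of proportionality to the Plücker vector is the common value of `Φ` on `B`;
      -- coordinates with zero minor impose no condition.
      refine exists_congr fun a => ⟨fun h b hb => ?_, fun h => ?_⟩
      · obtain ⟨c, hc, rfl⟩ := (mem_setB_iff u β hm).mp hb
        have := congrFun h c
        have hne : gaussVector u β T c ≠ 0 := mul_ne_zero hc (character_ne_zero _ T)
        simp only [Pi.smul_apply, smul_eq_mul, Λ₀, LinearMap.pi_apply, LinearMap.smul_apply,
          LinearMap.applyₗ_apply_apply] at this
        rw [mul_comm] at this
        exact (mul_left_cancel₀ hne this).symm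
      · funext c
        simp only [Pi.smul_apply, smul_eq_mul, Λ₀, LinearMap.pi_apply, LinearMap.smul_apply,
          LinearMap.applyₗ_apply_apply]
        by_cases hc : minor u β k c = 0
        · simp [gaussVector, hc]
        · rw [h _ ((mem_setB_iff u β hm).mpr ⟨c, hc, rfl⟩), mul_comm]
    rw [h1, Submodule.mem_dualAnnihilator]
    have hW : W = vectorSpan k (toModule k '' setB k u) := direction_affineSpan k _
    constructor
    · rintro ⟨a, ha⟩
      have hle : W ≤ LinearMap.ker Φ := by
        rw [hW, vectorSpan_def, Submodule.span_le]
        rintro _ ⟨_, ⟨b, hb, rfl⟩, _, ⟨b', hb', rfl⟩, rfl⟩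
        change Φ (toModule k b - toModule k b') = 0
        rw [map_sub, ha b hb, ha b' hb', sub_self]
      exact fun w hw => hle hw
    · intro h
      obtain ⟨b₀, hb₀⟩ := setB_nonempty k hA
      refine ⟨Φ (toModule k b₀), fun b hb => ?_⟩
      rw [← sub_eq_zero, ← map_sub]
      apply h
      rw [hW]
      exact vsub_mem_vectorSpan k ⟨b, hb, rfl⟩ ⟨b₀, hb₀, rfl⟩
  have h2 := LinearMap.finrank_range_add_finrank_ker Λ
  have h3 := Subspace.finrank_add_finrank_dualAnnihilator_eq W
  rw [hker, Subspace.dual_finrank_eq] at h2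
  rw [hrange]
  exact Nat.add_right_cancel (h2.trans h3.symm)

theorem hasRank_gaussMap (hA : affineSpan ℤ (Set.range u) = ⊤) :
    HasRank (toricVariety k u) (gaussMap (toricVariety k u))
      (Module.finrank k (affineSpan k (toModule k '' setB k u)).direction) := by
  have hm : dim (toricVariety k u) + 1 = Module.finrank ℤ M + 1 := by rw [dim_toricVariety hA]
  let β := coneBasis (k := k) u hA
  refine ⟨coordTorus k N, isOpen_coordTorus k N, ⟨torusMap u (pointOfHom 0), torusMap_mem u _,
    torusMap_mem_coordTorus _⟩, fun x hx => ?_⟩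
  refine ⟨_, gaussForm u β, isHomogeneous_gaussForm u β, coordTorus k N, isOpen_coordTorus k N,
    hx, fun y hy => ?_, ?_⟩
  · obtain ⟨T, hT, hyT⟩ := exists_rep_eq_conePoint hA hy
    have hg : (fun c => MvPolynomial.eval y.rep (gaussForm u β c)) = gaussVector u β T := by
      rw [hT]
      exact funext (eval_gaussForm u β T)
    have hys : y ∈ smoothLocus (toricVariety k u) := hyT ▸ mem_smoothLocus hA _
    refine ⟨hys, hg ▸ gaussVector_ne_zero β hA T, ?_⟩
    rw [gaussMap_eq hA β hys hT]
    congr 1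
    exact hg.symm
  · obtain ⟨T, hT, -⟩ := exists_rep_eq_conePoint hA hx
    exact finrank_range_differential β hA hm hT

end Rank

/-! ### Forms as a basis of the Zariski topology -/

section BasicOpen

variable {k ι : Type*} [Field k]

/-- The sets `F ≠ 0`, with `F` a form, are a basis of the Zariski topology. -/
theorem exists_form_of_mem_open {O : Set (ℙ k (ι → k))} (hO : IsOpen O) {x : ℙ k (ι → k)}
    (hx : x ∈ O) : ∃ (d : ℕ) (F : MvPolynomial ι k), F.IsHomogeneous d ∧
      MvPolynomial.eval x.rep F ≠ 0 ∧ ∀ y, MvPolynomial.eval y.rep F ≠ 0 → y ∈ O := by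
  induction hO with
  | basic s hs =>
    obtain ⟨d, F, hF, rfl⟩ := hs
    exact ⟨d, F, hF, hx, fun y hy => hy⟩
  | univ => exact ⟨0, 1, MvPolynomial.isHomogeneous_one _ _, by simp, fun _ _ => trivial⟩
  | inter s t _ _ hs ht =>
    obtain ⟨d, F, hF, hFx, hFs⟩ := hs hx.1
    obtain ⟨e, G, hG, hGx, hGt⟩ := ht hx.2
    refine ⟨d + e, F * G, hF.mul hG, by rw [map_mul]; exact mul_ne_zero hFx hGx, fun y hy => ?_⟩
    rw [map_mul] at hy
    exact ⟨hFs y (left_ne_zero_of_mul hy), hGt y (right_ne_zero_of_mul hy)⟩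
  | sUnion S _ ih =>
    obtain ⟨s, hs, hxs⟩ := hx
    obtain ⟨d, F, hF, hFx, hFs⟩ := ih s hs hxs
    exact ⟨d, F, hF, hFx, fun y hy => ⟨s, hs, hFs y hy⟩⟩

theorem eval_rep_div {P Q : MvPolynomial ι k} {d : ℕ} (hP : P.IsHomogeneous d)
    (hQ : Q.IsHomogeneous d) {v : ι → k} (hv : v ≠ 0) :
    MvPolynomial.eval (Projectivization.mk k v hv).rep P /
      MvPolynomial.eval (Projectivization.mk k v hv).rep Q =
        MvPolynomial.eval v P / MvPolynomial.eval v Q := by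
  obtain ⟨a, ha⟩ := Projectivization.exists_smul_eq_mk_rep k v hv
  have h : (Projectivization.mk k v hv).rep = (a : k) • v := ha.symm
  rw [h, eval_smul_of_isHomogeneous hP, eval_smul_of_isHomogeneous hQ,
    mul_div_mul_left _ _ (pow_ne_zero _ a.ne_zero)]

end BasicOpen

/-! ### The function field of the image and separability -/

section Pullback

variable {k M : Type*} [Field k] [IsAlgClosed k] [AddCommGroup M] [Module.Free ℤ M]
  [Module.Finite ℤ M] {N : ℕ} {u : Fin (N + 1) → M}

/-- Frees the formula for the Gauss map from the chosen `rep`: two cone points over the same torus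
point have proportional Plücker vectors. -/
theorem gaussMap_torusMap (hA : affineSpan ℤ (Set.range u) = ⊤)
    (β : Module.Basis (Fin (dim (toricVariety k u) + 1)) ℤ (M × ℤ)) (T : TorusPoint k (M × ℤ))
    (hx : torusMap u (basePoint T) ∈ smoothLocus (toricVariety k u)) :
    gaussMap (toricVariety k u) ⟨torusMap u (basePoint T), hx⟩ =
      Projectivization.mk k (gaussVector u β T) (gaussVector_ne_zero β hA T) := by
  obtain ⟨T', hb, hT'⟩ := rep_torusMap u (basePoint T)
  rw [gaussMap_eq hA β hx hT', Projectivization.mk_eq_mk_iff', gaussVector_eq_smul β T 0,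
    gaussVector_eq_smul β T' 0, hb]
  refine ⟨character (0, ((dim (toricVariety k u) + 1 : ℕ) : ℤ)) T' /
    character (0, ((dim (toricVariety k u) + 1 : ℕ) : ℤ)) T, ?_⟩
  rw [smul_smul, div_mul_cancel₀ _ (character_ne_zero _ T)]

/-- By homogeneity a factor `q^d` comes out, and what is left is a polynomial in the ratios `y_c /
q`. -/
theorem aeval_homogeneous_div_mem {E : Type*} [Field E] [Algebra k E] {K : Subfield E}
    (hK : ∀ c : k, algebraMap k E c ∈ K) {κ : Type*} {G : MvPolynomial κ k} {d : ℕ}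
    (hG : G.IsHomogeneous d) (y : κ → E) {q : E} (hq : q ≠ 0) (hy : ∀ c, y c / q ∈ K) :
    MvPolynomial.aeval y G / q ^ d ∈ K := by
  have h1 : y = q • fun c => y c / q := by
    funext c
    rw [Pi.smul_apply, smul_eq_mul, mul_div_cancel₀ _ hq]
  have h2 : MvPolynomial.aeval y G =
      q ^ d * MvPolynomial.eval (fun c => y c / q) (MvPolynomial.map (algebraMap k E) G) := by
    rw [← eval_smul_of_isHomogeneous (hG.map (algebraMap k E)), ← h1, MvPolynomial.eval_map]
    rfl
  rw [h2, mul_div_cancel_left₀ _ (pow_ne_zero _ hq), MvPolynomial.eval_eq]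
  refine sum_mem fun s _ => mul_mem ?_ (prod_mem fun i _ => pow_mem (hy i) _)
  rw [MvPolynomial.coeff_map]
  exact hK _

/-- A rational function on `X_A` that is a pull-back under the Gauss map lies in the field
of `⟨B - B⟩`. -/
theorem fracHom_div_mem_of_pullback (hA : affineSpan ℤ (Set.range u) = ⊤)
    {d e : ℕ} {G H : MvPolynomial (Fin (dim (toricVariety k u) + 1) ↪o Fin (N + 1)) k}
    {P Q : MvPolynomial (Fin (N + 1)) k} {O : Set (ℙ k (Fin (N + 1) → k))}
    (hG : G.IsHomogeneous d) (hH : H.IsHomogeneous d) (hP : P.IsHomogeneous e)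
    (hQ : Q.IsHomogeneous e) (hQ0 : Q ∉ vanishingIdeal (toricVariety k u)) (hO : IsOpen O)
    (hne : (toricVariety k u ∩ O).Nonempty)
    (h : ∀ x ∈ toricVariety k u ∩ O, ∃ hU : x ∈ smoothLocus (toricVariety k u),
        MvPolynomial.eval x.rep Q ≠ 0 ∧
        MvPolynomial.eval (gaussMap (toricVariety k u) ⟨x, hU⟩).rep H ≠ 0 ∧
        MvPolynomial.eval x.rep P / MvPolynomial.eval x.rep Q =
          MvPolynomial.eval (gaussMap (toricVariety k u) ⟨x, hU⟩).rep G /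
            MvPolynomial.eval (gaussMap (toricVariety k u) ⟨x, hU⟩).rep H) :
    fracHom u k (toFrac (toricVariety k u) P / toFrac (toricVariety k u) Q) ∈
      latticeField (coneEmb k M) (baseLattice (diffLattice (setB k u))) := by
  have hm : dim (toricVariety k u) + 1 = Module.finrank ℤ M + 1 := by rw [dim_toricVariety hA]
  let β := coneBasis (k := k) u hA
  obtain ⟨y, hyX, hyO⟩ := hne
  obtain ⟨r, R, hR, hRy, hRO⟩ := exists_form_of_mem_open hO hyO
  have hR0 : coneHom u k R ≠ 0 := by
    rw [Ne, ← mem_vanishingIdeal_toricVariety]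
    intro hmem
    exact hRy (hmem _ y.rep_nonzero (by rwa [Projectivization.mk_rep]))
  let g := MvPolynomial.bind₁ (gaussForm u β) G
  let h' := MvPolynomial.bind₁ (gaussForm u β) H
  have hbind : ∀ (G : MvPolynomial (Fin (dim (toricVariety k u) + 1) ↪o Fin (N + 1)) k)
      (T : TorusPoint k (M × ℤ)), T (coneHom u k (MvPolynomial.bind₁ (gaussForm u β) G)) =
        MvPolynomial.eval (gaussVector u β T) G := by
    intro G T
    rw [← eval_conePoint, ← MvPolynomial.aeval_eq_eval, MvPolynomial.aeval_bind₁,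
      MvPolynomial.aeval_eq_eval]
    congr 2
    funext c
    rw [MvPolynomial.aeval_eq_eval]
    exact eval_gaussForm u β T c
  have key : ∀ T : TorusPoint k (M × ℤ), T (coneHom u k R) ≠ 0 →
      MvPolynomial.eval (gaussVector u β T) H ≠ 0 ∧
      T (coneHom u k P) * MvPolynomial.eval (gaussVector u β T) H =
        T (coneHom u k Q) * MvPolynomial.eval (gaussVector u β T) G := by
    intro T hT
    rw [← eval_conePoint] at hT
    have hxO : torusMap u (basePoint T) ∈ O := by
      apply hRO
      rw [← mk_conePoint]
      exact fun h0 => hT ((eval_rep_eq_zero_iff hR _).mp h0)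
    obtain ⟨hU, h1, h2, h3⟩ := h _ ⟨torusMap_mem u _, hxO⟩
    rw [gaussMap_torusMap hA β T hU] at h2 h3
    rw [eval_rep_div hG hH, ← mk_conePoint, eval_rep_div hP hQ, eval_conePoint,
      eval_conePoint] at h3
    rw [Ne, eval_rep_eq_zero_iff hH] at h2
    rw [← mk_conePoint, Ne, eval_rep_eq_zero_iff hQ, eval_conePoint] at h1
    refine ⟨h2, ?_⟩
    rw [div_eq_div_iff h1 h2] at h3
    rw [h3, mul_comm]
  -- The pull-back identity is known only where `R ≠ 0`. After multiplication by `R` it holds on the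
  -- whole torus, and `R` cancels because the group algebra is a domain.
  have hzero : coneHom u k R * (coneHom u k P * coneHom u k h' - coneHom u k Q * coneHom u k g)
      = 0 := by
    apply eq_zero_of_forall_torusPoint
    intro T
    rw [map_mul, map_sub, map_mul, map_mul, hbind, hbind]
    by_cases hT : T (coneHom u k R) = 0
    · rw [hT, zero_mul]
    · rw [(key T hT).2, sub_self, mul_zero]
  have heq := sub_eq_zero.mp ((mul_eq_zero.mp hzero).resolve_left hR0)
  have hh0 : coneHom u k h' ≠ 0 := by
    intro h0
    apply hR0
    apply eq_zero_of_forall_torusPoint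
    intro T
    by_contra hT
    apply (key T hT).1
    rw [← hbind]
    change T (coneHom u k h') = 0
    rw [h0, map_zero]
  have hinj : Function.Injective (coneEmb k M) := IsFractionRing.injective _ _
  have hdiv : coneEmb k M (coneHom u k P) / coneEmb k M (coneHom u k Q) =
      coneEmb k M (coneHom u k g) / coneEmb k M (coneHom u k h') := by
    rw [mem_vanishingIdeal_toricVariety] at hQ0
    have h1 := congrArg (coneEmb k M) heq
    rw [map_mul, map_mul] at h1
    rw [div_eq_div_iff ((map_ne_zero_iff _ hinj).mpr hQ0) ((map_ne_zero_iff _ hinj).mpr hh0), h1,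
      mul_comm]
  rw [map_div₀, fracHom_toFrac, fracHom_toFrac, hdiv]
  obtain ⟨b₀, hb₀⟩ := setB_nonempty k hA
  -- Dividing by the `d`-th power of the monomial of `b₀` turns each Plücker monomial into some
  -- `z^(b - b₀)`, a character of `⟨B - B⟩`.
  have hform : ∀ (G : MvPolynomial (Fin (dim (toricVariety k u) + 1) ↪o Fin (N + 1)) k),
      G.IsHomogeneous d → coneEmb k M (coneHom u k (MvPolynomial.bind₁ (gaussForm u β) G)) /
        chi (coneEmb k M) (b₀, ((dim (toricVariety k u) + 1 : ℕ) : ℤ)) ^ d ∈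
          latticeField (coneEmb k M) (baseLattice (diffLattice (setB k u))) := by
    intro G hG
    have h1 : coneEmb k M (coneHom u k (MvPolynomial.bind₁ (gaussForm u β) G)) =
        MvPolynomial.aeval (fun c => coneEmb k M (coneHom u k (gaussForm u β c))) G := by
      have : ((IsScalarTower.toAlgHom k (AddMonoidAlgebra k (M × ℤ)) (ConeField k M)).comp
          (coneHom u k)).comp (MvPolynomial.bind₁ (gaussForm u β)) =
          MvPolynomial.aeval (fun c => coneEmb k M (coneHom u k (gaussForm u β c))) := by
        apply MvPolynomial.algHom_ext
        intro c
        simp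
      exact congrArg (fun f => f G) this
    rw [h1]
    refine aeval_homogeneous_div_mem
      (fun c => single_mem_latticeField (coneEmb k M) (zero_mem _) c) hG _
      (chi_ne_zero _ _) fun c => ?_
    rw [gaussForm, coneHom_monomial, sum_exponent_smul, single_eq_mul_chi, mul_div_assoc,
      ← chi_sub]
    by_cases hc : minor u β k c = 0
    · rw [hc, AddMonoidAlgebra.single_zero, map_zero, zero_mul]
      exact zero_mem _
    · refine mul_mem (single_mem_latticeField _ (zero_mem _) _) (chi_mem_latticeField _
        ⟨∑ s, u (c s) - b₀, sub_mem_diffLattice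
          ⟨_, (mem_setB_iff u β hm).mpr ⟨c, hc, rfl⟩⟩ ⟨b₀, hb₀⟩, ?_⟩)
      rw [sum_coneGen_eq]
      apply Prod.ext <;> simp
  rw [← div_div_div_cancel_right₀ (pow_ne_zero d (chi_ne_zero (coneEmb k M)
    (b₀, ((dim (toricVariety k u) + 1 : ℕ) : ℤ))))]
  exact div_mem (hform G hG) (hform H hH)

/-- `z^(b - b')` is the pull-back of a ratio of two Plücker coordinates, each divided by its nonzero
minor; on `X_A` it is a ratio of two monomials of the same degree. -/
theorem toFunctionField_mem_pullbackField (hA : affineSpan ℤ (Set.range u) = ⊤) {b b' : M}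
    (hb : b ∈ setB k u) (hb' : b' ∈ setB k u) :
    chi (toFunctionField hA k).toRingHom (b - b') ∈
      pullbackField (toricVariety k u) (gaussMap (toricVariety k u)) := by
  have hm : dim (toricVariety k u) + 1 = Module.finrank ℤ M + 1 := by rw [dim_toricVariety hA]
  let β := coneBasis (k := k) u hA
  obtain ⟨c, hc, rfl⟩ := (mem_setB_iff u β hm).mp hb
  obtain ⟨c', hc', rfl⟩ := (mem_setB_iff u β hm).mp hb'
  let mon (c : Fin (dim (toricVariety k u) + 1) ↪o Fin (N + 1)) : MvPolynomial (Fin (N + 1)) k :=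
    MvPolynomial.monomial (∑ s, Finsupp.single (c s) 1) 1
  let form (c : Fin (dim (toricVariety k u) + 1) ↪o Fin (N + 1)) :
      MvPolynomial (Fin (dim (toricVariety k u) + 1) ↪o Fin (N + 1)) k :=
    MvPolynomial.C (minor u β k c)⁻¹ * MvPolynomial.X c
  have hmon : ∀ (c : Fin (dim (toricVariety k u) + 1) ↪o Fin (N + 1)),
      (mon c).IsHomogeneous (dim (toricVariety k u) + 1) := by
    intro c
    apply MvPolynomial.isHomogeneous_monomial
    rw [map_sum]
    simp
  have hform : ∀ c, (form c).IsHomogeneous (0 + 1) := fun c =>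
    (MvPolynomial.isHomogeneous_C _ _).mul (MvPolynomial.isHomogeneous_X _ _)
  have hevm : ∀ (c : Fin (dim (toricVariety k u) + 1) ↪o Fin (N + 1)) T,
      MvPolynomial.eval (conePoint u T) (mon c) =
      character (∑ s, coneGen u (c s)) T := by
    intro c T
    rw [eval_conePoint, coneHom_monomial, apply_single, sum_exponent_smul, one_mul]
  have hevf : ∀ (c : Fin (dim (toricVariety k u) + 1) ↪o Fin (N + 1)) T,
      minor u β k c ≠ 0 → MvPolynomial.eval (gaussVector u β T) (form c) =
      character (∑ s, coneGen u (c s)) T := by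
    intro c T hc
    simp only [form, map_mul, MvPolynomial.eval_C, MvPolynomial.eval_X, gaussVector]
    rw [inv_mul_cancel_left₀ hc]
  refine IntermediateField.subset_adjoin _ _ ⟨0 + 1, dim (toricVariety k u) + 1, form c, form c',
    mon c, mon c', coordTorus k N, hform c, hform c', hmon c, hmon c',
    monomial_notMem _ one_ne_zero, ?_, isOpen_coordTorus k N, ⟨torusMap u (pointOfHom 0),
      torusMap_mem u _, torusMap_mem_coordTorus _⟩, fun x hx => ?_⟩
  · apply (fracHom u k).injective
    change fracHom u k _ = fracHom u k (toFrac _ (MvPolynomial.monomial _ 1) /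
      toFrac _ (MvPolynomial.monomial _ 1))
    rw [← chi_eq_fracHom (m := ∑ s, u (c s) - ∑ s, u (c' s))]
    · change ffHom u k (toFunctionField hA k _) = _
      rw [ffHom_toFunctionField, baseHom_single]
      rfl
    · rw [sum_exponent_smul, sum_exponent_smul, sum_coneGen_eq, sum_coneGen_eq]
      apply Prod.ext <;> simp
  · obtain ⟨T, hT, hxT⟩ := exists_rep_eq_conePoint hA hx
    have hU : x ∈ smoothLocus (toricVariety k u) := hxT ▸ mem_smoothLocus hA _
    refine ⟨hU, ?_, ?_, ?_⟩
    · rw [hT, hevm]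
      exact character_ne_zero _ T
    · rw [gaussMap_eq hA β hU hT, Ne, eval_rep_eq_zero_iff (hform c'), hevf c' T hc']
      exact character_ne_zero _ T
    · rw [gaussMap_eq hA β hU hT, eval_rep_div (hform c) (hform c'), hevf c T hc, hevf c' T hc',
        hT, hevm, hevm]

theorem latticeField_le_of_intermediateField (hA : affineSpan ℤ (Set.range u) = ⊤)
    (K : IntermediateField k (functionField (toricVariety k u)))
    (hK : ∀ b b' : M, b ∈ setB k u → b' ∈ setB k u →
      chi (toFunctionField hA k).toRingHom (b - b') ∈ K) :
    latticeField (toFunctionField hA k).toRingHom (diffLattice (setB k u)) ≤ K.toSubfield := by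
  apply latticeField_le
  · intro c
    have h1 : (toFunctionField hA k).toRingHom (algebraMap k _ c) = algebraMap k _ c :=
      (toFunctionField hA k).commutes c
    rw [AddMonoidAlgebra.coe_algebraMap, Function.comp_apply] at h1
    exact h1.symm ▸ K.algebraMap_mem c
  · intro l hl
    induction hl using AddSubgroup.closure_induction with
    | mem x hx =>
      obtain ⟨b, hb, b', hb', rfl⟩ := hx
      exact hK b b' hb hb'
    | zero => rw [chi_zero]; exact one_mem K
    | add x y _ _ hx hy => rw [chi_add]; exact mul_mem (S := IntermediateField _ _) hx hy
    | neg x _ hx => rw [chi_neg]; exact inv_mem (S := IntermediateField _ _) hx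

theorem toSubfield_pullbackField (hA : affineSpan ℤ (Set.range u) = ⊤) :
    (pullbackField (toricVariety k u) (gaussMap (toricVariety k u))).toSubfield =
      latticeField (toFunctionField hA k).toRingHom (diffLattice (setB k u)) := by
  apply le_antisymm
  · intro z hz
    replace hz : z ∈ pullbackField (toricVariety k u) (gaussMap (toricVariety k u)) := hz
    induction hz using IntermediateField.adjoin_induction with
    | mem z hz =>
      obtain ⟨d, e, G, H, P, Q, O, hG, hH, hP, hQ, hQ0, hz, hO, hne, h⟩ := hz
      rw [mem_latticeField_toFunctionField]
      change fracHom u k z ∈ _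
      rw [hz]
      exact fracHom_div_mem_of_pullback hA hG hH hP hQ hQ0 hO hne h
    | algebraMap c =>
      rw [← (toFunctionField hA k).commutes]
      exact single_mem_latticeField (toFunctionField hA k).toRingHom (zero_mem _) c
    | add x y _ _ hx hy => exact add_mem hx hy
    | inv x _ hx => exact inv_mem hx
    | mul x y _ _ hx hy => exact mul_mem hx hy
  · exact latticeField_le_of_intermediateField hA _
      fun b b' hb hb' => toFunctionField_mem_pullbackField hA hb hb'

theorem isSeparableExtension_intermediateField_iff {k E : Type*} [Field k] [Field E] [Algebra k E]
    (ι : AddMonoidAlgebra k M →+* E) (hι : Function.Injective ι) {L : AddSubgroup M}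
    {K : IntermediateField k E} (hK : K.toSubfield = latticeField ι L)
    (hE : latticeField ι ⊤ = ⊤) :
    IsSeparableExtension K E ↔
      Module.finrank k (Submodule.span k (toModule k '' (L : Set M))) =
        Module.finrank ℤ (AddSubgroup.toIntSubmodule L) := by
  refine isSeparableExtension_chi_iff ι hι ?_ hE
  rw [← hK]
  ext z
  exact ⟨fun ⟨w, hw⟩ => hw ▸ w.2, fun hz => ⟨⟨z, hz⟩, rfl⟩⟩

/-- The two dimensions are those of the span of `⟨B - B⟩` in `M_k` and of its rank, so this is the
lattice criterion for the extension of function fields. -/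
theorem isSeparableMap_gaussMap_iff (hA : affineSpan ℤ (Set.range u) = ⊤) :
    IsSeparableMap (toricVariety k u) (gaussMap (toricVariety k u)) ↔
      Module.finrank k (affineSpan k (toModule k '' setB k u)).direction =
        Module.finrank ℤ (affineSpan ℤ (setB k u)).direction := by
  rw [direction_affineSpan, direction_affineSpan, vectorSpan_toModule_image, vectorSpan_int_eq]
  exact isSeparableExtension_intermediateField_iff _ (toFunctionField_injective hA)
    (toSubfield_pullbackField hA) (latticeField_toFunctionField_top hA)

end Pullback

/-! ### Components of a finite partition into closed irreducible sets -/

section Partition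

variable {X J : Type*} [TopologicalSpace X] [Finite J]

/-- The irreducible components of a space that is partitioned into finitely many closed
irreducible subsets. -/
theorem irreducibleComponents_of_partition {F : Set X} (Z C : J → Set X)
    (hC : ∀ j, IsClosed (C j)) (hZ : ∀ j, Z j = F ∩ C j) (hirr : ∀ j, IsIrreducible (Z j))
    (hdisj : ∀ i j, ∀ x ∈ Z i, x ∈ Z j → i = j) (hcov : ∀ x ∈ F, ∃ j, x ∈ Z j) :
    (irreducibleComponents F).Finite ∧ (irreducibleComponents F).ncard = Nat.card J := by
  let Y : J → Set F := fun j => Subtype.val ⁻¹' C j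
  have hmem : ∀ j (x : F), x ∈ Y j ↔ (x : X) ∈ Z j := by
    intro j x
    rw [hZ]
    exact ⟨fun h => ⟨x.2, h⟩, fun h => h.2⟩
  have hY : ∀ j, IsIrreducible (Y j) := by
    intro j
    obtain ⟨⟨x, hx⟩, h⟩ := hirr j
    refine ⟨⟨⟨x, (hZ j ▸ hx : x ∈ F ∩ C j).1⟩, (hmem _ _).mpr hx⟩, ?_⟩
    rintro _ _ ⟨U, hU, rfl⟩ ⟨V, hV, rfl⟩ ⟨x, hx, hxU⟩ ⟨y, hy, hyV⟩
    obtain ⟨z, hz, hzUV⟩ := h U V hU hV ⟨x, (hmem _ _).mp hx, hxU⟩ ⟨y, (hmem _ _).mp hy, hyV⟩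
    exact ⟨⟨z, (hZ j ▸ hz : z ∈ F ∩ C j).1⟩, (hmem _ _).mpr hz, hzUV⟩
  have hYc : ∀ j, IsClosed (Y j) := fun j => (hC j).preimage continuous_subtype_val
  -- An irreducible set covered by finitely many closed sets lies in one of them. As the pieces are
  -- nonempty and disjoint, none contains another, so they are exactly the maximal irreducible
  -- subsets.
  have hsub : ∀ s : Set F, IsIrreducible s → ∃ j, s ⊆ Y j := by
    intro s hs
    obtain ⟨z, hz, hsz⟩ := isIrreducible_iff_sUnion_isClosed.mp hs
      (Set.finite_range Y).toFinset (by simpa using hYc) (by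
        intro x _
        obtain ⟨j, hj⟩ := hcov x x.2
        simpa using ⟨j, (hmem j x).mpr hj⟩)
    obtain ⟨j, rfl⟩ : ∃ j, Y j = z := by simpa using hz
    exact ⟨j, hsz⟩
  have hle : ∀ i j, Y i ⊆ Y j → i = j := by
    intro i j h
    obtain ⟨x, hx⟩ := (hY i).nonempty
    exact hdisj i j x ((hmem _ _).mp hx) ((hmem _ _).mp (h hx))
  have hrange : irreducibleComponents F = Set.range Y := by
    ext s
    constructor
    · rintro ⟨hs, hmax⟩
      obtain ⟨j, hj⟩ := hsub s hs
      exact ⟨j, Set.Subset.antisymm (hmax (hY j) hj) hj⟩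
    · rintro ⟨j, rfl⟩
      refine ⟨hY j, fun s hs hjs => ?_⟩
      obtain ⟨i, hi⟩ := hsub s hs
      rwa [← hle j i (hjs.trans hi)] at hi
  rw [hrange]
  refine ⟨Set.finite_range Y, ?_⟩
  rw [← Set.image_univ, Set.ncard_image_of_injective _ fun i j h => hle i j h.subset,
    Set.ncard_univ]

end Partition

/-! ### Translates of subtori: irreducibility and closedness -/

section Coset

variable {k M : Type*} [Field k] [AddCommGroup M] {N : ℕ} (u : Fin (N + 1) → M)

theorem charHom_pointOfHom (φ : M →+ Additive kˣ) : charHom (pointOfHom φ) = φ := by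
  ext m
  exact character_pointOfHom φ m

/-- The images of the torus points that restrict to a given character of a sublattice. -/
def torusCoset (H : AddSubgroup M) (ψ : H →+ Additive kˣ) : Set (ℙ k (Fin (N + 1) → k)) :=
  {x | ∃ t : TorusPoint k M, x = torusMap u t ∧ ∀ m : H, charHom t (m : M) = ψ m}

/-- Freeness of `M / H` splits off `H` as a direct summand, and `ψ` is composed with the projection
to it. -/
theorem exists_charHom_extending (H : AddSubgroup M) [Module.Free ℤ (M ⧸ H)]
    (ψ : H →+ Additive kˣ) : ∃ t : TorusPoint k M, ∀ m : H, charHom t (m : M) = ψ m := by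
  obtain ⟨σ, hσ⟩ := Module.projective_lifting_property
    (QuotientAddGroup.mk' H).toIntLinearMap (LinearMap.id (R := ℤ) (M := M ⧸ H))
    (QuotientAddGroup.mk'_surjective H)
  have hσ' : ∀ q, QuotientAddGroup.mk' H (σ q) = q := fun q => LinearMap.congr_fun hσ q
  let r : M →+ H := (AddMonoidHom.id M - σ.toAddMonoidHom.comp (QuotientAddGroup.mk' H)).codRestrict
    H fun m => by
      rw [← QuotientAddGroup.eq_zero_iff]
      change QuotientAddGroup.mk' H (m - σ (QuotientAddGroup.mk' H m)) = 0
      rw [map_sub, hσ', sub_self]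
  refine ⟨pointOfHom (ψ.comp r), fun m => ?_⟩
  rw [charHom_pointOfHom, AddMonoidHom.comp_apply]
  congr 1
  apply Subtype.ext
  change (m : M) - σ (QuotientAddGroup.mk' H (m : M)) = m
  have : QuotientAddGroup.mk' H (m : M) = 0 := (QuotientAddGroup.eq_zero_iff _).mpr m.2
  rw [this, map_zero, sub_zero]

theorem mem_iff_of_form {O : Set (ℙ k (Fin (N + 1) → k))} (hO : IsOpen O) {t : TorusPoint k M}
    (ht : torusMap u t ∈ O) : ∃ F : MvPolynomial (Fin (N + 1)) k,
      MvPolynomial.eval (fun i => character (u i) t) F ≠ 0 ∧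
      ∀ t' : TorusPoint k M, MvPolynomial.eval (fun i => character (u i) t') F ≠ 0 →
        torusMap u t' ∈ O := by
  obtain ⟨d, F, hF, hFt, h⟩ := exists_form_of_mem_open hO ht
  refine ⟨F, fun h0 => hFt ((eval_rep_eq_zero_iff hF _).mpr h0), fun t' ht' => h _ fun h0 => ?_⟩
  exact ht' ((eval_rep_eq_zero_iff hF _).mp h0)

/-- After choosing one point `t₁`, the coset is parametrized by the torus of `M / H`, and
polynomials restrict to Laurent polynomials in the domain `k[M / H]`. Two nonempty open sets give
two nonzero restrictions, whose product is nonzero at some torus point. -/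
theorem isIrreducible_torusCoset [IsAlgClosed k] (H : AddSubgroup M) [Module.Free ℤ (M ⧸ H)]
    [Module.Finite ℤ (M ⧸ H)] (ψ : H →+ Additive kˣ) : IsIrreducible (torusCoset u H ψ) := by
  obtain ⟨t₁, ht₁⟩ := exists_charHom_extending H ψ
  have := isDomain_addMonoidAlgebra k (M ⧸ H)
  let τ : TorusPoint k (M ⧸ H) → TorusPoint k M := fun s =>
    pointOfHom (charHom t₁ + (charHom s).comp (QuotientAddGroup.mk' H))
  let Φ : MvPolynomial (Fin (N + 1)) k →ₐ[k] AddMonoidAlgebra k (M ⧸ H) :=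
    MvPolynomial.aeval fun i => AddMonoidAlgebra.single (u i : M ⧸ H) (character (u i) t₁)
  have hΦ : ∀ s F, s (Φ F) = MvPolynomial.eval (fun i => character (u i) (τ s)) F := by
    intro s F
    have : s.comp Φ = MvPolynomial.aeval fun i => character (u i) (τ s) := by
      apply MvPolynomial.algHom_ext
      intro i
      rw [AlgHom.comp_apply, MvPolynomial.aeval_X, MvPolynomial.aeval_X, apply_single,
        character_pointOfHom]
      rfl
    rw [← AlgHom.comp_apply, this, MvPolynomial.aeval_eq_eval]
  have hτ : ∀ s, torusMap u (τ s) ∈ torusCoset u H ψ := by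
    refine fun s => ⟨_, rfl, fun m => ?_⟩
    have h0 : QuotientAddGroup.mk' H (m : M) = 0 := (QuotientAddGroup.eq_zero_iff _).mpr m.2
    rw [charHom_pointOfHom, AddMonoidHom.add_apply, AddMonoidHom.comp_apply, h0, map_zero,
      add_zero, ht₁]
  have hτs : ∀ t : TorusPoint k M, (∀ m : H, charHom t (m : M) = ψ m) → ∃ s, τ s = t := by
    intro t ht
    refine ⟨pointOfHom (QuotientAddGroup.lift H (charHom t - charHom t₁) fun m hm => ?_), ?_⟩
    · rw [AddMonoidHom.mem_ker, AddMonoidHom.sub_apply, ht ⟨m, hm⟩, ht₁ ⟨m, hm⟩, sub_self]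
    · apply torusPoint_ext
      intro m
      rw [← charHom_eq_iff]
      simp only [τ]
      rw [charHom_pointOfHom, charHom_pointOfHom, AddMonoidHom.add_apply]
      exact add_sub_cancel (charHom t₁ m) (charHom t m)
  refine ⟨⟨_, t₁, rfl, ht₁⟩, ?_⟩
  rintro U V hU hV ⟨_, ⟨a, rfl, ha⟩, haU⟩ ⟨_, ⟨b, rfl, hb⟩, hbV⟩
  obtain ⟨F, hFa, hF⟩ := mem_iff_of_form u hU haU
  obtain ⟨G, hGb, hG⟩ := mem_iff_of_form u hV hbV
  obtain ⟨s, rfl⟩ := hτs a ha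
  obtain ⟨s', rfl⟩ := hτs b hb
  have hF0 : Φ F ≠ 0 := fun h => hFa (by rw [← hΦ, h, map_zero])
  have hG0 : Φ G ≠ 0 := fun h => hGb (by rw [← hΦ, h, map_zero])
  obtain ⟨r, hr⟩ : ∃ r : TorusPoint k (M ⧸ H), r (Φ F * Φ G) ≠ 0 := by
    by_contra! h
    exact mul_ne_zero hF0 hG0 (eq_zero_of_forall_torusPoint _ h)
  rw [map_mul, hΦ, hΦ] at hr
  exact ⟨_, hτ r, hF _ (left_ne_zero_of_mul hr), hG _ (right_ne_zero_of_mul hr)⟩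

variable {u} [IsAlgClosed k] [Module.Free ℤ M] [Module.Finite ℤ M]

/-- `z^m` is a ratio of two monomials of the same degree, so the condition `z^m = c` is the
vanishing of a form. -/
theorem exists_isClosed_torusMap_mem_iff (hA : affineSpan ℤ (Set.range u) = ⊤) (m : M) (c : k) :
    ∃ C : Set (ℙ k (Fin (N + 1) → k)), IsClosed C ∧
      ∀ t : TorusPoint k M, torusMap u t ∈ C ↔ character m t = c := by
  obtain ⟨d, s, s', hs, hs', h⟩ := exists_monomials hA m
  let F : MvPolynomial (Fin (N + 1)) k :=
    MvPolynomial.monomial s 1 - MvPolynomial.C c * MvPolynomial.monomial s' 1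
  have hF : F.IsHomogeneous d := by
    refine (MvPolynomial.isHomogeneous_monomial _ hs).sub ?_
    rw [← zero_add d]
    exact (MvPolynomial.isHomogeneous_C _ _).mul (MvPolynomial.isHomogeneous_monomial _ hs')
  refine ⟨_, (isOpen_basic hF).isClosed_compl, fun t => ?_⟩
  obtain ⟨T, rfl, hT⟩ := rep_torusMap u t
  rw [Set.mem_compl_iff, Set.mem_ofPred_eq, not_not, hT, eval_conePoint, map_sub, map_mul, map_sub,
    map_mul, coneHom_monomial, coneHom_monomial, apply_single, apply_single, h, character_add,
    one_mul, one_mul, character_basePoint, sub_eq_zero, ← MvPolynomial.algebraMap_eq,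
    AlgHom.commutes, AlgHom.commutes, Algebra.algebraMap_self, RingHom.id_apply]
  exact mul_left_inj' (character_ne_zero _ T)

theorem exists_isClosed_torusCoset (hA : affineSpan ℤ (Set.range u) = ⊤) (H : AddSubgroup M)
    (ψ : H →+ Additive kˣ) : ∃ C : Set (ℙ k (Fin (N + 1) → k)), IsClosed C ∧
      ∀ t : TorusPoint k M, torusMap u t ∈ C ↔ ∀ m : H, charHom t (m : M) = ψ m := by
  choose C hC h using fun m : H =>
    exists_isClosed_torusMap_mem_iff hA (m : M) ((ψ m).toMul : k)
  refine ⟨⋂ m, C m, isClosed_iInter hC, fun t => ?_⟩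
  rw [Set.mem_iInter]
  refine forall_congr' fun m => ?_
  rw [h, ← coe_charHom, Units.val_inj]
  exact Additive.toMul.injective.eq_iff

end Coset

/-! ### Fibers of the Gauss map on the torus -/

section Fiber

variable {k M : Type*} [Field k] [IsAlgClosed k] [AddCommGroup M] [Module.Free ℤ M]
  [Module.Finite ℤ M] {N : ℕ} {u : Fin (N + 1) → M}

/-- The Plücker point determines the ratios `z^(b - b₀)` and is determined by them, and the `b - b₀`
generate `⟨B - B⟩`. -/
theorem gaussMap_torusMap_eq_iff (hA : affineSpan ℤ (Set.range u) = ⊤) {t t' : TorusPoint k M}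
    (hx : torusMap u t ∈ smoothLocus (toricVariety k u))
    (hx' : torusMap u t' ∈ smoothLocus (toricVariety k u)) :
    gaussMap (toricVariety k u) ⟨torusMap u t, hx⟩ =
      gaussMap (toricVariety k u) ⟨torusMap u t', hx'⟩ ↔
        ∀ l ∈ diffLattice (setB k u), charHom t l = charHom t' l := by
  have hm : dim (toricVariety k u) + 1 = Module.finrank ℤ M + 1 := by rw [dim_toricVariety hA]
  let β := coneBasis (k := k) u hA
  obtain ⟨b₀, hb₀⟩ := setB_nonempty k hA
  obtain ⟨T, rfl, -⟩ := rep_torusMap u t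
  obtain ⟨T', rfl, -⟩ := rep_torusMap u t'
  rw [gaussMap_torusMap hA β T hx, gaussMap_torusMap hA β T' hx', Projectivization.mk_eq_mk_iff',
    gaussVector_eq_smul β T b₀, gaussVector_eq_smul β T' b₀]
  set a := character (b₀, ((dim (toricVariety k u) + 1 : ℕ) : ℤ)) T
  have ha : a ≠ 0 := character_ne_zero _ T
  set a' := character (b₀, ((dim (toricVariety k u) + 1 : ℕ) : ℤ)) T'
  have ha' : a' ≠ 0 := character_ne_zero _ T'
  constructor
  · rintro ⟨e, he⟩ l hl
    have key : ∀ b ∈ setB k u, e * a' * character (b - b₀) (basePoint T') =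
        a * character (b - b₀) (basePoint T) := by
      intro b hb
      obtain ⟨c, hc, rfl⟩ := (mem_setB_iff u β hm).mp hb
      have := congrFun he c
      simp only [Pi.smul_apply, smul_eq_mul] at this
      apply mul_left_cancel₀ hc
      linear_combination this
    -- At `b = b₀` the characters are `1`, which fixes the factor of proportionality.
    have h0 := key b₀ hb₀
    rw [sub_self, character_zero, character_zero, mul_one, mul_one] at h0
    have key' : ∀ b ∈ setB k u,
        charHom (basePoint T) (b - b₀) = charHom (basePoint T') (b - b₀) := by
      intro b hb
      rw [charHom_eq_iff]
      have := key b hb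
      rw [h0] at this
      exact (mul_left_cancel₀ ha this).symm
    induction hl using AddSubgroup.closure_induction with
    | mem x hx =>
      obtain ⟨b, hb, b', hb', rfl⟩ := hx
      rw [← sub_sub_sub_cancel_right b b' b₀, map_sub _ (b - b₀), map_sub _ (b - b₀), key' b hb,
        key' b' hb']
    | zero => rw [map_zero, map_zero]
    | add x y _ _ hx hy => rw [map_add, map_add, hx, hy]
    | neg x _ hx => rw [map_neg, map_neg, hx]
  · intro h
    refine ⟨a / a', ?_⟩
    rw [smul_smul, div_mul_cancel₀ _ ha']
    congr 1
    funext c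
    by_cases hc : minor u β k c = 0
    · rw [hc, zero_mul, zero_mul]
    · congr 1
      exact (charHom_eq_iff.mp (h _ (sub_mem_diffLattice
        ⟨_, (mem_setB_iff u β hm).mpr ⟨c, hc, rfl⟩⟩ ⟨b₀, hb₀⟩))).symm

end Fiber

/-! ### Characters of finite groups with values in `kˣ` -/

section Duality

variable {k : Type*} [Field k]

/-- The exponent is invertible in `k`, so the algebraically closed field `k` has enough roots of
unity for duality of finite abelian groups. -/
theorem card_hom_units_of_coprime [IsAlgClosed k] (Q : Type*) [AddCommGroup Q] [Finite Q] {p : ℕ}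
    [CharP k p] (hp : p.Prime) (h : (Nat.card Q).Coprime p) :
    Nat.card (Q →+ Additive kˣ) = Nat.card Q := by
  have hexp : ((Monoid.exponent (Multiplicative Q) : ℕ) : k) ≠ 0 := by
    rw [Ne, CharP.cast_eq_zero_iff k p]
    intro hdvd
    have h1 : p ∣ Nat.card Q := hdvd.trans (Group.exponent_dvd_nat_card (G := Multiplicative Q))
    exact hp.one_lt.ne' (Nat.dvd_one.mp (h ▸ Nat.dvd_gcd h1 dvd_rfl))
  have : NeZero ((Monoid.exponent (Multiplicative Q) : ℕ) : k) := ⟨hexp⟩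
  rw [Nat.card_congr AddMonoidHom.toMultiplicativeLeft,
    CommGroup.card_monoidHom_of_hasEnoughRootsOfUnity (Multiplicative Q) k]
  rfl

/-- Injectivity of Frobenius: `kˣ` has no `p`-torsion. -/
theorem eq_zero_of_pow_nsmul_eq_zero {p : ℕ} [CharP k p] (hp : p.Prime) (s : ℕ) {x : Additive kˣ}
    (hx : p ^ s • x = 0) : x = 0 := by
  have : ExpChar k p := ExpChar.prime hp
  have h : ((x.toMul : kˣ) : k) ^ p ^ s = 1 ^ p ^ s := by
    rw [one_pow, ← Units.val_pow_eq_pow_val, ← toMul_nsmul, hx]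
    rfl
  exact Additive.toMul.injective (Units.ext (iterateFrobenius_inj k p s h))

end Duality

/-! ### Irreducible components of a general fiber -/

section FiberComponents

variable {k M : Type*} [Field k] [IsAlgClosed k] [AddCommGroup M] [Module.Free ℤ M]
  [Module.Finite ℤ M] {N : ℕ} {u : Fin (N + 1) → M}

theorem finite_quotient {M : Type*} [AddCommGroup M] [Module.Finite ℤ M] (H : AddSubgroup M) :
    Module.Finite ℤ (M ⧸ H) :=
  Module.Finite.of_surjective (QuotientAddGroup.mk' H).toIntLinearMap
    (QuotientAddGroup.mk'_surjective H)

/-- A saturated sublattice has a torsion-free quotient, and finitely generated torsion-free groups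
are free. -/
theorem free_quotient_realSaturation (L : AddSubgroup M) :
    Module.Free ℤ (M ⧸ realSaturation L) := by
  have := finite_quotient (realSaturation L)
  rw [Module.free_iff_isTorsionFree]
  refine Module.IsTorsionFree.of_smul_eq_zero fun r q h => ?_
  obtain ⟨m, rfl⟩ := QuotientAddGroup.mk_surjective q
  rw [← QuotientAddGroup.mk_zsmul, QuotientAddGroup.eq_zero_iff] at h
  rw [or_iff_not_imp_left]
  intro hr
  obtain ⟨d, hd, hm⟩ := mem_realSaturation.mp (natAbs_nsmul_mem h)
  rw [← mul_nsmul'] at hm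
  exact (QuotientAddGroup.eq_zero_iff _).mpr
    (mem_realSaturation.mpr ⟨_, mul_ne_zero hd (Int.natAbs_ne_zero.mpr hr), hm⟩)

/-- The fiber through `t₀` consists of the characters that agree with `t₀` on `L`. On the saturation
`H` they differ from `t₀` by a character of `H / L`, which factors through `H / D` as `kˣ` has no
`p`-torsion. Each character `f` of `H / D` gives one closed irreducible coset, and there are as many
`f` as elements of `H / D`. -/
theorem generalFiberHasComponents_gaussMap (hA : affineSpan ℤ (Set.range u) = ⊤) {p : ℕ}
    [CharP k p] (hp : p.Prime) (s : ℕ)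
    (hs : (Nat.card (realSaturation (diffLattice (setB k u)) ⧸
      torsionPreimage ((diffLattice (setB k u)).addSubgroupOf
        (realSaturation (diffLattice (setB k u)))) (p ^ s))).Coprime p) :
    GeneralFiberHasComponents (toricVariety k u) (gaussMap (toricVariety k u))
      (Nat.card (realSaturation (diffLattice (setB k u)) ⧸
        torsionPreimage ((diffLattice (setB k u)).addSubgroupOf
          (realSaturation (diffLattice (setB k u)))) (p ^ s))) := by
  set L := diffLattice (setB k u)
  set H := realSaturation L
  set D := torsionPreimage (L.addSubgroupOf H) (p ^ s)
  have := finite_quotient H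
  have : Module.Free ℤ (M ⧸ H) := free_quotient_realSaturation L
  have : Finite (H ⧸ L.addSubgroupOf H) := finite_realSaturation_quotient L
  have : Finite (H ⧸ D) := Finite.of_surjective
    (QuotientAddGroup.map _ D (AddMonoidHom.id H) (le_torsionPreimage _ _)) (by
      intro q
      obtain ⟨m, rfl⟩ := QuotientAddGroup.mk_surjective q
      exact ⟨(m : H ⧸ L.addSubgroupOf H), rfl⟩)
  have hcard := card_hom_units_of_coprime (k := k) (H ⧸ D) hp hs
  have : Finite (H ⧸ D →+ Additive kˣ) := Nat.finite_of_card_ne_zero (by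
    rw [hcard]
    exact Nat.card_pos.ne')
  refine ⟨coordTorus k N, isOpen_coordTorus k N, ⟨torusMap u (pointOfHom 0), torusMap_mem u _,
    torusMap_mem_coordTorus _⟩, fun x hx => ?_, Set.univ, isOpen_univ, ?_, ?_⟩
  · obtain ⟨T, -, rfl⟩ := exists_rep_eq_conePoint hA hx
    exact mem_smoothLocus hA _
  · rw [Set.univ_inter]
    exact ⟨_, ⟨torusMap u (pointOfHom 0), mem_smoothLocus hA _⟩,
      ⟨torusMap_mem u _, torusMap_mem_coordTorus _⟩, rfl⟩
  · rintro _ ⟨-, ⟨x₀, hx₀⟩, hx₀', rfl⟩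
    obtain ⟨T₀, -, h₀⟩ := exists_rep_eq_conePoint hA hx₀'
    obtain ⟨t₀, rfl⟩ : ∃ t₀, x₀ = torusMap u t₀ := ⟨_, h₀⟩
    let ψ : (H ⧸ D →+ Additive kˣ) → (H →+ Additive kˣ) := fun f =>
      (charHom t₀).comp H.subtype + f.comp (QuotientAddGroup.mk' D)
    choose C hC hCt using fun f => exists_isClosed_torusCoset hA H (ψ f)
    rw [← hcard]
    have hL : ∀ l ∈ L, ∃ hl : l ∈ H, (⟨l, hl⟩ : H) ∈ D := fun l hl =>
      ⟨le_realSaturation L hl, le_torsionPreimage _ _ hl⟩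
    have hψ : ∀ (t : TorusPoint k M) f, (∀ m : H, charHom t (m : M) = ψ f m) →
        ∀ l ∈ L, charHom t l = charHom t₀ l := by
      intro t f ht l hl
      obtain ⟨hlH, hlD⟩ := hL l hl
      have h0 : QuotientAddGroup.mk' D ⟨l, hlH⟩ = 0 := (QuotientAddGroup.eq_zero_iff _).mpr hlD
      have h1 := ht ⟨l, hlH⟩
      simp only [ψ, AddMonoidHom.add_apply, AddMonoidHom.comp_apply, h0, map_zero, add_zero] at h1
      exact h1
    refine irreducibleComponents_of_partition (fun f => torusCoset u H (ψ f)) C hC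
      (fun f => ?_) (fun f => isIrreducible_torusCoset u H (ψ f)) ?_ ?_
    · ext x
      constructor
      · rintro ⟨t, rfl, ht⟩
        exact ⟨⟨⟨torusMap_mem u _, torusMap_mem_coordTorus _⟩, mem_smoothLocus hA _,
          (gaussMap_torusMap_eq_iff hA _ _).mpr (hψ t f ht)⟩, (hCt f t).mpr ht⟩
      · rintro ⟨⟨hx, -⟩, hxC⟩
        obtain ⟨T, -, rfl⟩ := exists_rep_eq_conePoint hA hx
        exact ⟨_, rfl, (hCt f _).mp hxC⟩
    · rintro f g _ ⟨t, rfl, ht⟩ ⟨t', htt', ht'⟩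
      obtain rfl := torusMap_injective hA htt'
      apply QuotientAddGroup.addMonoidHom_ext
      ext1 m
      have h1 := (ht m).symm.trans (ht' m)
      simp only [ψ, AddMonoidHom.add_apply] at h1
      exact add_left_cancel h1
    · rintro x ⟨hx, hU, hxy⟩
      obtain ⟨T, -, hT⟩ := exists_rep_eq_conePoint hA hx
      obtain ⟨t, rfl⟩ : ∃ t, x = torusMap u t := ⟨_, hT⟩
      have htL := (gaussMap_torusMap_eq_iff hA _ _).mp hxy
      let δ : H →+ Additive kˣ := (charHom t - charHom t₀).comp H.subtype
      -- For `m ∈ D` the multiple `p^s m` lies in `L`, where both characters agree.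
      have hδ : ∀ m ∈ D, δ m = 0 := by
        intro m hm
        apply eq_zero_of_pow_nsmul_eq_zero hp s
        rw [← map_nsmul]
        exact sub_eq_zero.mpr (htL _ hm)
      refine ⟨QuotientAddGroup.lift D δ hδ, t, rfl, fun m => ?_⟩
      exact (add_sub_cancel (charHom t₀ (m : M)) (charHom t (m : M))).symm

end FiberComponents

end ToricGauss

end

/-! ### The structure theorem for the Gauss map of a toric variety -/

theorem corollary3p4 {k M : Type*} [Field k] [IsAlgClosed k] [AddCommGroup M] [Module.Free ℤ M]
    [Module.Finite ℤ M] {N : ℕ} (u : Fin (N + 1) → M) (hu : Function.Injective u)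
    (hA : affineSpan ℤ (Set.range u) = ⊤) :
    let X : Set (ℙ k (Fin (N + 1) → k)) := ToricGauss.toricVariety k u
    let γ := ToricGauss.gaussMap X
    let B : Set M := ToricGauss.setB k u
    let L : AddSubgroup M := ToricGauss.diffLattice B
    let L' : AddSubgroup M := ToricGauss.realSaturation L
    let hL : L ≤ L' := ToricGauss.le_realSaturation L
    -- the decomposition `γ|_{T_M} = g₂ ∘ g₁`, with `g₁ : T_M → T_{L'}` and `g₂ : T_{L'} → T_L`
    -- induced by `L ≤ L' ≤ M` and `T_L` embedded by `J` as the open orbit of `X_B`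
    (∃ J : (B → k) →ₗ[k] ((Fin (ToricGauss.dim X + 1) ↪o Fin (N + 1)) → k),
      Function.Injective J ∧
      ∀ (b₀ : B) (t : ToricGauss.TorusPoint k M),
        ∃ (hx : ToricGauss.torusMap u t ∈ ToricGauss.smoothLocus X)
          (h0 : J (ToricGauss.orbitCoords B b₀ ((t.comp (ToricGauss.torusComorphismTop k L')).comp
            (ToricGauss.torusComorphism k hL))) ≠ 0),
          γ ⟨ToricGauss.torusMap u t, hx⟩ = Projectivization.mk k _ h0) ∧
    (ToricGauss.torusComorphism k hL).toRingHom.Finite ∧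
    -- rank and separability of `γ`
    ToricGauss.HasRank X γ
      (Module.finrank k (affineSpan k (ToricGauss.toModule k '' B)).direction) ∧
    (ToricGauss.IsSeparableMap X γ ↔
      Module.finrank k (affineSpan k (ToricGauss.toModule k '' B)).direction =
        Module.finrank ℤ (affineSpan ℤ B).direction) ∧
    -- degrees of `g₂` and general fibers of `γ` in characteristic `p`
    ∀ p : ℕ, p.Prime → CharP k p →
      ToricGauss.torusDegree k hL = L.relIndex L' ∧
      ∃ s : ℕ, IsGreatest {s : ℕ | p ^ s ∣ ToricGauss.torusDegree k hL} s ∧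
        ToricGauss.torusSepDegree k hL = ToricGauss.torusDegree k hL / p ^ s ∧
        ToricGauss.torusInsepDegree k hL = p ^ s ∧
        ToricGauss.GeneralFiberHasComponents X γ (ToricGauss.torusDegree k hL / p ^ s) ∧
        Nat.Coprime (ToricGauss.torusDegree k hL / p ^ s) p := by
  intro X γ B L L' hL
  have hFG : AddGroup.FG L' := by
    rw [← Module.Finite.iff_addGroup_fg]
    exact inferInstanceAs (Module.Finite ℤ (AddSubgroup.toIntSubmodule L'))
  have : Finite (L' ⧸ L.addSubgroupOf L') := ToricGauss.finite_realSaturation_quotient L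
  refine ⟨ToricGauss.exists_linear_embedding hA hL,
    ToricGauss.torusComorphism_finite k hL fun m hm => ToricGauss.mem_realSaturation.mp hm,
    ToricGauss.hasRank_gaussMap hA, ToricGauss.isSeparableMap_gaussMap_iff hA, ?_⟩
  intro p hp hchar
  have hpos : L.relIndex L' ≠ 0 := Nat.card_pos.ne'
  have hsep := ToricGauss.torusSepDegree_eq k hL hp
  have hprod := ToricGauss.torusSepDegree_mul_torusInsepDegree k hL
  rw [ToricGauss.torusDegree_eq k hL] at hprod ⊢
  set s := (L.relIndex L').factorization p
  set q := Nat.card (L' ⧸ ToricGauss.torsionPreimage (L.addSubgroupOf L') (p ^ s))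
  obtain ⟨hcop, hmul⟩ : q.Coprime p ∧ L.relIndex L' = p ^ s * q :=
    ToricGauss.card_quotient_torsionPreimage (L.addSubgroupOf L') hp
  have hps : 0 < p ^ s := pow_pos hp.pos s
  have hdiv : L.relIndex L' / p ^ s = q := Nat.div_eq_of_eq_mul_right hps hmul
  have hq : q ≠ 0 := by
    intro h
    rw [h, mul_zero] at hmul
    exact hpos hmul
  refine ⟨rfl, s, ⟨Nat.ordProj_dvd _ _, fun r hr => ?_⟩, ?_, ?_, ?_, ?_⟩
  · exact (hp.pow_dvd_iff_le_factorization hpos).mp hr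
  · rw [hdiv, hsep]
  -- The inseparable degree is what remains of `p^s * q` after cancelling the separable degree `q`.
  · rw [hsep, hmul, mul_comm] at hprod
    exact Nat.eq_of_mul_eq_mul_right (Nat.pos_of_ne_zero hq) hprod
  · rw [hdiv]
    exact ToricGauss.generalFiberHasComponents_gaussMap hA hp s hcop
  · rw [hdiv]
    exact hcop
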